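/- **Theorem (stability of the ballistic part).** Let $n\ge 2$ and let $X\subset\mathbb R^n$ be a bounded open convex set with $C^1$ boundary, with outward unit normal $\nu$ and surface measure $d\mu$ on $\partial X$. Set $$\Gamma_-=\{(x,v)\in\partial X\times\mathbb S^{n-1}\;:\; v\cdot\nu(x)<0\},\qquad d\xi=|v\cdot\nu(x)|\,d\mu(x)\,dv,\qquad \tau_+(x,v)=\inf\{s>0\;:\;x+sv\notin X\}.$$ Let $(\sigma,k)$ be optical coefficients: $\sigma(x,v)$ and $k(x,v',v)$ are measurable, nonnegative and bounded for $x\in X$, $v,v'\in\mathbb S^{n-1}$, and there is $\sigma_0>0$ such that $\sigma_a(x,v):=\sigma(x,v)-\int_{\mathbb S^{n-1}}k(x,v,v')\,dv'\ge\sigma_0$ for a.e. $(x,v)\in X\times\mathbb S^{n-1}$. The albedo operator of $(\sigma,k)$ is the bounded operator $$A:L^1(\Gamma_-,d\xi)\to L^1(X),\qquad A\phi(x)=\int_{\mathbb S^{n-1}}\sigma_a(x,v)\,u(x,v)\,dv,$$ where $u\in L^1(X\times\mathbb S^{n-1})$ is the unique solution of $$v\cdot\nabla_x u+\sigma(x,v)u-\int_{\mathbb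 S^{n-1}}k(x,v',v)\,u(x,v')\,dv'=0\ \text{ in } X\times\mathbb S^{n-1},\qquad u=\phi\ \text{ on }\Gamma_-;$$ here $v\cdot\nabla_x u$ is the derivative along lines: for a.e. $(x',v')\in\Gamma_-$ the function $t\mapsto u(x'+tv',v')$ agrees a.e. on $(0,\tau_+(x',v'))$ with an absolutely continuous function on $[0,\tau_+(x',v')]$ which equals $\phi(x',v')$ at $t=0$ and satisfies the equation for a.e. $t$. Let $A$ and $\tilde A$ be the albedo operators of two such pairs $(\sigma,k)$ and $(\tilde\sigma,\tilde k)$. Then for $\xi$-a.e. $(x',v')\in\Gamma_-$ the integrand below is integrable and $$\int_0^{\tau_+(x',v')}\Big|\sigma_a(x'+tv',v')\,e^{-\int_0^t\sigma(x'+sv',v')\,ds}-\tilde\sigma_a(x'+tv',v')\,e^{-\int_0^t\tilde\sigma(x'+sv',v')\,ds}\Big|\,dt\;\le\;\|A-\tilde A\|_{\mathcal L(L^1(\Gamma_-,d\xi);\,L^1(X))}.$$ -/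

import Mathlib

open MeasureTheory Set Filter
open scoped Topology RealInnerProductSpace

noncomputable section

namespace Transport

/-- The physical space `ℝⁿ` with its Euclidean norm. -/
abbrev Space (n : ℕ) : Type := EuclideanSpace ℝ (Fin n)

/-- The unit sphere `𝕊ⁿ⁻¹` of directions. -/
abbrev Dir (n : ℕ) : Type := Metric.sphere (0 : Space n) 1

/-- The surface measure `dv` on `𝕊ⁿ⁻¹`. -/
def dirMeasure (n : ℕ) : Measure (Dir n) := (volume : Measure (Space n)).toSphere

/-- `ν` is the outward unit normal to `X` at the boundary point `x`, near which the boundary of `X`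
is of class `C¹`: near `x` the set `X` is the sublevel set `{ρ < 0}` of a `C¹` function `ρ` with
`∇ρ(x) ≠ 0`, and `ν = ∇ρ(x) / |∇ρ(x)|`. -/
def IsOutwardNormal {n : ℕ} (X : Set (Space n)) (x ν : Space n) : Prop :=
  x ∈ frontier X ∧ ∃ ρ : Space n → ℝ, ContDiffAt ℝ 1 ρ x ∧ gradient ρ x ≠ 0 ∧
    (∀ᶠ y in 𝓝 x, (y ∈ X ↔ ρ y < 0)) ∧ ν = ‖gradient ρ x‖⁻¹ • gradient ρ x

/-- The boundary of `X` is of class `C¹`, with `X` locally on one side of it. -/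
def HasC1Boundary {n : ℕ} (X : Set (Space n)) : Prop :=
  ∀ x ∈ frontier X, ∃ ν, IsOutwardNormal X x ν

open Classical in
/-- The outward unit normal `ν(x)` for `x ∈ ∂X` (and `0` where there is none). -/
def outwardNormal {n : ℕ} (X : Set (Space n)) (x : Space n) : Space n :=
  if h : ∃ ν, IsOutwardNormal X x ν then h.choose else 0

/-- The incoming boundary `Γ₋ = {(x, v) ∈ ∂X × 𝕊ⁿ⁻¹ | v · ν(x) < 0}`. -/
def inflow {n : ℕ} (X : Set (Space n)) : Set (Space n × Dir n) :=
  {p | p.1 ∈ frontier X ∧ ⟪(p.2 : Space n), outwardNormal X p.1⟫ < 0}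

/-- The surface measure `dμ` on `∂X`: the `(n-1)`-dimensional Hausdorff measure, normalized so as
to agree with Lebesgue measure on hyperplanes. -/
def boundaryMeasure {n : ℕ} (X : Set (Space n)) : Measure (Space n) :=
  (Measure.euclideanHausdorffMeasure (n - 1)).restrict (frontier X)

/-- The measure `dξ = |v · ν(x)| dμ(x) dv` on `Γ₋`. -/
def inflowMeasure {n : ℕ} (X : Set (Space n)) : Measure (Space n × Dir n) :=
  (((boundaryMeasure X).prod (dirMeasure n)).withDensity
    fun p => ENNReal.ofReal |⟪(p.2 : Space n), outwardNormal X p.1⟫|).restrict (inflow X)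

/-- Lebesgue measure times surface measure, `dx dv`, on `X × 𝕊ⁿ⁻¹`. -/
def phaseMeasure {n : ℕ} (X : Set (Space n)) : Measure (Space n × Dir n) :=
  ((volume : Measure (Space n)).restrict X).prod (dirMeasure n)

/-- The escape time `τ₊(x, v) = inf {s > 0 | x + s v ∉ X}`. -/
def escapeTime {n : ℕ} (X : Set (Space n)) (x : Space n) (v : Dir n) : ℝ :=
  sInf {s : ℝ | 0 < s ∧ x + s • (v : Space n) ∉ X}

/-- The scattering coefficient `σₛ(x, v) = ∫ k(x, v, v') dv'`. -/
def sigmaS {n : ℕ} (k : Space n → Dir n → Dir n → ℝ) (x : Space n) (v : Dir n) : ℝ :=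
  ∫ v', k x v v' ∂(dirMeasure n)

/-- The intrinsic attenuation coefficient `σₐ = σ - σₛ`. -/
def sigmaA {n : ℕ} (σ : Space n → Dir n → ℝ) (k : Space n → Dir n → Dir n → ℝ)
    (x : Space n) (v : Dir n) : ℝ :=
  σ x v - sigmaS k x v

/-- The standing assumptions on the optical coefficients in `X`: `σ(x, v)` and `k(x, v', v)` are
measurable, nonnegative and bounded in `X`, and `σₐ ≥ σ₀ > 0` almost everywhere in `X × 𝕊ⁿ⁻¹`.
Values outside `X` play no role. -/
structure IsAdmissible {n : ℕ} (X : Set (Space n)) (σ : Space n → Dir n → ℝ)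
    (k : Space n → Dir n → Dir n → ℝ) : Prop where
  measurable_sigma : Measurable fun p : Space n × Dir n => σ p.1 p.2
  measurable_k : Measurable fun p : Space n × Dir n × Dir n => k p.1 p.2.1 p.2.2
  sigma_nonneg : ∀ x ∈ X, ∀ v, 0 ≤ σ x v
  k_nonneg : ∀ x ∈ X, ∀ v' v, 0 ≤ k x v' v
  bounded : ∃ M : ℝ, ∀ x ∈ X, ∀ v, σ x v ≤ M ∧ ∀ v', k x v' v ≤ M
  sigmaA_pos : ∃ σ₀ : ℝ, 0 < σ₀ ∧ ∀ᵐ p ∂(phaseMeasure X), σ₀ ≤ sigmaA σ k p.1 p.2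

/-- `u` solves the boundary value problem
`v · ∇ₓu + σ(x, v) u - ∫ k(x, v', v) u(x, v') dv' = 0` in `X × 𝕊ⁿ⁻¹`, `u = φ` on `Γ₋`.
The derivative `v · ∇ₓu` is that along the characteristics: on almost every line `t ↦ x' + t v'`
with `(x', v') ∈ Γ₋`, `u` has an absolutely continuous version `U` which takes the value
`φ(x', v')` at `t = 0` and satisfies the equation for almost every `t ∈ (0, τ₊(x', v'))`. -/
def IsTransportSolution {n : ℕ} (X : Set (Space n)) (σ : Space n → Dir n → ℝ)
    (k : Space n → Dir n → Dir n → ℝ) (φ u : Space n × Dir n → ℝ) : Prop :=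
  ∀ᵐ p ∂(inflowMeasure X), ∃ U : ℝ → ℝ,
    AbsolutelyContinuousOnInterval U 0 (escapeTime X p.1 p.2) ∧
    U 0 = φ p ∧
    ∀ᵐ t ∂(volume.restrict (Ioo 0 (escapeTime X p.1 p.2))),
      U t = u (p.1 + t • (p.2 : Space n), p.2) ∧
      HasDerivAt U
        (-(σ (p.1 + t • (p.2 : Space n)) p.2 * U t)
          + ∫ v', k (p.1 + t • (p.2 : Space n)) v' p.2 * u (p.1 + t • (p.2 : Space n), v')
              ∂(dirMeasure n)) t

/-- `A` is the albedo operator: for every `φ ∈ L¹(Γ₋, dξ)` the boundary value problem has exactly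
one solution `u` in `L¹(X × 𝕊ⁿ⁻¹)`, and `A φ (x) = ∫ σₐ(x, v) u(x, v) dv`. -/
def IsAlbedoOperator {n : ℕ} (X : Set (Space n)) (σ : Space n → Dir n → ℝ)
    (k : Space n → Dir n → Dir n → ℝ)
    (A : Lp ℝ 1 (inflowMeasure X) →L[ℝ] Lp ℝ 1 ((volume : Measure (Space n)).restrict X)) : Prop :=
  ∀ φ : Lp ℝ 1 (inflowMeasure X), ∃ u : Lp ℝ 1 (phaseMeasure X),
    IsTransportSolution X σ k φ u ∧
    (∀ w : Lp ℝ 1 (phaseMeasure X), IsTransportSolution X σ k φ w → w = u) ∧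
    A φ =ᵐ[(volume : Measure (Space n)).restrict X]
      fun x => ∫ v, sigmaA σ k x v * u (x, v) ∂(dirMeasure n)

/-- There is at most one albedo operator, so that the next definition is unambiguous. -/
theorem IsAlbedoOperator.unique {n : ℕ} {X : Set (Space n)} {σ : Space n → Dir n → ℝ}
    {k : Space n → Dir n → Dir n → ℝ}
    {A B : Lp ℝ 1 (inflowMeasure X) →L[ℝ] Lp ℝ 1 ((volume : Measure (Space n)).restrict X)}
    (hA : IsAlbedoOperator X σ k A) (hB : IsAlbedoOperator X σ k B) : A = B := by
  ext1 φ
  obtain ⟨u, hu, -, hAu⟩ := hA φ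
  obtain ⟨w, -, hw, hBw⟩ := hB φ
  obtain rfl := hw u hu
  exact Lp.ext (hAu.trans hBw.symm)

open Classical in
/-- The albedo operator `A : L¹(Γ₋, dξ) → L¹(X)` of the optical coefficients `(σ, k)`. (The default
value is never taken for admissible coefficients on the domains considered.) -/
def albedoOperator {n : ℕ} (X : Set (Space n)) (σ : Space n → Dir n → ℝ)
    (k : Space n → Dir n → Dir n → ℝ) :
    Lp ℝ 1 (inflowMeasure X) →L[ℝ] Lp ℝ 1 ((volume : Measure (Space n)).restrict X) :=
  if h : ∃ A, IsAlbedoOperator X σ k A then h.choose else 0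

/-- The ballistic profile `σₐ(x + t v, v) exp(-∫₀ᵗ σ(x + s v, v) ds)`. -/
def ballisticProfile {n : ℕ} (σ : Space n → Dir n → ℝ) (k : Space n → Dir n → Dir n → ℝ)
    (x : Space n) (v : Dir n) (t : ℝ) : ℝ :=
  sigmaA σ k (x + t • (v : Space n)) v *
    Real.exp (-∫ s in (0 : ℝ)..t, σ (x + s • (v : Space n)) v)

end Transport

end

/-!
Stability of the ballistic part of the albedo operator.

Why the estimate holds. Particles that are never scattered stay on the line on which they entered,
whereas scattered particles spread over all directions. If the inflow is concentrated near a point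
`(x', v')` of the incoming boundary and absorption is measured only in a thin tube around the line
`x' + t v'`, the scattered particles hardly contribute, and what is measured is the ballistic
profile `σₐ exp(-∫ σ)` on that line. The difference of two albedo operators therefore sees, on
almost every line, the difference of the two ballistic profiles.

Geometry. The map `((x', v'), t) ↦ (x' + t v', v')` transports `dξ dt` to `dx dv`
(`IsSmoothConvexDomain.measurePreserving_flow`). For a fixed direction this is an area formula
(`map_sweep`): by convexity the normal is continuous, so that the boundary is nearly flat on small
scales, and sweeping a flat piece in the direction `v` is close to a linear map of determinant
`v · ν`.

Well-posedness. On a line the transport equation is a linear ordinary differential equation, solved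
by `lineSol`, and `stream` collects these solutions. Since `σ - σₛ ≥ σ₀ > 0`, streaming followed by
scattering is a contraction of `L¹`, so that a Neumann series gives the albedo operator
(`exists_isAlbedoOperator`) and the solution is the streamed inflow plus the streamed scattered
particles.

Dispersion. For a weight `ψ` with `|ψ| ≤ 1`, polar coordinates around each point of emission show
that the `ψ`-average of the scattered particles is at most a constant times
`(η + η^(1-n) ∫ |ψ|) ‖φ‖` for every `η > 0` (`lintegral_mul_stream_scatter_le`). Hence, for almost
every ray, the `ψ`-average of the difference of the profiles is at most `‖A - A'‖` plus such an error
(`ae_abs_ballistic_average_le`).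

Localization. The exceptional set can be chosen independent of the continuous weight `ψ`, by
separability (`ae_forall_continuous_abs_integral_le`). On a fixed ray one may then let `ψ`
concentrate on the line, which is a null set because `n ≥ 2`, let `η` tend to zero, and use that the
`L¹` norm is the supremum of the integrals against continuous functions of modulus at most one
(`integral_abs_ray_le`).
-/

noncomputable section

namespace Transport

open scoped NNReal ENNReal

/-! ### The geometry of smooth convex sets -/

section

variable {n : ℕ} {X : Set (Space n)}

theorem IsOutwardNormal.norm_eq_one {x ν : Space n} (h : IsOutwardNormal X x ν) : ‖ν‖ = 1 := by
  obtain ⟨-, ρ, -, hg, -, rfl⟩ := h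
  rw [norm_smul, norm_inv, norm_norm, inv_mul_cancel₀ (norm_ne_zero_iff.2 hg)]

/-- Points between a point of the closure and a point of an open convex set lie in the set. -/
theorem add_smul_mem_of_mem_closure (ho : IsOpen X) (hc : Convex ℝ X) {x w : Space n}
    (hx : x ∈ closure X) {s r : ℝ} (hs : x + s • w ∈ X) (hr : 0 < r) (hrs : r ≤ s) :
    x + r • w ∈ X := by
  have hs0 : 0 < s := hr.trans_le hrs
  have := hc.add_smul_sub_mem_interior' hx (by rwa [ho.interior_eq] : x + s • w ∈ interior X)
    (t := r / s) ⟨by positivity, (div_le_one hs0).2 hrs⟩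
  rw [ho.interior_eq, add_sub_cancel_left, smul_smul, div_mul_cancel₀ _ hs0.ne'] at this
  exact this

/-- A supporting hyperplane of an open set does not meet the set. -/
theorem inner_neg_of_forall_inner_nonpos (ho : IsOpen X) {x ν z : Space n} (hν : ‖ν‖ = 1)
    (h : ∀ y ∈ X, ⟪y - x, ν⟫ ≤ 0) (hz : z ∈ X) : ⟪z - x, ν⟫ < 0 := by
  have hc : Continuous fun e : ℝ => z + e • ν := by fun_prop
  have hev : ∀ᶠ e in 𝓝 (0 : ℝ), z + e • ν ∈ X :=
    hc.continuousAt.eventually_mem (by simpa using ho.mem_nhds hz)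
  obtain ⟨e, he, he0⟩ := ((hev.filter_mono nhdsWithin_le_nhds).and
    (self_mem_nhdsWithin : Ioi (0 : ℝ) ∈ 𝓝[>] 0)).exists
  have h1 := h _ he
  rw [add_sub_right_comm, inner_add_left, real_inner_smul_left, real_inner_self_eq_norm_sq,
    hν] at h1
  have : (0 : ℝ) < e := he0
  nlinarith

/-- An outward normal of an open convex set determines the cone of the directions that point into
the set. -/
theorem IsOutwardNormal.inner_neg_iff (ho : IsOpen X) (hc : Convex ℝ X) {x ν : Space n}
    (h : IsOutwardNormal X x ν) (w : Space n) :
    ⟪w, ν⟫ < 0 ↔ ∃ s : ℝ, 0 < s ∧ x + s • w ∈ X := by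
  have hν := h.norm_eq_one
  obtain ⟨hx, ρ, hρ, hg, hev, hνe⟩ := h
  have hgrad := (hρ.differentiableAt one_ne_zero).hasGradientAt
  have hgn : 0 < ‖gradient ρ x‖ := norm_pos_iff.2 hg
  have hρx : ρ x = 0 := by
    refine le_antisymm ?_ ?_
    · have hfr : ∃ᶠ y in 𝓝 x, y ∈ X := mem_closure_iff_frequently.1 hx.1
      exact le_of_tendsto_of_frequently hρ.continuousAt
        ((hfr.and_eventually hev).mono fun y hy => (hy.2.1 hy.1).le)
    · by_contra! hlt
      exact (ho.frontier_eq ▸ hx).2 (hev.self_of_nhds.2 hlt)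
  have hline : ∀ w : Space n, HasDerivAt (fun s : ℝ => ρ (x + s • w)) ⟪gradient ρ x, w⟫ 0 := by
    intro w
    have h1 : HasDerivAt (fun s : ℝ => x + s • w) w 0 := by
      simpa using ((hasDerivAt_id (0 : ℝ)).smul_const w).const_add x
    have h2 : HasFDerivAt ρ ((InnerProductSpace.toDual ℝ (Space n)) (gradient ρ x))
        (x + (0 : ℝ) • w) := by simpa using hgrad.hasFDerivAt
    simpa [Function.comp_def] using h2.comp_hasDerivAt (0 : ℝ) h1
  have hevl : ∀ w : Space n, ∀ᶠ s in 𝓝[>] (0 : ℝ), (x + s • w ∈ X ↔ ρ (x + s • w) < 0) := by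
    intro w
    have hcw : Continuous fun s : ℝ => x + s • w := by fun_prop
    exact nhdsWithin_le_nhds ((hcw.tendsto' 0 x (by simp)).eventually hev)
  have hin : ∀ w : Space n, ⟪w, ν⟫ = ‖gradient ρ x‖⁻¹ * ⟪gradient ρ x, w⟫ := by
    intro w
    rw [hνe, real_inner_smul_right, real_inner_comm]
  constructor
  · intro hw
    have hneg : ⟪gradient ρ x, w⟫ < 0 := by
      rw [hin] at hw
      by_contra! h0
      exact hw.not_ge (by positivity)
    have h1 : ∀ᶠ s in 𝓝[>] (0 : ℝ), slope (fun s : ℝ => ρ (x + s • w)) 0 s < 0 :=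
      ((hasDerivAt_iff_tendsto_slope.1 (hline w)).mono_left
        (nhdsWithin_mono _ fun s hs => (ne_of_gt hs))).eventually_lt_const hneg
    obtain ⟨s, ⟨hs1, hs2⟩, hs0⟩ := ((h1.and (hevl w)).and
      (self_mem_nhdsWithin : Ioi (0 : ℝ) ∈ 𝓝[>] 0)).exists
    have hs0 : (0 : ℝ) < s := hs0
    refine ⟨s, hs0, hs2.2 ?_⟩
    simp only [slope_def_field, zero_smul, add_zero, hρx, sub_zero] at hs1
    by_contra! h0
    exact hs1.not_ge (by positivity)
  · rintro ⟨s, hs, hsX⟩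
    -- by convexity the whole set lies on the inner side of its tangent hyperplane
    have key : ∀ y ∈ X, ⟪y - x, ν⟫ ≤ 0 := by
      intro y hy
      have h1 : ∀ᶠ s in 𝓝[>] (0 : ℝ), slope (fun s : ℝ => ρ (x + s • (y - x))) 0 s ≤ 0 := by
        filter_upwards [hevl (y - x), Ioc_mem_nhdsGT (zero_lt_one' ℝ)] with s hs1 hs2
        have := hs1.1 (add_smul_mem_of_mem_closure ho hc hx.1 (s := 1) (by simpa) hs2.1 hs2.2)
        simp only [slope_def_field, zero_smul, add_zero, hρx, sub_zero]
        exact div_nonpos_of_nonpos_of_nonneg this.le hs2.1.le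
      have h2 := le_of_tendsto (x := 𝓝[>] (0 : ℝ))
        ((hasDerivAt_iff_tendsto_slope.1 (hline (y - x))).mono_left
          (nhdsWithin_mono _ fun s (hs : (0 : ℝ) < s) => hs.ne')) h1
      rw [hin]
      exact mul_nonpos_of_nonneg_of_nonpos (by positivity) h2
    have h3 := inner_neg_of_forall_inner_nonpos ho hν key hsX
    rw [add_sub_cancel_left, real_inner_smul_left] at h3
    by_contra! h0
    exact h3.not_ge (by positivity)

/-- A unit vector is determined by its negative half-space. -/
theorem eq_of_inner_neg_iff {ν ν' : Space n} (h : ‖ν‖ = 1) (h' : ‖ν'‖ = 1)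
    (hh : ∀ w : Space n, ⟪w, ν⟫ < 0 → ⟪w, ν'⟫ < 0) : ν = ν' := by
  by_contra hne
  have hlt : ⟪ν, ν'⟫ < 1 := (inner_lt_one_iff_real_of_norm_eq_one h h').2 hne
  have h1 := hh (ν' - ν) (by
    rw [inner_sub_left, real_inner_self_eq_norm_sq, h, real_inner_comm]; linarith)
  rw [inner_sub_left, real_inner_self_eq_norm_sq, h'] at h1
  linarith

theorem outwardNormal_spec (hC : HasC1Boundary X) {x : Space n} (hx : x ∈ frontier X) :
    IsOutwardNormal X x (outwardNormal X x) := by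
  have h := hC x hx
  rw [outwardNormal, dif_pos h]
  exact h.choose_spec

theorem norm_outwardNormal (hC : HasC1Boundary X) {x : Space n} (hx : x ∈ frontier X) :
    ‖outwardNormal X x‖ = 1 :=
  (outwardNormal_spec hC hx).norm_eq_one

theorem norm_outwardNormal_le (hC : HasC1Boundary X) (x : Space n) :
    ‖outwardNormal X x‖ ≤ 1 := by
  by_cases hx : x ∈ frontier X
  · exact (norm_outwardNormal hC hx).le
  · rw [outwardNormal, dif_neg]
    · simp
    · rintro ⟨ν, hν⟩
      exact hx hν.1

theorem outwardNormal_of_notMem {x : Space n} (hx : x ∉ frontier X) : outwardNormal X x = 0 := by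
  rw [outwardNormal, dif_neg]
  rintro ⟨ν, hν⟩
  exact hx hν.1

theorem inner_outwardNormal_neg_iff (ho : IsOpen X) (hc : Convex ℝ X) (hC : HasC1Boundary X)
    {x : Space n} (hx : x ∈ frontier X) (w : Space n) :
    ⟪w, outwardNormal X x⟫ < 0 ↔ ∃ s : ℝ, 0 < s ∧ x + s • w ∈ X :=
  (outwardNormal_spec hC hx).inner_neg_iff ho hc w

theorem inner_sub_outwardNormal_neg (ho : IsOpen X) (hc : Convex ℝ X) (hC : HasC1Boundary X)
    {x y : Space n} (hx : x ∈ frontier X) (hy : y ∈ X) : ⟪y - x, outwardNormal X x⟫ < 0 :=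
  (inner_outwardNormal_neg_iff ho hc hC hx _).2 ⟨1, one_pos, by simpa⟩

theorem inner_sub_outwardNormal_nonpos (ho : IsOpen X) (hc : Convex ℝ X) (hC : HasC1Boundary X)
    {x y : Space n} (hx : x ∈ frontier X) (hy : y ∈ closure X) :
    ⟪y - x, outwardNormal X x⟫ ≤ 0 := by
  have hcl : IsClosed {y : Space n | ⟪y - x, outwardNormal X x⟫ ≤ 0} :=
    isClosed_le (by fun_prop) continuous_const
  exact closure_minimal (fun z hz => (inner_sub_outwardNormal_neg ho hc hC hx hz).le) hcl hy

/-- The normal is continuous along the boundary: a limit of normals supports `X`, and the supporting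
half-space of a smooth convex set is unique. -/
theorem continuousOn_outwardNormal (ho : IsOpen X) (hc : Convex ℝ X) (hC : HasC1Boundary X) :
    ContinuousOn (outwardNormal X) (frontier X) := by
  rw [continuousOn_iff_continuous_domRestrict]
  have hball : ∀ x : frontier X, outwardNormal X x ∈ Metric.closedBall (0 : Space n) 1 :=
    fun x => by simpa using norm_outwardNormal_le hC (x : Space n)
  let f : frontier X → Metric.closedBall (0 : Space n) 1 := fun x => ⟨outwardNormal X x, hball x⟩
  suffices hf : Continuous f from continuous_subtype_val.comp hf
  have : CompactSpace (Metric.closedBall (0 : Space n) 1) :=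
    isCompact_iff_compactSpace.1 (isCompact_closedBall _ _)
  -- the graph of the normal, given by closed conditions
  let G : Set (frontier X × Metric.closedBall (0 : Space n) 1) :=
    {q | ‖(q.2 : Space n)‖ = 1} ∩ ⋂ y ∈ X, {q | ⟪y - (q.1 : Space n), (q.2 : Space n)⟫ ≤ 0}
  have hG : IsClosed G := IsClosed.inter (isClosed_eq (by fun_prop) continuous_const)
    (isClosed_biInter fun y _ => isClosed_le (by fun_prop) continuous_const)
  have hGf : ∀ q, q ∈ G ↔ f q.1 = q.2 := by
    rintro ⟨x, ν⟩
    simp only [G, mem_inter_iff, mem_iInter, mem_ofPred_eq]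
    constructor
    · rintro ⟨h1, h2⟩
      refine Subtype.ext (eq_of_inner_neg_iff (norm_outwardNormal hC x.2) h1 fun w hw => ?_)
      obtain ⟨s, hs, hsX⟩ := (inner_outwardNormal_neg_iff ho hc hC x.2 w).1 hw
      have h3 := inner_neg_of_forall_inner_nonpos ho h1 h2 hsX
      rw [add_sub_cancel_left, real_inner_smul_left] at h3
      by_contra! h0
      exact h3.not_ge (by positivity)
    · rintro rfl
      exact ⟨norm_outwardNormal hC x.2,
        fun y hy => (inner_sub_outwardNormal_neg ho hc hC x.2 hy).le⟩
  refine continuous_iff_isClosed.2 fun C hC' => ?_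
  convert isClosedMap_fst_of_compactSpace _ (hG.inter (hC'.preimage continuous_snd)) using 1
  ext x
  simp [hGf]

theorem measurable_outwardNormal (ho : IsOpen X) (hc : Convex ℝ X) (hC : HasC1Boundary X) :
    Measurable (outwardNormal X) := by
  classical
  have h := ContinuousOn.measurable_piecewise (s := frontier X) (f := outwardNormal X)
    (g := fun _ => 0) (continuousOn_outwardNormal ho hc hC) continuousOn_const
    isClosed_frontier.measurableSet
  convert h using 1
  ext1 x
  by_cases hx : x ∈ frontier X
  · simp [hx]
  · simp [hx, outwardNormal_of_notMem hx]

/-- Near one of its points the boundary of a smooth convex set is nearly orthogonal to the normal: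
by convexity two boundary points lie on the inner side of each other's tangent hyperplane, and these
hyperplanes vary continuously. -/
theorem exists_abs_inner_sub_le (ho : IsOpen X) (hc : Convex ℝ X) (hC : HasC1Boundary X)
    {x₀ : Space n} (hx₀ : x₀ ∈ frontier X) {δ : ℝ} (hδ : 0 < δ) :
    ∃ U ∈ 𝓝[frontier X] x₀, ∀ x ∈ U, ∀ z ∈ U,
      |⟪x - z, outwardNormal X x₀⟫| ≤ δ * ‖x - z‖ := by
  have hev : ∀ᶠ x in 𝓝[frontier X] x₀,
      x ∈ frontier X ∧ ‖outwardNormal X x - outwardNormal X x₀‖ < δ := by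
    refine (eventually_mem_nhdsWithin).and ?_
    have := (continuousOn_outwardNormal ho hc hC x₀ hx₀).eventually
      (Metric.ball_mem_nhds _ hδ)
    simpa [dist_eq_norm] using this
  have key : ∀ x z : Space n, x ∈ frontier X → z ∈ frontier X →
      ‖outwardNormal X x - outwardNormal X x₀‖ < δ →
      ⟪z - x, outwardNormal X x₀⟫ ≤ δ * ‖x - z‖ := by
    intro x z hx hz hxδ
    have h1 := inner_sub_outwardNormal_nonpos ho hc hC hx hz.1
    have h2 := real_inner_le_norm (z - x) (outwardNormal X x₀ - outwardNormal X x)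
    rw [inner_sub_right, norm_sub_rev (outwardNormal X x₀), norm_sub_rev z x] at h2
    nlinarith [norm_nonneg (x - z)]
  refine ⟨_, hev, fun x hx z hz => ?_⟩
  rw [abs_le]
  constructor
  · have := key x z hx.1 hz.1 hx.2
    rw [← neg_sub x z, inner_neg_left] at this
    linarith
  · have := key z x hz.1 hx.1 hz.2
    rwa [norm_sub_rev] at this

theorem mem_inflow_iff (ho : IsOpen X) (hc : Convex ℝ X) (hC : HasC1Boundary X)
    {p : Space n × Dir n} :
    p ∈ inflow X ↔ p.1 ∈ frontier X ∧ ∃ s : ℝ, 0 < s ∧ p.1 + s • (p.2 : Space n) ∈ X :=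
  and_congr_right fun h => inner_outwardNormal_neg_iff ho hc hC h _

theorem measurableSet_inflow (ho : IsOpen X) (hc : Convex ℝ X) (hC : HasC1Boundary X) :
    MeasurableSet (inflow X) := by
  have : inflow X = (Prod.fst ⁻¹' frontier X) ∩
      ⋃ s : ℝ, ⋃ _ : 0 < s, {p : Space n × Dir n | p.1 + s • (p.2 : Space n) ∈ X} := by
    ext p
    simp [mem_inflow_iff ho hc hC]
  rw [this]
  refine (isClosed_frontier.measurableSet.preimage measurable_fst).inter (IsOpen.measurableSet ?_)
  exact isOpen_iUnion fun s => isOpen_iUnion fun _ => ho.preimage (by fun_prop)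

/-- Along a ray that enters `X`, the points of `X` are those before the escape time. -/
theorem lt_escapeTime_iff (ho : IsOpen X) (hb : Bornology.IsBounded X) (hc : Convex ℝ X)
    {x : Space n} {v : Dir n} (hx : x ∈ closure X) {t : ℝ} (ht : 0 < t) :
    t < escapeTime X x v ↔ x + t • (v : Space n) ∈ X := by
  have hbdd : BddBelow {s : ℝ | 0 < s ∧ x + s • (v : Space n) ∉ X} := ⟨0, fun s hs => hs.1.le⟩
  constructor
  · intro hlt
    by_contra hX
    exact hlt.not_ge (csInf_le hbdd ⟨ht, hX⟩)
  · intro htX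
    have hcw : Continuous fun s : ℝ => x + s • (v : Space n) := by fun_prop
    have hev : ∀ᶠ s in 𝓝[>] t, x + s • (v : Space n) ∈ X :=
      nhdsWithin_le_nhds (hcw.continuousAt.eventually_mem (ho.mem_nhds htX))
    obtain ⟨s, hs, hts⟩ := (hev.and self_mem_nhdsWithin).exists
    refine lt_of_lt_of_le hts (le_csInf ?_ ?_)
    · -- the ray leaves the bounded set, so that the infimum is not that of the empty set
      obtain ⟨R, hR⟩ := hb.exists_norm_le
      refine ⟨max (‖x‖ + R + 1) 1, by positivity, fun hmem => ?_⟩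
      have h1 := hR _ hmem
      have hv : ‖(v : Space n)‖ = 1 := by simp
      have h2 : ‖(max (‖x‖ + R + 1) 1 : ℝ) • (v : Space n)‖
          ≤ ‖x + (max (‖x‖ + R + 1) 1 : ℝ) • (v : Space n)‖ + ‖x‖ := by
        simpa using norm_sub_le (x + (max (‖x‖ + R + 1) 1 : ℝ) • (v : Space n)) x
      rw [norm_smul, hv, mul_one, Real.norm_of_nonneg (by positivity)] at h2
      linarith [le_max_left (‖x‖ + R + 1) 1]
    · rintro r ⟨hr0, hr⟩
      by_contra! hrs
      exact hr (add_smul_mem_of_mem_closure ho hc hx hs hr0 hrs.le)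

theorem escapeTime_pos (ho : IsOpen X) (hb : Bornology.IsBounded X) (hc : Convex ℝ X)
    {x : Space n} {v : Dir n} (hx : x ∈ closure X)
    (hin : ∃ s : ℝ, 0 < s ∧ x + s • (v : Space n) ∈ X) : 0 < escapeTime X x v := by
  obtain ⟨s, hs, hsX⟩ := hin
  exact hs.trans ((lt_escapeTime_iff ho hb hc hx hs).2 hsX)

/-- Where a ray that meets `X` leaves it, it crosses the boundary. -/
theorem add_escapeTime_smul_mem_frontier (ho : IsOpen X) (hb : Bornology.IsBounded X)
    (hc : Convex ℝ X) {x : Space n} {v : Dir n} (hx : x ∈ X) :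
    x + escapeTime X x v • (v : Space n) ∈ frontier X := by
  have hcw : Continuous fun s : ℝ => x + s • (v : Space n) := by fun_prop
  have hin : ∃ s : ℝ, 0 < s ∧ x + s • (v : Space n) ∈ X := by
    have hev : ∀ᶠ s in 𝓝[>] (0 : ℝ), x + s • (v : Space n) ∈ X :=
      nhdsWithin_le_nhds (hcw.continuousAt.eventually_mem (by simpa using ho.mem_nhds hx))
    obtain ⟨s, hs, hs0⟩ := (hev.and self_mem_nhdsWithin).exists
    exact ⟨s, hs0, hs⟩
  have hpos := escapeTime_pos ho hb hc (subset_closure hx) hin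
  have hiff := fun t ht => lt_escapeTime_iff ho hb hc (v := v) (subset_closure hx) (t := t) ht
  rw [ho.frontier_eq]
  refine ⟨?_, fun h => lt_irrefl _ ((hiff _ hpos).2 h)⟩
  refine mem_closure_of_tendsto
    (hcw.continuousWithinAt (s := Iio (escapeTime X x v)) (x := escapeTime X x v)) ?_
  filter_upwards [Ioo_mem_nhdsLT hpos] with s hs
  exact (hiff s hs.1).1 hs.2

/-- A bounded open convex set with `C¹` boundary in a space of positive dimension. -/
structure IsSmoothConvexDomain (X : Set (Space n)) : Prop where
  pos : 0 < n
  isOpen : IsOpen X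
  isBounded : Bornology.IsBounded X
  convex : Convex ℝ X
  c1 : HasC1Boundary X

/-- The time that a particle at `x` with velocity `v` has spent in `X` (and `0` for `x ∉ X`). -/
def backTime (X : Set (Space n)) (x : Space n) (v : Dir n) : ℝ :=
  open Classical in if x ∈ X then escapeTime X x (-v) else 0

namespace IsSmoothConvexDomain

theorem lt_backTime_iff (hX : IsSmoothConvexDomain X) {x : Space n} (hx : x ∈ X) {v : Dir n}
    {s : ℝ} (hs : 0 < s) : s < backTime X x v ↔ x - s • (v : Space n) ∈ X := by
  rw [backTime, if_pos hx,
    lt_escapeTime_iff hX.isOpen hX.isBounded hX.convex (subset_closure hx) hs]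
  simp [sub_eq_add_neg]

theorem backTime_pos (hX : IsSmoothConvexDomain X) {x : Space n} (hx : x ∈ X) (v : Dir n) :
    0 < backTime X x v := by
  have hcw : Continuous fun s : ℝ => x + s • ((-v : Dir n) : Space n) := by fun_prop
  have hev : ∀ᶠ s in 𝓝[>] (0 : ℝ), x + s • ((-v : Dir n) : Space n) ∈ X :=
    nhdsWithin_le_nhds (hcw.continuousAt.eventually_mem (by simpa using hX.isOpen.mem_nhds hx))
  obtain ⟨s, hs, hs0⟩ := (hev.and self_mem_nhdsWithin).exists
  rw [backTime, if_pos hx]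
  exact escapeTime_pos hX.isOpen hX.isBounded hX.convex (subset_closure hx) ⟨s, hs0, hs⟩

theorem sub_backTime_smul_mem_frontier (hX : IsSmoothConvexDomain X) {x : Space n} (hx : x ∈ X)
    (v : Dir n) : x - backTime X x v • (v : Space n) ∈ frontier X := by
  have h := add_escapeTime_smul_mem_frontier hX.isOpen hX.isBounded hX.convex hx (v := -v)
  rw [backTime, if_pos hx]
  simpa [sub_eq_add_neg] using h

theorem notMem_of_mem_frontier (hX : IsSmoothConvexDomain X) {x : Space n}
    (hx : x ∈ frontier X) : x ∉ X :=
  (hX.isOpen.frontier_eq ▸ hx).2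

theorem backTime_add_smul (hX : IsSmoothConvexDomain X) {x : Space n} {v : Dir n} {t : ℝ}
    (hx : x ∈ frontier X) (ht : 0 < t) (hxt : x + t • (v : Space n) ∈ X) :
    backTime X (x + t • (v : Space n)) v = t := by
  refine le_antisymm (not_lt.1 fun h => ?_) (le_of_forall_lt fun s hs => ?_)
  · rw [hX.lt_backTime_iff hxt ht, add_sub_cancel_right] at h
    exact hX.notMem_of_mem_frontier hx h
  · rcases le_or_gt s 0 with hs0 | hs0
    · exact hs0.trans_lt (hX.backTime_pos hxt v)
    · rw [hX.lt_backTime_iff hxt hs0, add_sub_assoc, ← sub_smul]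
      exact add_smul_mem_of_mem_closure hX.isOpen hX.convex hx.1 hxt (sub_pos.2 hs) (by linarith)

theorem measurable_backTime (hX : IsSmoothConvexDomain X) :
    Measurable fun p : Space n × Dir n => backTime X p.1 p.2 := by
  refine measurable_of_Ioi fun s => ?_
  rcases lt_or_ge s 0 with hs | hs
  · convert MeasurableSet.univ
    ext p
    simp only [mem_preimage, mem_Ioi, mem_univ, iff_true]
    by_cases hp : p.1 ∈ X
    · exact hs.trans (hX.backTime_pos hp p.2)
    · simpa [backTime, hp] using hs
  · have : (fun p : Space n × Dir n => backTime X p.1 p.2) ⁻¹' Ioi s =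
        {p | p.1 ∈ X ∧ p.1 - s • (p.2 : Space n) ∈ X} := by
      ext p
      simp only [mem_preimage, mem_Ioi, mem_ofPred_eq]
      by_cases hp : p.1 ∈ X
      · rcases hs.eq_or_lt with rfl | hs
        · simpa [hp] using hX.backTime_pos hp p.2
        · simp [hp, hX.lt_backTime_iff hp hs]
      · simpa [backTime, hp] using hs
    rw [this]
    exact ((hX.isOpen.preimage continuous_fst).inter
      (hX.isOpen.preimage (by fun_prop : Continuous fun p : Space n × Dir n =>
        p.1 - s • (p.2 : Space n)))).measurableSet

end IsSmoothConvexDomain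

end

/-! ### Flat pieces of a hypersurface -/

section

variable {n : ℕ} {X : Set (Space n)}

/-- If a measure is locally dominated by another one, with constants arbitrarily close to one, then
it is dominated by it: countably many of the neighbourhoods cover `Ω`. The constants are written as
cubes because three approximations are combined where this is applied. -/
theorem measure_le_of_local {α : Type*} [TopologicalSpace α] [SecondCountableTopology α]
    [MeasurableSpace α] [OpensMeasurableSpace α] {m₁ m₂ : Measure α} {Ω : Set α}
    (hΩ : MeasurableSet Ω) (h0 : m₁ Ωᶜ = 0)
    (h : ∀ r : ℝ≥0, 1 < r → ∀ x ∈ Ω, ∃ U ∈ 𝓝 x, ∀ B, MeasurableSet B → B ⊆ U ∩ Ω →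
      m₁ B ≤ (r : ℝ≥0∞) ^ 3 * m₂ B) : m₁ ≤ m₂ := by
  have key : ∀ r : ℝ≥0, 1 < r → ∀ B, MeasurableSet B → m₁ B ≤ (r : ℝ≥0∞) ^ 3 * m₂ B := by
    intro r hr B hB
    choose! U hU hUB using h r hr
    obtain ⟨t, htΩ, htc, htU⟩ := TopologicalSpace.countable_cover_nhdsWithin
      (s := Ω) (f := fun x => interior (U x))
      (fun x hx => mem_nhdsWithin_of_mem_nhds (interior_mem_nhds.2 (hU x hx)))
    rcases t.eq_empty_or_nonempty with rfl | hne
    · have hΩe : Ω = ∅ := by simpa [subset_empty_iff] using htU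
      have : m₁ B = 0 := measure_mono_null (by simp [hΩe]) h0
      simp [this]
    obtain ⟨f, hf⟩ := htc.exists_eq_range hne
    let D : ℕ → Set α := fun i => (B ∩ Ω) ∩ disjointed (fun i => interior (U (f i))) i
    have hDm : ∀ i, MeasurableSet (D i) := fun i => (hB.inter hΩ).inter
      (MeasurableSet.disjointed (fun i => isOpen_interior.measurableSet) i)
    have hDd : Pairwise (Function.onFun Disjoint D) := fun i j hij =>
      (disjoint_disjointed _ hij).mono inter_subset_right inter_subset_right
    have hDU : ⋃ i, D i = B ∩ Ω := by
      rw [← inter_iUnion, iUnion_disjointed]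
      refine inter_eq_left.2 fun x hx => ?_
      have := htU hx.2
      simpa [hf] using this
    calc m₁ B ≤ m₁ (B ∩ Ω) + m₁ Ωᶜ :=
          (measure_mono fun x hx => by
            by_cases hxΩ : x ∈ Ω
            · exact Or.inl ⟨hx, hxΩ⟩
            · exact Or.inr hxΩ).trans (measure_union_le _ _)
      _ = ∑' i, m₁ (D i) := by rw [h0, add_zero, ← hDU, measure_iUnion hDd hDm]
      _ ≤ ∑' i, (r : ℝ≥0∞) ^ 3 * m₂ (D i) := by
          refine ENNReal.tsum_le_tsum fun i => hUB (f i) (htΩ (hf ▸ mem_range_self i)) _ (hDm i) ?_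
          exact fun x hx => ⟨interior_subset (disjointed_subset _ i hx.2), hx.1.2⟩
      _ = (r : ℝ≥0∞) ^ 3 * m₂ (B ∩ Ω) := by
          rw [ENNReal.tsum_mul_left, ← hDU, measure_iUnion hDd hDm]
      _ ≤ _ := by gcongr; exact inter_subset_left
  refine Measure.le_iff.2 fun B hB => ?_
  by_cases htop : m₂ B = ∞
  · simp [htop]
  have hlim : Tendsto (fun r : ℝ≥0 => (r : ℝ≥0∞) ^ 3 * m₂ B) (𝓝[>] 1) (𝓝 (m₂ B)) := by
    have hc : Tendsto (fun r : ℝ≥0 => ((r ^ 3 : ℝ≥0) : ℝ≥0∞)) (𝓝 1) (𝓝 1) := by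
      have h1 : Continuous fun r : ℝ≥0 => ((r ^ 3 : ℝ≥0) : ℝ≥0∞) :=
        ENNReal.continuous_coe.comp (by fun_prop)
      simpa using h1.tendsto 1
    have := ENNReal.Tendsto.mul_const (b := m₂ B) (hc.mono_left (nhdsWithin_le_nhds (s := Ioi 1)))
      (Or.inr htop)
    simpa using this
  exact ge_of_tendsto hlim (eventually_mem_nhdsWithin.mono fun r hr => key r hr B hB)

/-- Orthogonal coordinates in which a given unit vector is the last basis vector. -/
theorem exists_orthogonal_coordinates {d : ℕ} {ν : Space (d + 1)} (hν : ‖ν‖ = 1) :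
    ∃ L : WithLp 2 (Space d × ℝ) ≃ₗᵢ[ℝ] Space (d + 1), L (WithLp.toLp 2 (0, 1)) = ν := by
  have hν0 : ν ≠ 0 := by rintro rfl; simp at hν
  have : Fact (Module.finrank ℝ (Space (d + 1)) = d + 1) := ⟨by simp⟩
  let b := OrthonormalBasis.fromOrthogonalSpanSingleton (𝕜 := ℝ) d hν0
  let e : Space d →ₗᵢ[ℝ] Space (d + 1) :=
    ((ℝ ∙ ν)ᗮ).subtypeₗᵢ.comp b.repr.symm.toLinearIsometry
  have he : ∀ w, ⟪e w, ν⟫ = 0 := fun w =>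
    Submodule.mem_orthogonal_singleton_iff_inner_left.1 (b.repr.symm w).2
  let l : WithLp 2 (Space d × ℝ) →ₗ[ℝ] Space (d + 1) :=
    { toFun := fun q => e q.fst + q.snd • ν
      map_add' := fun q r => by simp [add_smul]; abel
      map_smul' := fun c q => by simp [mul_smul] }
  have hl : ∀ q, l q = e q.fst + q.snd • ν := fun q => rfl
  have hln : ∀ q, ‖l q‖ = ‖q‖ := by
    intro q
    rw [← sq_eq_sq₀ (norm_nonneg _) (norm_nonneg _), WithLp.prod_norm_sq_eq_of_L2, hl,
      norm_add_sq_real, real_inner_smul_right, he, norm_smul, hν, e.norm_map]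
    simp
  have hfr : Module.finrank ℝ (WithLp 2 (Space d × ℝ)) = Module.finrank ℝ (Space (d + 1)) := by
    rw [(WithLp.linearEquiv 2 ℝ (Space d × ℝ)).finrank_eq]
    simp
  refine ⟨(⟨l, hln⟩ : WithLp 2 (Space d × ℝ) →ₗᵢ[ℝ] Space (d + 1)).toLinearIsometryEquiv hfr, ?_⟩
  rw [LinearIsometry.toLinearIsometryEquiv_apply]
  change l _ = ν
  simp [hl]

section Flat

variable {d : ℕ} {ν v : Space (d + 1)} {L : WithLp 2 (Space d × ℝ) ≃ₗᵢ[ℝ] Space (d + 1)}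
  {W : Set (Space (d + 1))} {δ : ℝ≥0}

/-! A piece `W` of a hypersurface is flat with respect to the unit vector `ν` if its secants are
nearly orthogonal to `ν`. The isometry `L` gives coordinates in which `ν` is the last basis vector,
and `x ↦ (L.symm x).fst` is the orthogonal projection along `ν`. -/

theorem norm_le_of_snd_zero_one (hL : L (WithLp.toLp 2 (0, 1)) = ν) (x : Space (d + 1)) :
    ‖x‖ ≤ ‖(L.symm x).fst‖ + |⟪x, ν⟫| := by
  have h1 : (L.symm x).snd = ⟪x, ν⟫ := by
    rw [← hL, ← L.symm.inner_map_map x, L.symm_apply_apply, WithLp.prod_inner_apply]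
    simp
  have h2 : ‖x‖ ^ 2 = ‖(L.symm x).fst‖ ^ 2 + ⟪x, ν⟫ ^ 2 := by
    rw [← h1, ← L.symm.norm_map x, WithLp.prod_norm_sq_eq_of_L2, Real.norm_eq_abs, sq_abs]
  have h3 : ‖x‖ ^ 2 ≤ (‖(L.symm x).fst‖ + |⟪x, ν⟫|) ^ 2 := by
    rw [h2, add_sq, sq_abs]
    have : 0 ≤ 2 * ‖(L.symm x).fst‖ * |⟪x, ν⟫| := by positivity
    linarith
  exact (sq_le_sq₀ (norm_nonneg _) (by positivity)).1 h3

/-- On a flat piece the projection along the normal shrinks distances only a little. -/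
theorem norm_sub_le_of_flat (hL : L (WithLp.toLp 2 (0, 1)) = ν) (hδ : δ < 1)
    (hW : ∀ x ∈ W, ∀ z ∈ W, |⟪x - z, ν⟫| ≤ δ * ‖x - z‖) {x z : Space (d + 1)} (hx : x ∈ W)
    (hz : z ∈ W) : ‖x - z‖ ≤ (1 - (δ : ℝ))⁻¹ * ‖(L.symm x).fst - (L.symm z).fst‖ := by
  have h1 := norm_le_of_snd_zero_one hL (x - z)
  have h2 := hW x hx z hz
  have hδ' : (0 : ℝ) < 1 - δ := sub_pos.2 (by exact_mod_cast hδ)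
  rw [map_sub, WithLp.sub_fst] at h1
  rw [inv_mul_eq_div, le_div_iff₀ hδ']
  linarith

theorem injOn_fst_of_flat (hL : L (WithLp.toLp 2 (0, 1)) = ν) (hδ : δ < 1)
    (hW : ∀ x ∈ W, ∀ z ∈ W, |⟪x - z, ν⟫| ≤ δ * ‖x - z‖) :
    InjOn (fun x => (L.symm x).fst) W := by
  intro x hx z hz hxz
  have h := norm_sub_le_of_flat hL hδ hW hx hz
  simp only at hxz
  rw [hxz, sub_self, norm_zero, mul_zero] at h
  exact sub_eq_zero.1 (norm_le_zero_iff.1 h)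

theorem continuous_fst_symm : Continuous fun x => (L.symm x).fst :=
  (WithLp.prod_continuous_ofLp 2 _ _).fst.comp L.symm.continuous

/-- The projection does not increase the surface measure. -/
theorem volume_fst_image_le (A : Set (Space (d + 1))) :
    volume ((fun x => (L.symm x).fst) '' A) ≤ Measure.euclideanHausdorffMeasure d A := by
  have hlip : LipschitzWith 1 fun x => (L.symm x).fst := by
    refine LipschitzWith.of_dist_le_mul fun x z => ?_
    rw [dist_eq_norm, dist_eq_norm, ← WithLp.sub_fst, ← map_sub, NNReal.coe_one, one_mul,
      ← L.symm.norm_map (x - z)]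
    exact WithLp.norm_fst_le _ _
  rw [← EuclideanSpace.euclideanHausdorffMeasure_eq_volume]
  simp only [Measure.euclideanHausdorffMeasure_def, Measure.smul_apply]
  gcongr
  simpa using hlip.hausdorffMeasure_image_le (Nat.cast_nonneg d) A

/-- On a flat piece the projection decreases the surface measure only a little. -/
theorem hausdorff_le_of_flat (hL : L (WithLp.toLp 2 (0, 1)) = ν) (hδ : δ < 1)
    (hW : ∀ x ∈ W, ∀ z ∈ W, |⟪x - z, ν⟫| ≤ δ * ‖x - z‖) {A : Set (Space (d + 1))} (hA : A ⊆ W) :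
    Measure.euclideanHausdorffMeasure d A ≤
      (((1 - δ)⁻¹ : ℝ≥0) : ℝ≥0∞) ^ d * volume ((fun x => (L.symm x).fst) '' A) := by
  have hinj := (injOn_fst_of_flat hL hδ hW).mono hA
  let g := Function.invFunOn (fun x => (L.symm x).fst) A
  have hg : ∀ x ∈ A, g ((L.symm x).fst) = x := fun x hx => hinj.leftInvOn_invFunOn hx
  have hlip : LipschitzOnWith (1 - δ)⁻¹ g ((fun x => (L.symm x).fst) '' A) := by
    refine LipschitzOnWith.of_dist_le_mul ?_
    rintro _ ⟨x, hx, rfl⟩ _ ⟨z, hz, rfl⟩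
    simp only [hg x hx, hg z hz, dist_eq_norm]
    simpa [NNReal.coe_sub hδ.le] using norm_sub_le_of_flat hL hδ hW (hA hx) (hA hz)
  have himg : g '' ((fun x => (L.symm x).fst) '' A) = A := by
    rw [image_image]
    exact (image_congr hg).trans (image_id _)
  rw [← EuclideanSpace.euclideanHausdorffMeasure_eq_volume]
  simp only [Measure.euclideanHausdorffMeasure_def, Measure.smul_apply]
  have h := hlip.hausdorffMeasure_image_le (Nat.cast_nonneg d)
  rw [himg, ENNReal.rpow_natCast] at h
  rw [mul_smul_comm]
  gcongr

/-- The slices of the image of `B` under the orthogonal projection to the tangent hyperplane, applied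
in the first variable. -/
theorem volume_prodMap_fst_image (hL : L (WithLp.toLp 2 (0, 1)) = ν) (hδ : δ < 1)
    (hW : ∀ x ∈ W, ∀ z ∈ W, |⟪x - z, ν⟫| ≤ δ * ‖x - z‖) {B : Set (Space (d + 1) × ℝ)}
    (hB : MeasurableSet B) (hBW : B ⊆ W ×ˢ univ) :
    MeasurableSet (Prod.map (fun x => (L.symm x).fst) id '' B) ∧
    (volume : Measure (Space d × ℝ)) (Prod.map (fun x => (L.symm x).fst) id '' B) =
      ∫⁻ t, volume ((fun x => (L.symm x).fst) '' ((fun x => (x, t)) ⁻¹' B)) := by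
  have hm : MeasurableSet (Prod.map (fun x => (L.symm x).fst) id '' B) := by
    refine hB.image_of_continuousOn_injOn
      (continuous_fst_symm.prodMap continuous_id).continuousOn ?_
    rintro ⟨x, t⟩ hx ⟨z, s⟩ hz hxz
    simp only [Prod.map_apply, id_eq, Prod.mk.injEq] at hxz
    exact Prod.ext (injOn_fst_of_flat hL hδ hW (hBW hx).1 (hBW hz).1 hxz.1) hxz.2
  refine ⟨hm, ?_⟩
  rw [Measure.volume_eq_prod, Measure.prod_apply_symm hm]
  congr 1 with t
  congr 1
  ext w
  simp

/-- In a neighbourhood where the hypersurface is flat, sweeping it in the direction `v` is close to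
the linear map that is the identity on the tangent hyperplane and maps the normal to `v`. -/
theorem approximatesLinearOn_sweep (hL : L (WithLp.toLp 2 (0, 1)) = ν) (hδ : δ ≤ 1 / 2)
    (hW : ∀ x ∈ W, ∀ z ∈ W, |⟪x - z, ν⟫| ≤ δ * ‖x - z‖) :
    ∃ F : Space (d + 1) → Space (d + 1),
      (∀ x ∈ W, ∀ t : ℝ, F (L (WithLp.toLp 2 ((L.symm x).fst, t))) = x + t • v) ∧
      ApproximatesLinearOn F (ContinuousLinearMap.id ℝ (Space (d + 1)) +
        (innerSL ℝ ν).smulRight (v - ν))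
        {y | ∃ x ∈ W, ∃ t : ℝ, y = L (WithLp.toLp 2 ((L.symm x).fst, t))} (2 * δ) := by
  have hδ1 : δ < 1 := hδ.trans_lt (by
    rw [← NNReal.coe_lt_coe]; push_cast; norm_num)
  have hδr : (δ : ℝ) ≤ 1 / 2 := by exact_mod_cast hδ
  have hinj := injOn_fst_of_flat hL hδ1 hW
  let g := Function.invFunOn (fun x => (L.symm x).fst) W
  have hg : ∀ x ∈ W, g ((L.symm x).fst) = x := fun x hx => hinj.leftInvOn_invFunOn hx
  have hF : ∀ x ∈ W, ∀ t : ℝ, (fun y => g (L.symm y).fst + (L.symm y).snd • v)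
      (L (WithLp.toLp 2 ((L.symm x).fst, t))) = x + t • v := by
    intro x hx t
    simp [hg x hx]
  refine ⟨fun y => g (L.symm y).fst + (L.symm y).snd • v, hF, ?_⟩
  have hlin : ∀ q : WithLp 2 (Space d × ℝ), L q = L (WithLp.toLp 2 (q.fst, 0)) + q.snd • ν := by
    intro q
    rw [← hL, ← map_smul, ← map_add]
    congr 1
    refine WithLp.ofLp_injective 2 (Prod.ext ?_ ?_) <;> simp
  have hin : ∀ q : WithLp 2 (Space d × ℝ), ⟪ν, L q⟫ = q.snd := by
    intro q
    rw [← hL, L.inner_map_map, WithLp.prod_inner_apply]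
    simp
  rintro _ ⟨x, hx, t, rfl⟩ _ ⟨z, hz, s, rfl⟩
  rw [hF x hx, hF z hz, ← map_sub]
  set q : WithLp 2 (Space d × ℝ) :=
    WithLp.toLp 2 ((L.symm x).fst, t) - WithLp.toLp 2 ((L.symm z).fst, s) with hq
  have hq1 : q.fst = (L.symm (x - z)).fst := by simp [hq]
  have hq2 : q.snd = t - s := by simp [hq]
  have hxz : x - z = L (WithLp.toLp 2 (q.fst, 0)) + ⟪x - z, ν⟫ • ν := by
    conv_lhs => rw [← L.apply_symm_apply (x - z), hlin]
    rw [hq1, real_inner_comm, ← hin, L.apply_symm_apply]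
  have hdiff : x + t • v - (z + s • v) - (ContinuousLinearMap.id ℝ (Space (d + 1)) +
      (innerSL ℝ ν).smulRight (v - ν)) (L q) = ⟪x - z, ν⟫ • ν := by
    have h1 : (ContinuousLinearMap.id ℝ (Space (d + 1)) +
      (innerSL ℝ ν).smulRight (v - ν)) (L q) = L (WithLp.toLp 2 (q.fst, 0)) + (t - s) • v := by
      simp only [add_apply, ContinuousLinearMap.id_apply,
        ContinuousLinearMap.smulRight_apply, innerSL_apply_apply, hin]
      rw [hlin q, hq2, smul_sub]
      abel
    rw [h1, eq_sub_of_add_eq hxz.symm, sub_smul]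
    abel
  have hν : ‖ν‖ = 1 := by
    rw [← hL, L.norm_map, ← sq_eq_sq₀ (norm_nonneg _) (by positivity),
      WithLp.prod_norm_sq_eq_of_L2]
    simp
  rw [hdiff, norm_smul, hν, mul_one, Real.norm_eq_abs, L.norm_map]
  have h2 := norm_sub_le_of_flat hL hδ1 hW hx hz
  have h3 : ‖(L.symm x).fst - (L.symm z).fst‖ ≤ ‖q‖ := by
    have := WithLp.norm_fst_le _ q
    rwa [hq1, map_sub, WithLp.sub_fst] at this
  have h4 : (1 - (δ : ℝ))⁻¹ ≤ 2 := by
    rw [inv_le_comm₀ (by linarith) (by norm_num)]; linarith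
  calc |⟪x - z, ν⟫| ≤ δ * ‖x - z‖ := hW x hx z hz
    _ ≤ δ * (2 * ‖q‖) := by
        gcongr
        exact h2.trans (mul_le_mul h4 h3 (norm_nonneg _) (by norm_num))
    _ = _ := by push_cast; ring

/-- The linear map that replaces the normal `ν` by `v` is a transvection. -/
theorem det_sweep (hν : ‖ν‖ = 1) : (ContinuousLinearMap.id ℝ (Space (d + 1)) +
    (innerSL ℝ ν).smulRight (v - ν)).det = ⟪ν, v⟫ := by
  have h := LinearMap.transvection.det (R := ℝ)
    ((innerSL ℝ ν : Space (d + 1) →L[ℝ] ℝ) : Space (d + 1) →ₗ[ℝ] ℝ) (v - ν)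
  have h2 : ((ContinuousLinearMap.id ℝ (Space (d + 1)) + (innerSL ℝ ν).smulRight (v - ν) :
      Space (d + 1) →L[ℝ] Space (d + 1)) : Space (d + 1) →ₗ[ℝ] Space (d + 1)) =
      LinearMap.transvection ((innerSL ℝ ν : Space (d + 1) →L[ℝ] ℝ) :
        Space (d + 1) →ₗ[ℝ] ℝ) (v - ν) := by
    ext1 x
    simp [LinearMap.transvection.apply]
  rw [ContinuousLinearMap.det, h2, h]
  simp [inner_sub_right, hν]

end Flat

end

/-! ### Sweeping the boundary in a fixed direction -/

section

variable {n : ℕ} {X : Set (Space n)}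

section Area

variable {d : ℕ} {X : Set (Space (d + 1))}

/-- The boundary is compact, and locally it is a Lipschitz image of a bounded part of a hyperplane.
-/
theorem boundaryMeasure_univ_lt_top (hX : IsSmoothConvexDomain X) :
    boundaryMeasure X univ < ∞ := by
  rw [boundaryMeasure, Measure.restrict_apply_univ]
  change Measure.euclideanHausdorffMeasure d (frontier X) < ∞
  have hcpt : IsCompact (frontier X) :=
    Metric.isCompact_of_isClosed_isBounded isClosed_frontier
      (hX.isBounded.closure.subset frontier_subset_closure)
  refine hcpt.measure_lt_top_of_nhdsWithin fun x₀ hx₀ => ?_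
  obtain ⟨U, hU, hflat⟩ := exists_abs_inner_sub_le hX.isOpen hX.convex hX.c1 hx₀
    (δ := ((1 / 2 : ℝ≥0) : ℝ)) (by norm_num)
  obtain ⟨L, hL⟩ := exists_orthogonal_coordinates (norm_outwardNormal hX.c1 hx₀)
  have hδ : (1 / 2 : ℝ≥0) < 1 := by rw [← NNReal.coe_lt_coe]; norm_num
  refine ⟨U ∩ frontier X, inter_mem hU self_mem_nhdsWithin, ?_⟩
  refine (hausdorff_le_of_flat hL hδ hflat inter_subset_left).trans_lt ?_
  refine ENNReal.mul_lt_top (ENNReal.pow_lt_top ENNReal.coe_lt_top) ?_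
  refine (measure_mono (image_mono inter_subset_right)).trans_lt ?_
  exact (hcpt.image continuous_fst_symm).measure_lt_top

theorem isFiniteMeasure_boundaryMeasure (hX : IsSmoothConvexDomain X) :
    IsFiniteMeasure (boundaryMeasure X) :=
  ⟨boundaryMeasure_univ_lt_top hX⟩

/-- The incoming boundary times the time axis, for a fixed direction: the pairs `(x, t)` such that
the particle which enters at `x` is still in `X` at time `t`. -/
def rays (X : Set (Space (d + 1))) (v : Dir (d + 1)) : Set (Space (d + 1) × ℝ) :=
  {q | q.1 ∈ frontier X ∧ 0 < q.2 ∧ q.1 + q.2 • (v : Space (d + 1)) ∈ X}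

theorem measurableSet_rays (hX : IsSmoothConvexDomain X) (v : Dir (d + 1)) :
    MeasurableSet (rays X v) :=
  (isClosed_frontier.preimage continuous_fst).measurableSet.inter
    ((isOpen_Ioi.preimage continuous_snd).measurableSet.inter
      (hX.isOpen.preimage (by fun_prop : Continuous fun q : Space (d + 1) × ℝ =>
        q.1 + q.2 • (v : Space (d + 1)))).measurableSet)

/-- Sweeping a small piece of the boundary in the direction `v` multiplies its surface measure by
`|v · ν|`, up to a factor close to one. -/
theorem exists_volume_sweep_bounds (hX : IsSmoothConvexDomain X) (v : Dir (d + 1))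
    {x₀ : Space (d + 1)} (hx₀ : x₀ ∈ frontier X)
    (hv : ⟪(v : Space (d + 1)), outwardNormal X x₀⟫ < 0) {r : ℝ≥0} (hr : 1 < r) :
    ∃ U ∈ 𝓝 x₀, ∀ B : Set (Space (d + 1) × ℝ), MeasurableSet B →
      B ⊆ (U ∩ frontier X) ×ˢ univ →
      volume ((fun q : Space (d + 1) × ℝ => q.1 + q.2 • (v : Space (d + 1))) '' B) ≤
        (r : ℝ≥0∞) ^ 3 * ∫⁻ q in B, ENNReal.ofReal |⟪(v : Space (d + 1)), outwardNormal X q.1⟫|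
          ∂((boundaryMeasure X).prod volume) ∧
      ∫⁻ q in B, ENNReal.ofReal |⟪(v : Space (d + 1)), outwardNormal X q.1⟫|
          ∂((boundaryMeasure X).prod volume) ≤ (r : ℝ≥0∞) ^ 3 *
        volume ((fun q : Space (d + 1) × ℝ => q.1 + q.2 • (v : Space (d + 1))) '' B) := by
  have := isFiniteMeasure_boundaryMeasure hX
  set ν := outwardNormal X x₀ with hνdef
  have hν : ‖ν‖ = 1 := norm_outwardNormal hX.c1 hx₀
  set a : ℝ≥0 := ‖⟪(v : Space (d + 1)), ν⟫‖₊ with ha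
  have ha0 : 0 < a := by simpa [ha] using hv.ne
  have hr0 : 0 < r := one_pos.trans hr
  have hadet : ENNReal.ofReal |(ContinuousLinearMap.id ℝ (Space (d + 1)) +
      (innerSL ℝ ν).smulRight ((v : Space (d + 1)) - ν)).det| = a := by
    rw [det_sweep hν, real_inner_comm, ha, ← Real.norm_eq_abs, ofReal_norm, enorm_eq_nnnorm]
  -- all the smallness conditions on the flatness constant
  have hev1 := addHaar_image_le_mul_of_det_lt (volume : Measure (Space (d + 1)))
    (ContinuousLinearMap.id ℝ (Space (d + 1)) +
      (innerSL ℝ ν).smulRight ((v : Space (d + 1)) - ν)) (m := r * a)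
    (by rw [hadet]; exact_mod_cast lt_mul_of_one_lt_left ha0 hr)
  have hev2 := mul_le_addHaar_image_of_lt_det (volume : Measure (Space (d + 1)))
    (ContinuousLinearMap.id ℝ (Space (d + 1)) +
      (innerSL ℝ ν).smulRight ((v : Space (d + 1)) - ν)) (m := r⁻¹ * a)
    (by rw [hadet]; exact_mod_cast mul_lt_of_lt_one_left ha0 (inv_lt_one_of_one_lt₀ hr))
  have hev3 : ∀ᶠ δ in 𝓝[>] (0 : ℝ≥0), ((1 - δ / 2)⁻¹) ^ d < r := by
    have hc : ContinuousAt (fun δ : ℝ≥0 => ((1 - δ / 2)⁻¹) ^ d) 0 := by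
      refine ContinuousAt.pow (ContinuousAt.inv₀ (by fun_prop) (by simp)) d
    exact nhdsWithin_le_nhds (hc.eventually_lt_const (by simpa using hr))
  have hev4 : ∀ᶠ δ in 𝓝[>] (0 : ℝ≥0), δ < 1 :=
    nhdsWithin_le_nhds (gt_mem_nhds one_pos)
  obtain ⟨δ', ⟨⟨⟨h1, h2⟩, h3⟩, h4⟩, h5⟩ :=
    ((((hev1.and hev2).and hev3).and hev4).and eventually_mem_nhdsWithin).exists
  set δ := δ' / 2 with hδdef
  have hδδ : 2 * δ = δ' := by rw [hδdef]; field_simp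
  have hδ0 : 0 < δ := half_pos h5
  have hδ : δ ≤ 1 / 2 := by rw [hδdef]; gcongr
  have hδ1 : δ < 1 := (NNReal.half_lt_self (ne_of_gt h5)).trans h4
  obtain ⟨U₁, hU₁, hflat⟩ := exists_abs_inner_sub_le hX.isOpen hX.convex hX.c1 hx₀
    (δ := (δ : ℝ)) (by exact_mod_cast hδ0)
  have hcont : ContinuousWithinAt
      (fun x => ‖⟪(v : Space (d + 1)), outwardNormal X x⟫‖₊) (frontier X) x₀ :=
    (ContinuousWithinAt.inner continuousWithinAt_const
      (continuousOn_outwardNormal hX.isOpen hX.convex hX.c1 x₀ hx₀)).nnnorm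
  have hU₂ : ∀ᶠ x in 𝓝[frontier X] x₀,
      r⁻¹ * a < ‖⟪(v : Space (d + 1)), outwardNormal X x⟫‖₊ ∧
      ‖⟪(v : Space (d + 1)), outwardNormal X x⟫‖₊ < r * a :=
    (hcont.eventually_const_lt (mul_lt_of_lt_one_left ha0 (inv_lt_one_of_one_lt₀ hr))).and
      (hcont.eventually_lt_const (lt_mul_of_one_lt_left ha0 hr))
  obtain ⟨U, hU, hUsub⟩ := mem_nhdsWithin_iff_exists_mem_nhds_inter.1 (inter_mem hU₁ hU₂)
  refine ⟨U, hU, fun B hB hBU => ?_⟩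
  have hWflat : ∀ x ∈ U ∩ frontier X, ∀ z ∈ U ∩ frontier X, |⟪x - z, ν⟫| ≤ δ * ‖x - z‖ :=
    fun x hx z hz => hflat x (hUsub hx).1 z (hUsub hz).1
  obtain ⟨L, hL⟩ := exists_orthogonal_coordinates hν
  obtain ⟨hSm, hS⟩ := volume_prodMap_fst_image hL hδ1 hWflat hB hBU
  set S := Prod.map (fun x => (L.symm x).fst) id '' B with hSdef
  -- the measure of the piece of the boundary, and of its projection to the tangent hyperplane
  have hprod : ((boundaryMeasure X).prod volume) B =
      ∫⁻ t, Measure.euclideanHausdorffMeasure d ((fun x => (x, t)) ⁻¹' B) := by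
    rw [Measure.prod_apply_symm hB]
    refine lintegral_congr fun t => ?_
    exact Measure.restrict_eq_self _ fun x hx => (hBU hx).1.2
  have hSle : volume S ≤ ((boundaryMeasure X).prod volume) B := by
    rw [hS, hprod]
    exact lintegral_mono fun t => volume_fst_image_le _
  have hleS : ((boundaryMeasure X).prod volume) B ≤ r * volume S := by
    rw [hS, hprod, ← lintegral_const_mul']
    · refine lintegral_mono fun t => ?_
      refine (hausdorff_le_of_flat hL hδ1 hWflat (A := (fun x => (x, t)) ⁻¹' B)
        (fun x hx => (hBU hx).1)).trans ?_
      gcongr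
      exact_mod_cast h3.le
    · exact ENNReal.coe_ne_top
  -- the density is nearly constant
  have hdle : ∫⁻ q in B, ENNReal.ofReal |⟪(v : Space (d + 1)), outwardNormal X q.1⟫|
      ∂((boundaryMeasure X).prod volume) ≤ (r * a) * ((boundaryMeasure X).prod volume) B := by
    rw [← setLIntegral_const]
    refine setLIntegral_mono measurable_const fun q hq => ?_
    rw [← Real.norm_eq_abs, ofReal_norm, enorm_eq_nnnorm]
    exact_mod_cast (hUsub (hBU hq).1).2.2.le
  have hled : ((r⁻¹ : ℝ≥0) * a) * ((boundaryMeasure X).prod volume) B ≤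
      ∫⁻ q in B, ENNReal.ofReal |⟪(v : Space (d + 1)), outwardNormal X q.1⟫|
      ∂((boundaryMeasure X).prod volume) := by
    rw [← setLIntegral_const]
    refine setLIntegral_mono' hB fun q hq => ?_
    rw [← Real.norm_eq_abs, ofReal_norm, enorm_eq_nnnorm]
    exact_mod_cast (hUsub (hBU hq).1).2.1.le
  -- the volume of the swept region
  obtain ⟨F, hF, hFL⟩ := approximatesLinearOn_sweep (v := (v : Space (d + 1))) hL hδ hWflat
  rw [hδδ] at hFL
  let G : Space d × ℝ → Space (d + 1) := fun q => L (WithLp.toLp 2 q)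
  have hG : MeasurePreserving G volume volume :=
    L.measurePreserving.comp (WithLp.volume_preserving_toLp _ _)
  have hGe : MeasurableEmbedding G :=
    L.toHomeomorph.measurableEmbedding.comp (MeasurableEquiv.toLp 2 _).measurableEmbedding
  have hGS : volume (G '' S) = volume S := by
    rw [← hG.measure_preimage_emb hGe, preimage_image_eq _ hGe.injective]
  have hGsub : G '' S ⊆ {y | ∃ x ∈ U ∩ frontier X, ∃ t : ℝ,
      y = L (WithLp.toLp 2 ((L.symm x).fst, t))} := by
    rintro _ ⟨_, ⟨q, hq, rfl⟩, rfl⟩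
    exact ⟨q.1, (hBU hq).1, q.2, rfl⟩
  have hFG : F '' (G '' S) =
      (fun q : Space (d + 1) × ℝ => q.1 + q.2 • (v : Space (d + 1))) '' B := by
    rw [hSdef, image_image, image_image]
    exact image_congr fun q hq => hF q.1 (hBU hq).1 q.2
  have hup := h1 _ F (hFL.mono_set hGsub)
  have hlo := h2 _ F (hFL.mono_set hGsub)
  rw [hFG, hGS] at hup hlo
  push_cast at hup hlo
  have hrr : (r : ℝ≥0∞) * ((r⁻¹ : ℝ≥0) : ℝ≥0∞) = 1 := by
    exact_mod_cast mul_inv_cancel₀ hr0.ne'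
  constructor
  · calc _ ≤ r * a * volume S := hup
      _ ≤ r * a * ((boundaryMeasure X).prod volume) B := by gcongr
      _ = r * 1 * a * ((boundaryMeasure X).prod volume) B := by rw [mul_one]
      _ = r * r * (((r⁻¹ : ℝ≥0) * a) * ((boundaryMeasure X).prod volume) B) := by
          rw [← hrr]; ring
      _ ≤ r * r * _ := by gcongr
      _ ≤ _ := by
          gcongr
          rw [← pow_two]
          exact pow_le_pow_right₀ (by exact_mod_cast hr.le) (by norm_num)
  · calc _ ≤ (r * a) * ((boundaryMeasure X).prod volume) B := hdle
      _ ≤ (r * a) * (r * volume S) := by gcongr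
      _ = r * r * 1 * (a * volume S) := by ring
      _ = r ^ 3 * (((r⁻¹ : ℝ≥0) * a) * volume S) := by rw [← hrr]; ring
      _ ≤ _ := by gcongr

/-- For a fixed direction `v`, the map `(x, t) ↦ x + t v` transports `|v · ν| dμ dt` on the incoming
part of the boundary times the time axis to Lebesgue measure on `X`. -/
theorem map_sweep (hX : IsSmoothConvexDomain X) (v : Dir (d + 1)) :
    ((((boundaryMeasure X).prod volume).withDensity fun q : Space (d + 1) × ℝ =>
        ENNReal.ofReal |⟪(v : Space (d + 1)), outwardNormal X q.1⟫|).restrict (rays X v)).map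
      (fun q => q.1 + q.2 • (v : Space (d + 1))) =
    (volume : Measure (Space (d + 1))).restrict X := by
  have := isFiniteMeasure_boundaryMeasure hX
  let Φ : Space (d + 1) × ℝ → Space (d + 1) := fun q => q.1 + q.2 • (v : Space (d + 1))
  let Ψ : Space (d + 1) → Space (d + 1) × ℝ :=
    fun x => (x - backTime X x v • (v : Space (d + 1)), backTime X x v)
  have hΦ : Measurable Φ := by fun_prop
  have hβ : Measurable fun x => backTime X x v :=
    hX.measurable_backTime.comp (measurable_id.prodMk measurable_const)
  have hΨ : Measurable Ψ := (measurable_id.sub (hβ.smul_const _)).prodMk hβ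
  have hΦΨ : ∀ x, Φ (Ψ x) = x := fun x => sub_add_cancel _ _
  have hΨmem : ∀ x ∈ X, Ψ x ∈ rays X v := fun x hx =>
    ⟨hX.sub_backTime_smul_mem_frontier hx v, hX.backTime_pos hx v, by
      have := hΦΨ x
      simp only [Φ] at this
      rwa [this]⟩
  have hΨΦ : ∀ q ∈ rays X v, Ψ (Φ q) = q := fun q hq => by
    have h := hX.backTime_add_smul hq.1 hq.2.1 hq.2.2
    simp [Ψ, Φ, h]
  have hR := measurableSet_rays hX v
  set N₁ := ((volume : Measure (Space (d + 1))).restrict X).map Ψ with hN₁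
  set N₂ := ((((boundaryMeasure X).prod volume).withDensity fun q : Space (d + 1) × ℝ =>
        ENNReal.ofReal |⟪(v : Space (d + 1)), outwardNormal X q.1⟫|).restrict (rays X v)) with hN₂
  have hN₁B : ∀ B, MeasurableSet B → B ⊆ rays X v → N₁ B = volume (Φ '' B) := by
    intro B hB hBR
    rw [hN₁, Measure.map_apply hΨ hB, Measure.restrict_apply (hΨ hB)]
    congr 1
    ext x
    constructor
    · rintro ⟨hx, -⟩
      exact ⟨Ψ x, hx, hΦΨ x⟩
    · rintro ⟨q, hq, rfl⟩
      exact ⟨by rw [mem_preimage, hΨΦ q (hBR hq)]; exact hq, (hBR hq).2.2⟩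
  have hN₂B : ∀ B, MeasurableSet B → B ⊆ rays X v → N₂ B = ∫⁻ q in B,
      ENNReal.ofReal |⟪(v : Space (d + 1)), outwardNormal X q.1⟫|
        ∂((boundaryMeasure X).prod volume) := by
    intro B hB hBR
    rw [hN₂, Measure.restrict_eq_self _ hBR, withDensity_apply _ hB]
  have hloc : ∀ r : ℝ≥0, 1 < r → ∀ q ∈ rays X v, ∃ U ∈ 𝓝 q, ∀ B, MeasurableSet B →
      B ⊆ U ∩ rays X v → N₁ B ≤ (r : ℝ≥0∞) ^ 3 * N₂ B ∧ N₂ B ≤ (r : ℝ≥0∞) ^ 3 * N₁ B := by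
    intro r hr q hq
    obtain ⟨U, hU, hUB⟩ := exists_volume_sweep_bounds hX v hq.1
      ((inner_outwardNormal_neg_iff hX.isOpen hX.convex hX.c1 hq.1 _).2 ⟨q.2, hq.2⟩) hr
    refine ⟨Prod.fst ⁻¹' U, continuousAt_fst.preimage_mem_nhds hU, fun B hB hBU => ?_⟩
    have hBR : B ⊆ rays X v := fun x hx => (hBU hx).2
    rw [hN₁B B hB hBR, hN₂B B hB hBR]
    exact hUB B hB fun x hx => ⟨⟨(hBU hx).1, (hBR hx).1⟩, mem_univ _⟩
  -- both measures live on the rays, and locally each of them nearly dominates the other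
  have heq : N₁ = N₂ := by
    refine le_antisymm (measure_le_of_local hR ?_ fun r hr q hq => ?_)
      (measure_le_of_local hR ?_ fun r hr q hq => ?_)
    · rw [hN₁, Measure.map_apply hΨ hR.compl, Measure.restrict_apply (hΨ hR.compl)]
      convert measure_empty (μ := (volume : Measure (Space (d + 1))))
      refine eq_empty_of_forall_notMem fun x hx => hx.1 (hΨmem x hx.2)
    · obtain ⟨U, hU, h⟩ := hloc r hr q hq
      exact ⟨U, hU, fun B hB hBU => (h B hB hBU).1⟩
    · rw [hN₂, Measure.restrict_apply hR.compl, compl_inter_self, measure_empty]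
    · obtain ⟨U, hU, h⟩ := hloc r hr q hq
      exact ⟨U, hU, fun B hB hBU => (h B hB hBU).2⟩
  change N₂.map Φ = _
  rw [← heq, hN₁, Measure.map_map hΦ hΨ]
  have : Φ ∘ Ψ = id := funext hΦΨ
  rw [this, Measure.map_id]

/-- The volume of a part of `X` as an integral over the boundary of the lengths of its sections by
the rays of a fixed direction. -/
theorem volume_restrict_eq_lintegral (hX : IsSmoothConvexDomain X) (v : Dir (d + 1))
    {E : Set (Space (d + 1))} (hE : MeasurableSet E) :
    (volume : Measure (Space (d + 1))).restrict X E =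
      ∫⁻ x, ENNReal.ofReal |⟪(v : Space (d + 1)), outwardNormal X x⟫| *
        volume {t : ℝ | x + t • (v : Space (d + 1)) ∈ E ∧ (x, t) ∈ rays X v}
        ∂(boundaryMeasure X) := by
  have := isFiniteMeasure_boundaryMeasure hX
  have hsw : Measurable fun q : Space (d + 1) × ℝ => q.1 + q.2 • (v : Space (d + 1)) := by fun_prop
  have hd : Measurable fun x : Space (d + 1) =>
      ENNReal.ofReal |⟪(v : Space (d + 1)), outwardNormal X x⟫| :=
    (continuous_abs.measurable.comp (measurable_const.inner
      (measurable_outwardNormal hX.isOpen hX.convex hX.c1))).ennreal_ofReal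
  have hT := (hsw hE).inter (measurableSet_rays hX v)
  rw [← map_sweep hX v, Measure.map_apply hsw hE, Measure.restrict_apply (hsw hE),
    withDensity_apply _ hT, ← lintegral_indicator hT, lintegral_prod]
  · refine lintegral_congr fun x => ?_
    have hset : MeasurableSet {t : ℝ | x + t • (v : Space (d + 1)) ∈ E ∧ (x, t) ∈ rays X v} :=
      measurable_prodMk_left hT
    rw [← setLIntegral_one, ← lintegral_indicator hset, ← lintegral_const_mul _
      ((measurable_const (a := (1 : ℝ≥0∞))).indicator hset)]
    refine lintegral_congr fun t => ?_
    classical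
    simp only [indicator_apply, mem_inter_iff, mem_preimage, mem_ofPred_eq]
    split_ifs <;> simp
  · exact ((hd.comp measurable_fst).indicator hT).aemeasurable

end Area

end

/-! ### The change of variables along the rays -/

section

variable {n : ℕ} {X : Set (Space n)}

instance (n : ℕ) : IsFiniteMeasure (dirMeasure n) := by
  unfold dirMeasure; infer_instance

/-- Free motion for a time `t`: `((x, v), t) ↦ (x + t v, v)`. -/
def flow (q : (Space n × Dir n) × ℝ) : Space n × Dir n :=
  (q.1.1 + q.2 • (q.1.2 : Space n), q.1.2)

/-- The pairs `((x, v), t)` of a point of the boundary, a direction and a positive time at which the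
particle that started at `x` with velocity `v` is in `X`. -/
def rayDomain (X : Set (Space n)) : Set ((Space n × Dir n) × ℝ) :=
  {q | q.1.1 ∈ frontier X ∧ 0 < q.2 ∧ q.1.1 + q.2 • (q.1.2 : Space n) ∈ X}

/-- The measure `dξ dt` on the incoming boundary times the time axis, up to the escape time. -/
def rayMeasure (X : Set (Space n)) : Measure ((Space n × Dir n) × ℝ) :=
  ((inflowMeasure X).prod volume).restrict (rayDomain X)

/-- The inverse of the flow: the point where the particle entered `X`, and the time since then. -/
def entry (X : Set (Space n)) (p : Space n × Dir n) : (Space n × Dir n) × ℝ :=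
  ((p.1 - backTime X p.1 p.2 • (p.2 : Space n), p.2), backTime X p.1 p.2)

theorem continuous_flow : Continuous (flow : (Space n × Dir n) × ℝ → Space n × Dir n) := by
  unfold flow; fun_prop

theorem measurable_flow : Measurable (flow : (Space n × Dir n) × ℝ → Space n × Dir n) :=
  continuous_flow.measurable

namespace IsSmoothConvexDomain

variable (hX : IsSmoothConvexDomain X)
include hX

theorem isFiniteMeasure_boundaryMeasure : IsFiniteMeasure (boundaryMeasure X) := by
  obtain ⟨d, rfl⟩ := Nat.exists_eq_succ_of_ne_zero hX.pos.ne'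
  exact Transport.isFiniteMeasure_boundaryMeasure hX

theorem measurable_inner_outwardNormal :
    Measurable fun p : Space n × Dir n => ⟪(p.2 : Space n), outwardNormal X p.1⟫ :=
  (measurable_subtype_coe.comp measurable_snd).inner
    ((measurable_outwardNormal hX.isOpen hX.convex hX.c1).comp measurable_fst)

theorem measurable_density :
    Measurable fun p : Space n × Dir n =>
      ENNReal.ofReal |⟪(p.2 : Space n), outwardNormal X p.1⟫| :=
  (continuous_abs.measurable.comp hX.measurable_inner_outwardNormal).ennreal_ofReal

theorem isFiniteMeasure_inflowMeasure : IsFiniteMeasure (inflowMeasure X) := by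
  have := hX.isFiniteMeasure_boundaryMeasure
  suffices h : IsFiniteMeasure (((boundaryMeasure X).prod (dirMeasure n)).withDensity
      fun p => ENNReal.ofReal |⟪(p.2 : Space n), outwardNormal X p.1⟫|) by
    unfold inflowMeasure; infer_instance
  refine isFiniteMeasure_withDensity (ne_of_lt ?_)
  calc _ ≤ ∫⁻ _, 1 ∂((boundaryMeasure X).prod (dirMeasure n)) := by
        refine lintegral_mono fun p => ?_
        rw [← ENNReal.ofReal_one]
        refine ENNReal.ofReal_le_ofReal ((abs_real_inner_le_norm _ _).trans ?_)
        simpa using norm_outwardNormal_le hX.c1 p.1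
    _ < ∞ := by simp

theorem measurableSet_inflow : MeasurableSet (inflow X) :=
  Transport.measurableSet_inflow hX.isOpen hX.convex hX.c1

theorem mem_inflow_iff {p : Space n × Dir n} :
    p ∈ inflow X ↔ p.1 ∈ frontier X ∧ ∃ s : ℝ, 0 < s ∧ p.1 + s • (p.2 : Space n) ∈ X :=
  Transport.mem_inflow_iff hX.isOpen hX.convex hX.c1

theorem ae_mem_inflow : ∀ᵐ p ∂(inflowMeasure X), p ∈ inflow X :=
  ae_restrict_mem hX.measurableSet_inflow

theorem lt_escapeTime_iff {p : Space n × Dir n} (hp : p ∈ inflow X) {t : ℝ} (ht : 0 < t) :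
    t < escapeTime X p.1 p.2 ↔ p.1 + t • (p.2 : Space n) ∈ X :=
  Transport.lt_escapeTime_iff hX.isOpen hX.isBounded hX.convex hp.1.1 ht

theorem escapeTime_pos {p : Space n × Dir n} (hp : p ∈ inflow X) : 0 < escapeTime X p.1 p.2 :=
  Transport.escapeTime_pos hX.isOpen hX.isBounded hX.convex hp.1.1 (hX.mem_inflow_iff.1 hp).2

theorem mem_rayDomain_iff {p : Space n × Dir n} (hp : p ∈ inflow X) {t : ℝ} :
    (p, t) ∈ rayDomain X ↔ t ∈ Ioo 0 (escapeTime X p.1 p.2) := by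
  constructor
  · rintro ⟨-, ht, htX⟩
    exact ⟨ht, (hX.lt_escapeTime_iff hp ht).2 htX⟩
  · rintro ⟨ht, htτ⟩
    exact ⟨hp.1, ht, (hX.lt_escapeTime_iff hp ht).1 htτ⟩

theorem mem_inflow_of_mem_rayDomain {q : (Space n × Dir n) × ℝ} (hq : q ∈ rayDomain X) :
    q.1 ∈ inflow X :=
  hX.mem_inflow_iff.2 ⟨hq.1, q.2, hq.2⟩

theorem flow_mem {p : Space n × Dir n} (hp : p ∈ inflow X) {t : ℝ}
    (ht : t ∈ Ioo 0 (escapeTime X p.1 p.2)) : p.1 + t • (p.2 : Space n) ∈ X :=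
  ((hX.mem_rayDomain_iff hp).2 ht).2.2

theorem measurableSet_rayDomain : MeasurableSet (rayDomain X) := by
  have h1 : Continuous fun q : (Space n × Dir n) × ℝ => q.1.1 := by fun_prop
  have h2 : Continuous fun q : (Space n × Dir n) × ℝ => q.1.1 + q.2 • (q.1.2 : Space n) := by
    fun_prop
  exact (isClosed_frontier.preimage h1).measurableSet.inter
    ((isOpen_Ioi.preimage continuous_snd).measurableSet.inter
      (hX.isOpen.preimage h2).measurableSet)

theorem measurable_entry : Measurable (entry X) := by
  have := hX.measurable_backTime
  exact ((measurable_fst.sub (this.smul (measurable_subtype_coe.comp measurable_snd))).prodMk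
    measurable_snd).prodMk this

theorem entry_mem {p : Space n × Dir n} (hp : p.1 ∈ X) : entry X p ∈ rayDomain X :=
  ⟨hX.sub_backTime_smul_mem_frontier hp p.2, hX.backTime_pos hp p.2, by
    simp only [entry]
    rwa [sub_add_cancel]⟩

theorem entry_flow {q : (Space n × Dir n) × ℝ} (hq : q ∈ rayDomain X) : entry X (flow q) = q := by
  have h := hX.backTime_add_smul hq.1 hq.2.1 hq.2.2
  ext1
  · simp [entry, flow, h]
  · simp [entry, flow, h]

/-- The change of variables `x = x' + t v'`: Lebesgue measure `dx dv` is `dξ dt`. -/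
theorem measurePreserving_flow : MeasurePreserving flow (rayMeasure X) (phaseMeasure X) := by
  have hfin := hX.isFiniteMeasure_boundaryMeasure
  have hfin' := hX.isFiniteMeasure_inflowMeasure
  refine ⟨measurable_flow, Measure.ext fun E hE => ?_⟩
  have hR := hX.measurableSet_rayDomain
  set T := flow ⁻¹' E ∩ rayDomain X with hT
  have hTm : MeasurableSet T := (measurable_flow hE).inter hR
  set h : Space n × Dir n → ℝ≥0∞ := fun p => volume (Prod.mk p ⁻¹' T) with hh
  have hhm : Measurable h := measurable_measure_prodMk_left hTm
  have hh0 : ∀ p, p ∉ inflow X → h p = 0 := by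
    intro p hp
    have : Prod.mk p ⁻¹' T = ∅ :=
      eq_empty_of_forall_notMem fun t ht => hp (hX.mem_inflow_of_mem_rayDomain ht.2)
    simp [hh, this]
  have hd := hX.measurable_density
  have hlhs : (rayMeasure X).map flow E = ∫⁻ v, ∫⁻ x,
      ENNReal.ofReal |⟪(v : Space n), outwardNormal X x⟫| * h (x, v)
        ∂(boundaryMeasure X) ∂(dirMeasure n) := by
    rw [Measure.map_apply measurable_flow hE, rayMeasure,
      Measure.restrict_apply (measurable_flow hE), ← hT, Measure.prod_apply hTm]
    change ∫⁻ p, h p ∂(inflowMeasure X) = _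
    rw [inflowMeasure, setLIntegral_eq_of_support_subset,
      lintegral_withDensity_eq_lintegral_mul _ hd hhm,
      lintegral_prod_symm _ (hd.mul hhm).aemeasurable]
    · rfl
    · intro p hp
      by_contra hpi
      exact hp (hh0 p hpi)
  rw [hlhs, phaseMeasure, Measure.prod_apply_symm hE]
  -- one direction at a time
  refine lintegral_congr fun v => ?_
  obtain ⟨d, rfl⟩ := Nat.exists_eq_succ_of_ne_zero hX.pos.ne'
  exact (volume_restrict_eq_lintegral hX v (measurable_prodMk_right hE)).symm

theorem measurePreserving_entry :
    MeasurePreserving (entry X) (phaseMeasure X) (rayMeasure X) := by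
  refine ⟨hX.measurable_entry, ?_⟩
  rw [← hX.measurePreserving_flow.map_eq, Measure.map_map hX.measurable_entry measurable_flow]
  have : entry X ∘ flow =ᵐ[rayMeasure X] id := by
    filter_upwards [ae_restrict_mem hX.measurableSet_rayDomain] with q hq
    exact hX.entry_flow hq
  rw [Measure.map_congr this, Measure.map_id]

theorem ae_rayMeasure {P : (Space n × Dir n) × ℝ → Prop} (h : ∀ᵐ q ∂(rayMeasure X), P q) :
    ∀ᵐ p ∂(inflowMeasure X), ∀ᵐ t ∂(volume.restrict (Ioo 0 (escapeTime X p.1 p.2))),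
      P (p, t) := by
  have hfin' := hX.isFiniteMeasure_inflowMeasure
  rw [rayMeasure, ae_restrict_iff' hX.measurableSet_rayDomain] at h
  filter_upwards [Measure.ae_ae_of_ae_prod h, hX.ae_mem_inflow] with p hp hpi
  rw [ae_restrict_iff' measurableSet_Ioo]
  filter_upwards [hp] with t ht htI
  exact ht ((hX.mem_rayDomain_iff hpi).2 htI)

theorem ae_phaseMeasure {P : Space n × Dir n → Prop} (h : ∀ᵐ z ∂(phaseMeasure X), P z) :
    ∀ᵐ p ∂(inflowMeasure X), ∀ᵐ t ∂(volume.restrict (Ioo 0 (escapeTime X p.1 p.2))),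
      P (flow (p, t)) :=
  hX.ae_rayMeasure (hX.measurePreserving_flow.quasiMeasurePreserving.ae h)

theorem indicator_rayDomain {E : Type*} [Zero E] {p : Space n × Dir n} (hp : p ∈ inflow X)
    (F : (Space n × Dir n) × ℝ → E) (t : ℝ) :
    (rayDomain X).indicator F (p, t) =
      (Ioo 0 (escapeTime X p.1 p.2)).indicator (fun t => F (p, t)) t := by
  by_cases ht : t ∈ Ioo 0 (escapeTime X p.1 p.2)
  · rw [indicator_of_mem ht, indicator_of_mem ((hX.mem_rayDomain_iff hp).2 ht)]
  · rw [indicator_of_notMem ht, indicator_of_notMem (mt (hX.mem_rayDomain_iff hp).1 ht)]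

theorem lintegral_rayMeasure {F : (Space n × Dir n) × ℝ → ℝ≥0∞} (hF : Measurable F) :
    ∫⁻ q, F q ∂(rayMeasure X) =
      ∫⁻ p, (∫⁻ t in Ioo 0 (escapeTime X p.1 p.2), F (p, t)) ∂(inflowMeasure X) := by
  have hfin' := hX.isFiniteMeasure_inflowMeasure
  have hR := hX.measurableSet_rayDomain
  rw [rayMeasure, ← lintegral_indicator hR, lintegral_prod _ (hF.indicator hR).aemeasurable]
  refine lintegral_congr_ae ?_
  filter_upwards [hX.ae_mem_inflow] with p hp
  rw [← lintegral_indicator measurableSet_Ioo]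
  exact lintegral_congr fun t => hX.indicator_rayDomain hp F t

theorem lintegral_phaseMeasure {f : Space n × Dir n → ℝ≥0∞} (hf : Measurable f) :
    ∫⁻ z, f z ∂(phaseMeasure X) =
      ∫⁻ p, (∫⁻ t in Ioo 0 (escapeTime X p.1 p.2), f (flow (p, t))) ∂(inflowMeasure X) := by
  rw [← hX.measurePreserving_flow.lintegral_comp hf]
  exact hX.lintegral_rayMeasure (hf.comp measurable_flow)

theorem integrableOn_rayMeasure {F : (Space n × Dir n) × ℝ → ℝ} (hF : Integrable F (rayMeasure X)) :
    ∀ᵐ p ∂(inflowMeasure X),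
      IntegrableOn (fun t => F (p, t)) (Ioo 0 (escapeTime X p.1 p.2)) := by
  have hfin' := hX.isFiniteMeasure_inflowMeasure
  have hR := hX.measurableSet_rayDomain
  rw [rayMeasure, ← IntegrableOn, ← integrable_indicator_iff hR] at hF
  filter_upwards [hX.ae_mem_inflow, hF.prod_right_ae] with p hp hpF
  rw [← integrable_indicator_iff measurableSet_Ioo]
  refine hpF.congr (Eventually.of_forall fun t => ?_)
  exact hX.indicator_rayDomain hp F t

theorem integrableOn_flow {f : Space n × Dir n → ℝ} (hf : Integrable f (phaseMeasure X)) :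
    ∀ᵐ p ∂(inflowMeasure X),
      IntegrableOn (fun t => f (flow (p, t))) (Ioo 0 (escapeTime X p.1 p.2)) :=
  hX.integrableOn_rayMeasure (hX.measurePreserving_flow.integrable_comp_of_integrable hf)

theorem integral_phaseMeasure {f : Space n × Dir n → ℝ} (hf : Integrable f (phaseMeasure X)) :
    ∫ z, f z ∂(phaseMeasure X) =
      ∫ p, (∫ t in Ioo 0 (escapeTime X p.1 p.2), f (flow (p, t))) ∂(inflowMeasure X) := by
  have hfin' := hX.isFiniteMeasure_inflowMeasure
  have hR := hX.measurableSet_rayDomain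
  have hmp := hX.measurePreserving_flow
  have hF : Integrable (fun q => f (flow q)) (rayMeasure X) := hmp.integrable_comp_of_integrable hf
  rw [← hmp.map_eq, integral_map hmp.measurable.aemeasurable
    (by rw [hmp.map_eq]; exact hf.aestronglyMeasurable)]
  rw [rayMeasure, ← IntegrableOn, ← integrable_indicator_iff hR] at hF
  rw [rayMeasure, ← integral_indicator hR, integral_prod _ hF]
  refine integral_congr_ae ?_
  filter_upwards [hX.ae_mem_inflow] with p hp
  rw [← integral_indicator measurableSet_Ioo]
  exact integral_congr_ae (Eventually.of_forall fun t => hX.indicator_rayDomain hp _ t)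

end IsSmoothConvexDomain

end

/-! ### Attenuation along a line -/

section

variable {n : ℕ} {X : Set (Space n)}

/-- The solution of `U' + σ U = f`, `U 0 = a` on a line, in closed form. -/
def lineSol (σ f : ℝ → ℝ) (a t : ℝ) : ℝ :=
  Real.exp (-∫ s in (0 : ℝ)..t, σ s) *
    (a + ∫ s in (0 : ℝ)..t, Real.exp (∫ r in (0 : ℝ)..s, σ r) * f s)

section Line

variable {σ f g : ℝ → ℝ} {M τ a : ℝ}

theorem intervalIntegrable_of_bounded (hσ : Measurable σ) (h0 : ∀ t, 0 ≤ σ t) (hM : ∀ t, σ t ≤ M)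
    (b c : ℝ) : IntervalIntegrable σ volume b c :=
  (intervalIntegrable_const (c := M)).mono_fun hσ.aestronglyMeasurable
    (Eventually.of_forall fun t => by
      simpa [abs_of_nonneg, h0 t, (h0 t).trans (hM t)] using hM t)

theorem abs_primitive_sub_le (hσ : Measurable σ) (h0 : ∀ t, 0 ≤ σ t) (hM : ∀ t, σ t ≤ M)
    (s t : ℝ) : |(∫ r in (0 : ℝ)..t, σ r) - ∫ r in (0 : ℝ)..s, σ r| ≤ M * |t - s| := by
  have hi := intervalIntegrable_of_bounded hσ h0 hM
  rw [intervalIntegral.integral_interval_sub_left (hi 0 t) (hi 0 s)]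
  exact intervalIntegral.norm_integral_le_of_norm_le_const fun r _ => by
    rw [Real.norm_of_nonneg (h0 r)]; exact hM r

theorem continuous_primitive (hσ : Measurable σ) (h0 : ∀ t, 0 ≤ σ t) (hM : ∀ t, σ t ≤ M) :
    Continuous fun t => ∫ r in (0 : ℝ)..t, σ r :=
  intervalIntegral.continuous_primitive (intervalIntegrable_of_bounded hσ h0 hM) 0

theorem lipschitzWith_primitive (hσ : Measurable σ) (h0 : ∀ t, 0 ≤ σ t) (hM : ∀ t, σ t ≤ M) :
    LipschitzWith M.toNNReal fun t => ∫ r in (0 : ℝ)..t, σ r :=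
  LipschitzWith.of_dist_le_mul fun t s => by
    rw [Real.coe_toNNReal _ ((h0 0).trans (hM 0))]
    exact abs_primitive_sub_le hσ h0 hM s t

theorem absolutelyContinuousOnInterval_exp_primitive (hσ : Measurable σ) (h0 : ∀ t, 0 ≤ σ t)
    (hM : ∀ t, σ t ≤ M) (c b : ℝ) : AbsolutelyContinuousOnInterval
      (fun t => Real.exp (c * ∫ r in (0 : ℝ)..t, σ r)) 0 b := by
  have hlip := (lipschitzWith_primitive hσ h0 hM).lipschitzOnWith (s := uIcc 0 b)
  have hcpt : IsCompact ((fun t => ∫ r in (0 : ℝ)..t, σ r) '' uIcc 0 b) :=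
    isCompact_uIcc.image (continuous_primitive hσ h0 hM)
  obtain ⟨R, hR⟩ := hcpt.isBounded.subset_closedBall 0
  have hexp : ContDiffOn ℝ 1 (fun y : ℝ => Real.exp (c * y)) (Metric.closedBall 0 R) := by
    fun_prop
  obtain ⟨K, hK⟩ := hexp.exists_lipschitzOnWith one_ne_zero (convex_closedBall _ _)
    (isCompact_closedBall _ _)
  exact (hK.comp hlip fun t ht => hR (mem_image_of_mem _ ht)).absolutelyContinuousOnInterval

theorem ae_hasDerivAt_primitive (hf : IntegrableOn f (Ioo 0 τ)) (hτ : 0 ≤ τ) :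
    ∀ᵐ t ∂(volume.restrict (Ioo 0 τ)),
      HasDerivAt (fun t => ∫ s in (0 : ℝ)..t, f s) (f t) t := by
  have hi : IntervalIntegrable f volume 0 τ :=
    (intervalIntegrable_iff_integrableOn_Ioo_of_le hτ).2 hf
  rw [ae_restrict_iff' measurableSet_Ioo]
  filter_upwards [hi.ae_hasDerivAt_integral] with t ht htI
  rw [uIcc_of_le hτ] at ht
  exact ht (Ioo_subset_Icc_self htI) 0 (left_mem_Icc.2 hτ)

theorem integrableOn_exp_mul (hσ : Measurable σ) (h0 : ∀ t, 0 ≤ σ t) (hM : ∀ t, σ t ≤ M)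
    (hf : IntegrableOn f (Ioo 0 τ)) :
    IntegrableOn (fun s => Real.exp (∫ r in (0 : ℝ)..s, σ r) * f s) (Ioo 0 τ) := by
  rcases le_or_gt τ 0 with hτ | hτ
  · simp [Ioo_eq_empty_of_le hτ]
  have hf' := (integrableOn_Icc_iff_integrableOn_Ioo (μ := volume)).2 hf
  exact (hf'.continuousOn_mul (Real.continuous_exp.comp
    (continuous_primitive hσ h0 hM)).continuousOn isCompact_Icc).mono_set Ioo_subset_Icc_self

theorem ae_hasDerivAt_exp_primitive (hσ : Measurable σ) (h0 : ∀ t, 0 ≤ σ t) (hM : ∀ t, σ t ≤ M)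
    (hτ : 0 ≤ τ) (c : ℝ) : ∀ᵐ t ∂(volume.restrict (Ioo 0 τ)),
      HasDerivAt (fun t => Real.exp (c * ∫ r in (0 : ℝ)..t, σ r))
        (Real.exp (c * ∫ r in (0 : ℝ)..t, σ r) * (c * σ t)) t := by
  have hi := (intervalIntegrable_iff_integrableOn_Ioo_of_le hτ).1
    (intervalIntegrable_of_bounded hσ h0 hM 0 τ)
  filter_upwards [ae_hasDerivAt_primitive hi hτ] with t ht
  exact (ht.const_mul c).exp

theorem absolutelyContinuousOnInterval_lineSol (hσ : Measurable σ) (h0 : ∀ t, 0 ≤ σ t)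
    (hM : ∀ t, σ t ≤ M) (hτ : 0 ≤ τ) (hf : IntegrableOn f (Ioo 0 τ)) (a : ℝ) :
    AbsolutelyContinuousOnInterval (lineSol σ f a) 0 τ := by
  have h1 := absolutelyContinuousOnInterval_exp_primitive hσ h0 hM (-1) τ
  have h2 := ((intervalIntegrable_iff_integrableOn_Ioo_of_le hτ).2
    (integrableOn_exp_mul hσ h0 hM hf)).absolutelyContinuousOnInterval_intervalIntegral
      (c := 0) left_mem_uIcc
  have h3 : AbsolutelyContinuousOnInterval (fun _ : ℝ => a) 0 τ :=
    ((LipschitzWith.const a).lipschitzOnWith (s := uIcc 0 τ)).absolutelyContinuousOnInterval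
  have h := h1.fun_mul (h3.fun_add h2)
  simp only [neg_one_mul] at h
  exact h

theorem ae_hasDerivAt_lineSol (hσ : Measurable σ) (h0 : ∀ t, 0 ≤ σ t)
    (hM : ∀ t, σ t ≤ M) (hτ : 0 ≤ τ) (hf : IntegrableOn f (Ioo 0 τ)) (a : ℝ) :
    ∀ᵐ t ∂(volume.restrict (Ioo 0 τ)),
      HasDerivAt (lineSol σ f a) (-(σ t * lineSol σ f a t) + f t) t := by
  filter_upwards [ae_hasDerivAt_exp_primitive hσ h0 hM hτ (-1),
    ae_hasDerivAt_primitive (integrableOn_exp_mul hσ h0 hM hf) hτ] with t h1 h2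
  have h := h1.fun_mul (h2.const_add a)
  simp only [neg_one_mul] at h
  refine h.congr_deriv ?_
  have : Real.exp (-∫ r in (0 : ℝ)..t, σ r) * Real.exp (∫ r in (0 : ℝ)..t, σ r) = 1 := by
    rw [← Real.exp_add]; simp
  simp only [lineSol]
  linear_combination (f t) * this

theorem lineSol_zero : lineSol σ f a 0 = a := by simp [lineSol]

/-- Multiplication by the integrating factor shows that the initial value problem has no other
absolutely continuous solution. -/
theorem eq_lineSol (hσ : Measurable σ) (h0 : ∀ t, 0 ≤ σ t)
    (hM : ∀ t, σ t ≤ M) (hτ : 0 ≤ τ) (hf : IntegrableOn f (Ioo 0 τ)) {U : ℝ → ℝ}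
    (hU : AbsolutelyContinuousOnInterval U 0 τ)
    (hd : ∀ᵐ t ∂(volume.restrict (Ioo 0 τ)), HasDerivAt U (-(σ t * U t) + f t) t) :
    ∀ t ∈ Icc 0 τ, U t = lineSol σ f (U 0) t := by
  have h1 := absolutelyContinuousOnInterval_exp_primitive hσ h0 hM 1 τ
  have h2 := ((intervalIntegrable_iff_integrableOn_Ioo_of_le hτ).2
    (integrableOn_exp_mul hσ h0 hM hf)).absolutelyContinuousOnInterval_intervalIntegral
      (c := 0) left_mem_uIcc
  have hW := (h1.fun_mul hU).fun_sub h2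
  have hW0 : ∀ᵐ t ∂(volume.restrict (Ioo 0 τ)), HasDerivAt
      (fun t => Real.exp (1 * ∫ r in (0 : ℝ)..t, σ r) * U t -
        ∫ s in (0 : ℝ)..t, Real.exp (∫ r in (0 : ℝ)..s, σ r) * f s) 0 t := by
    filter_upwards [ae_hasDerivAt_exp_primitive hσ h0 hM hτ 1, hd,
      ae_hasDerivAt_primitive (integrableOn_exp_mul hσ h0 hM hf) hτ] with t e1 e2 e3
    refine ((e1.fun_mul e2).fun_sub e3).congr_deriv ?_
    simp only [one_mul]
    ring
  obtain ⟨C, hC⟩ := hW.const_of_ae_hasDerivAt_zero (by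
    rw [uIcc_of_le hτ, ← ae_restrict_iff' measurableSet_Icc,
      ← Measure.restrict_congr_set Ioo_ae_eq_Icc]
    exact hW0)
  rw [uIcc_of_le hτ] at hC
  have hC0 := hC 0 (left_mem_Icc.2 hτ)
  simp only [intervalIntegral.integral_same, mul_zero, Real.exp_zero, one_mul, sub_zero] at hC0
  intro t ht
  have hCt := hC t ht
  rw [one_mul, sub_eq_iff_eq_add] at hCt
  rw [lineSol, hC0, ← hCt, ← mul_assoc, ← Real.exp_add]
  simp

theorem lineSol_add_mul (hσ : Measurable σ) (h0 : ∀ t, 0 ≤ σ t) (hM : ∀ t, σ t ≤ M)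
    (hf : IntegrableOn f (Ioo 0 τ)) (hg : IntegrableOn g (Ioo 0 τ)) (a b c : ℝ) {t : ℝ}
    (ht : t ∈ Icc 0 τ) :
    lineSol σ (fun s => f s + c * g s) (a + c * b) t = lineSol σ f a t + c * lineSol σ g b t := by
  have hi : ∀ f : ℝ → ℝ, IntegrableOn f (Ioo 0 τ) → IntervalIntegrable
      (fun s => Real.exp (∫ r in (0 : ℝ)..s, σ r) * f s) volume 0 t := fun f hf =>
    (intervalIntegrable_iff_integrableOn_Ioo_of_le ht.1).2
      ((integrableOn_exp_mul hσ h0 hM hf).mono_set (Ioo_subset_Ioo_right ht.2))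
  simp only [lineSol, mul_add]
  rw [intervalIntegral.integral_add (hi f hf) (by
    simpa only [mul_left_comm] using (hi g hg).const_mul c)]
  simp only [mul_left_comm _ c, intervalIntegral.integral_const_mul]
  ring

theorem abs_lineSol_le (σ f : ℝ → ℝ) (a : ℝ) {t : ℝ} (ht : 0 ≤ t) :
    |lineSol σ f a t| ≤ lineSol σ (fun s => |f s|) |a| t := by
  rw [lineSol, abs_mul, Real.abs_exp, lineSol]
  gcongr
  refine (abs_add_le _ _).trans ?_
  gcongr
  refine (intervalIntegral.abs_integral_le_integral_abs ht).trans_eq ?_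
  simp [abs_mul]

theorem lineSol_nonneg (hf : ∀ t, 0 ≤ f t) (ha : 0 ≤ a) {t : ℝ} (ht : 0 ≤ t) :
    0 ≤ lineSol σ f a t := by
  refine mul_nonneg (Real.exp_pos _).le (add_nonneg ha ?_)
  exact intervalIntegral.integral_nonneg ht fun s _ => mul_nonneg (Real.exp_pos _).le (hf s)

/-- Attenuation only decreases the solution. -/
theorem lineSol_le (hσ : Measurable σ) (h0 : ∀ t, 0 ≤ σ t) (hM : ∀ t, σ t ≤ M)
    (hf : IntegrableOn f (Ioo 0 τ)) (hf0 : ∀ t, 0 ≤ f t) (ha : 0 ≤ a) {t : ℝ}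
    (ht : t ∈ Icc 0 τ) : lineSol σ f a t ≤ a + ∫ s in (0 : ℝ)..t, f s := by
  have hi := intervalIntegrable_of_bounded hσ h0 hM
  rw [lineSol, mul_add, ← intervalIntegral.integral_const_mul]
  have hft : IntegrableOn f (Ioo 0 t) := hf.mono_set (Ioo_subset_Ioo_right ht.2)
  gcongr ?_ + ?_
  · refine mul_le_of_le_one_left ha (Real.exp_le_one_iff.2 ?_)
    rw [neg_nonpos]
    exact intervalIntegral.integral_nonneg ht.1 fun s _ => h0 s
  · refine intervalIntegral.integral_mono_on ht.1 ?_ ?_ fun s hs => ?_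
    · exact ((intervalIntegrable_iff_integrableOn_Ioo_of_le ht.1).2
        (integrableOn_exp_mul hσ h0 hM hft)).const_mul _
    · exact (intervalIntegrable_iff_integrableOn_Ioo_of_le ht.1).2 hft
    · rw [← mul_assoc, ← Real.exp_add]
      refine mul_le_of_le_one_left (hf0 s) (Real.exp_le_one_iff.2 ?_)
      rw [← sub_eq_neg_add, sub_nonpos]
      exact intervalIntegral.integral_mono_interval le_rfl hs.1 hs.2
        (Eventually.of_forall fun r => h0 r) (hi 0 t)

theorem abs_lineSol_le_add (hσ : Measurable σ) (h0 : ∀ t, 0 ≤ σ t) (hM : ∀ t, σ t ≤ M)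
    (hf : IntegrableOn f (Ioo 0 τ)) (a : ℝ) {t : ℝ} (ht : t ∈ Icc 0 τ) :
    |lineSol σ f a t| ≤ |a| + ∫ s in (0 : ℝ)..t, |f s| :=
  (abs_lineSol_le σ f a ht.1).trans
    (lineSol_le hσ h0 hM hf.abs (fun _ => abs_nonneg _) (abs_nonneg _) ht)

/-- Balance along a line: what is absorbed is at most what enters plus what is produced. -/
theorem integral_mul_lineSol_le (hσ : Measurable σ) (h0 : ∀ t, 0 ≤ σ t) (hM : ∀ t, σ t ≤ M)
    (hτ : 0 ≤ τ) (hf : IntegrableOn f (Ioo 0 τ)) (hf0 : ∀ t, 0 ≤ f t) (ha : 0 ≤ a) :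
    IntegrableOn (fun t => σ t * lineSol σ f a t) (Ioo 0 τ) ∧
    ∫ t in Ioo 0 τ, σ t * lineSol σ f a t ≤ a + ∫ t in Ioo 0 τ, f t := by
  have hac := absolutelyContinuousOnInterval_lineSol hσ h0 hM hτ hf a
  have hint : IntegrableOn (fun t => σ t * lineSol σ f a t) (Ioo 0 τ) := by
    have h1 : IntegrableOn σ (Icc 0 τ) := (intervalIntegrable_iff_integrableOn_Icc_of_le hτ).1
      (intervalIntegrable_of_bounded hσ h0 hM 0 τ)
    have hc := hac.continuousOn
    rw [uIcc_of_le hτ] at hc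
    exact (h1.mul_continuousOn hc isCompact_Icc).mono_set Ioo_subset_Icc_self
  refine ⟨hint, ?_⟩
  have h2 := hac.integral_deriv_eq_sub
  rw [intervalIntegral.integral_of_le hτ, integral_Ioc_eq_integral_Ioo, lineSol_zero] at h2
  have h3 : ∫ t in Ioo 0 τ, deriv (lineSol σ f a) t =
      ∫ t in Ioo 0 τ, (-(σ t * lineSol σ f a t) + f t) := by
    refine integral_congr_ae ?_
    filter_upwards [ae_hasDerivAt_lineSol hσ h0 hM hτ hf a] with t ht
    exact ht.deriv
  rw [h3, integral_add (f := fun t => -(σ t * lineSol σ f a t)) hint.neg hf, integral_neg] at h2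
  linarith [lineSol_nonneg (σ := σ) hf0 ha hτ]

theorem lintegral_mul_lineSol_le (hσ : Measurable σ) (h0 : ∀ t, 0 ≤ σ t) (hM : ∀ t, σ t ≤ M)
    (hτ : 0 ≤ τ) (hf : IntegrableOn f (Ioo 0 τ)) (a : ℝ) :
    ∫⁻ t in Ioo 0 τ, ‖σ t * lineSol σ f a t‖ₑ ≤ ‖a‖ₑ + ∫⁻ t in Ioo 0 τ, ‖f t‖ₑ := by
  obtain ⟨hi, hle⟩ := integral_mul_lineSol_le hσ h0 hM hτ hf.abs (fun _ => abs_nonneg _)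
    (abs_nonneg a)
  calc ∫⁻ t in Ioo 0 τ, ‖σ t * lineSol σ f a t‖ₑ
      ≤ ∫⁻ t in Ioo 0 τ, ENNReal.ofReal (σ t * lineSol σ (fun s => |f s|) |a| t) := by
        refine setLIntegral_mono' measurableSet_Ioo fun t ht => ?_
        rw [← ofReal_norm, norm_mul, Real.norm_of_nonneg (h0 t)]
        refine ENNReal.ofReal_le_ofReal ?_
        gcongr
        · exact h0 t
        · exact abs_lineSol_le σ f a ht.1.le
    _ = ENNReal.ofReal (∫ t in Ioo 0 τ, σ t * lineSol σ (fun s => |f s|) |a| t) := by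
        rw [ofReal_integral_eq_lintegral_ofReal hi]
        filter_upwards [ae_restrict_mem measurableSet_Ioo] with t ht
        exact mul_nonneg (h0 t) (lineSol_nonneg (fun _ => abs_nonneg _) (abs_nonneg _) ht.1.le)
    _ ≤ ENNReal.ofReal (|a| + ∫ t in Ioo 0 τ, |f t|) := ENNReal.ofReal_le_ofReal hle
    _ = _ := by
        rw [ENNReal.ofReal_add (abs_nonneg _) (integral_nonneg fun _ => abs_nonneg _),
          ofReal_integral_eq_lintegral_ofReal hf.abs (Eventually.of_forall fun _ => abs_nonneg _)]
        simp only [← Real.norm_eq_abs, ofReal_norm]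

/-- What is present at the time `t` is at most what has entered or been produced before. -/
theorem enorm_lineSol_le (hσ : Measurable σ) (h0 : ∀ t, 0 ≤ σ t) (hM : ∀ t, σ t ≤ M)
    (hf : IntegrableOn f (Ioo 0 τ)) (a : ℝ) {t : ℝ} (ht : t ∈ Ioo 0 τ) :
    ‖lineSol σ f a t‖ₑ ≤ ‖a‖ₑ + ∫⁻ s in Ioo 0 t, ‖f s‖ₑ := by
  have hft : IntegrableOn f (Ioo 0 t) := hf.mono_set (Ioo_subset_Ioo_right ht.2.le)
  have h := abs_lineSol_le_add hσ h0 hM hf a (Ioo_subset_Icc_self ht)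
  rw [intervalIntegral.integral_of_le ht.1.le, integral_Ioc_eq_integral_Ioo] at h
  rw [← ofReal_norm]
  refine (ENNReal.ofReal_le_ofReal h).trans_eq ?_
  rw [ENNReal.ofReal_add (abs_nonneg _) (integral_nonneg fun _ => abs_nonneg _),
    ofReal_integral_eq_lintegral_ofReal hft.abs (Eventually.of_forall fun _ => abs_nonneg _)]
  simp only [← Real.norm_eq_abs, ofReal_norm]

end Line

end

/-! ### Streaming, scattering and absorption -/

section

variable {n : ℕ} {X : Set (Space n)}

/-- A linear operation on measurable integrable functions that is bounded in `L¹` induces a bounded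
operator on `L¹`. -/
theorem exists_continuousLinearMap_L1 {α β : Type*} [MeasurableSpace α] [MeasurableSpace β]
    {μ : Measure α} {ν : Measure β} (Op : (α → ℝ) → β → ℝ) (C : ℝ≥0)
    (hm : ∀ f, Measurable f → Integrable f μ → Measurable (Op f))
    (hb : ∀ f, Measurable f → Integrable f μ → ∫⁻ y, ‖Op f y‖ₑ ∂ν ≤ C * ∫⁻ x, ‖f x‖ₑ ∂μ)
    (hl : ∀ f g, Measurable f → Integrable f μ → Measurable g → Integrable g μ → ∀ c : ℝ,
      Op (fun x => f x + c * g x) =ᵐ[ν] fun y => Op f y + c * Op g y) :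
    ∃ T : Lp ℝ 1 μ →L[ℝ] Lp ℝ 1 ν, ∀ (φ : Lp ℝ 1 μ) (f : α → ℝ), Measurable f →
      φ =ᵐ[μ] f → T φ =ᵐ[ν] Op f := by
  have hcm : ∀ φ : Lp ℝ 1 μ, Measurable φ := fun φ => (Lp.stronglyMeasurable φ).measurable
  have hci : ∀ φ : Lp ℝ 1 μ, Integrable φ μ := fun φ => L1.integrable_coeFn φ
  have hint : ∀ f, Measurable f → Integrable f μ → Integrable (Op f) ν := fun f hf hfi =>
    ⟨(hm f hf hfi).aestronglyMeasurable, (hb f hf hfi).trans_lt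
      (ENNReal.mul_lt_top ENNReal.coe_lt_top hfi.2)⟩
  have hcongr : ∀ f g, Measurable f → Integrable f μ → Measurable g → f =ᵐ[μ] g →
      Op f =ᵐ[ν] Op g := by
    intro f g hf hfi hg hfg
    have hgi : Integrable g μ := hfi.congr hfg
    have hd := hl f g hf hfi hg hgi (-1)
    have hhm : Measurable fun x => f x + (-1) * g x := hf.add (hg.const_mul _)
    have hhi : Integrable (fun x => f x + (-1) * g x) μ := hfi.add (hgi.const_mul _)
    have hz : ∫⁻ y, ‖Op (fun x => f x + (-1) * g x) y‖ₑ ∂ν = 0 := by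
      refine le_antisymm ((hb _ hhm hhi).trans_eq ?_) bot_le
      have : ∫⁻ x, ‖f x + (-1) * g x‖ₑ ∂μ = 0 := by
        rw [lintegral_eq_zero_iff hhm.enorm]
        filter_upwards [hfg] with x hx
        simp [hx]
      rw [this, mul_zero]
    rw [lintegral_eq_zero_iff (hm _ hhm hhi).enorm] at hz
    filter_upwards [hd, hz] with y h1 h2
    simp only [Pi.zero_apply, enorm_eq_zero] at h2
    rw [h2] at h1
    linarith
  let T₀ : Lp ℝ 1 μ → Lp ℝ 1 ν := fun φ => (hint φ (hcm φ) (hci φ)).toL1 _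
  have hT₀ : ∀ φ, T₀ φ =ᵐ[ν] Op φ := fun φ => Integrable.coeFn_toL1 _
  have hlin : ∀ (φ ψ : Lp ℝ 1 μ) (c : ℝ), T₀ (φ + c • ψ) = T₀ φ + c • T₀ ψ := by
    intro φ ψ c
    refine Lp.ext ?_
    have h1 : (φ + c • ψ : Lp ℝ 1 μ) =ᵐ[μ] fun x => φ x + c * ψ x := by
      filter_upwards [Lp.coeFn_add φ (c • ψ), Lp.coeFn_smul c ψ] with x h1 h2
      rw [h1, Pi.add_apply, h2, Pi.smul_apply, smul_eq_mul]
    have hsm : Measurable fun x => φ x + c * ψ x := (hcm φ).add ((hcm ψ).const_mul c)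
    filter_upwards [hT₀ (φ + c • ψ), hcongr _ _ (hcm _) (hci _)
      hsm h1, hl φ ψ (hcm φ) (hci φ) (hcm ψ) (hci ψ) c,
      Lp.coeFn_add (T₀ φ) (c • T₀ ψ), Lp.coeFn_smul c (T₀ ψ), hT₀ φ, hT₀ ψ]
      with y e1 e2 e3 e4 e5 e6 e7
    simp only [e1, e2, e3, e4, e5, e6, e7, Pi.add_apply, Pi.smul_apply, smul_eq_mul]
  have hzero : T₀ 0 = 0 := by
    have h := hlin 0 0 1
    simp only [smul_zero, add_zero, one_smul] at h
    exact left_eq_add.1 h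
  let T₁ : Lp ℝ 1 μ →ₗ[ℝ] Lp ℝ 1 ν :=
    { toFun := T₀
      map_add' := fun φ ψ => by simpa using hlin φ ψ 1
      map_smul' := fun c φ => by simpa [hzero] using hlin 0 φ c }
  have hbound : ∀ φ, ‖T₁ φ‖ ≤ C * ‖φ‖ := by
    intro φ
    have h1 : ‖T₀ φ‖ₑ ≤ C * ‖φ‖ₑ := by
      rw [Lp.enorm_def, Lp.enorm_def, eLpNorm_one_eq_lintegral_enorm,
        eLpNorm_one_eq_lintegral_enorm]
      refine (lintegral_congr_ae ?_).trans_le (hb φ (hcm φ) (hci φ))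
      filter_upwards [hT₀ φ] with y hy
      rw [hy]
    have h2 := ENNReal.toReal_mono (ENNReal.mul_ne_top ENNReal.coe_ne_top enorm_ne_top) h1
    change ‖T₀ φ‖ ≤ C * ‖φ‖
    simpa only [ENNReal.toReal_mul, toReal_enorm, ENNReal.coe_toReal] using h2
  refine ⟨T₁.mkContinuous C hbound, fun φ f hf hφf => ?_⟩
  exact (hT₀ φ).trans (hcongr φ f (hcm φ) (hci φ) hf hφf)

theorem lintegral_enorm_mul_le {α : Type*} [MeasurableSpace α] {μ : Measure α} {g u : α → ℝ} {C : ℝ}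
    (hg : ∀ᵐ z ∂μ, |g z| ≤ C) :
    ∫⁻ z, ‖g z * u z‖ₑ ∂μ ≤ (C.toNNReal : ℝ≥0∞) * ∫⁻ z, ‖u z‖ₑ ∂μ := by
  rw [← lintegral_const_mul' _ _ ENNReal.coe_ne_top]
  refine lintegral_mono_ae (hg.mono fun z hz => ?_)
  rw [enorm_mul]
  gcongr
  rw [← ofReal_norm]
  exact ENNReal.ofReal_le_ofReal hz

/-- Optical coefficients that are measurable, nonnegative and bounded by `M` on the whole space. -/
structure IsBoundedCoefficients (σ : Space n → Dir n → ℝ) (k : Space n → Dir n → Dir n → ℝ)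
    (M : ℝ) : Prop where
  measurable_sigma : Measurable fun p : Space n × Dir n => σ p.1 p.2
  measurable_k : Measurable fun p : Space n × Dir n × Dir n => k p.1 p.2.1 p.2.2
  sigma_nonneg : ∀ x v, 0 ≤ σ x v
  k_nonneg : ∀ x v' v, 0 ≤ k x v' v
  sigma_le : ∀ x v, σ x v ≤ M
  k_le : ∀ x v' v, k x v' v ≤ M

/-- The stationary particle density with inflow `φ`, attenuation `σ` and source `f`, in the absence
of scattering: along each ray it is the solution of the ordinary differential equation. -/
def stream (X : Set (Space n)) (σ : Space n → Dir n → ℝ) (φ f : Space n × Dir n → ℝ)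
    (z : Space n × Dir n) : ℝ :=
  lineSol (fun s => σ ((entry X z).1.1 + s • (z.2 : Space n)) z.2)
    (fun s => f (flow ((entry X z).1, s))) (φ (entry X z).1) (entry X z).2

/-- The particles that are scattered into the direction `v`: `∫ k(x, v', v) u(x, v') dv'`. -/
def scatter (k : Space n → Dir n → Dir n → ℝ) (u : Space n × Dir n → ℝ)
    (z : Space n × Dir n) : ℝ :=
  ∫ v', k z.1 v' z.2 * u (z.1, v') ∂(dirMeasure n)

/-- The absorbed particles: `∫ σₐ(x, v) u(x, v) dv`. -/
def absorb (σ : Space n → Dir n → ℝ) (k : Space n → Dir n → Dir n → ℝ)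
    (u : Space n × Dir n → ℝ) (x : Space n) : ℝ :=
  ∫ v, sigmaA σ k x v * u (x, v) ∂(dirMeasure n)

theorem measurable_intervalIntegral {α : Type*} [MeasurableSpace α] {F : α × ℝ → ℝ}
    (hF : Measurable F) : Measurable fun q : α × ℝ => ∫ s in (0 : ℝ)..q.2, F (q.1, s) := by
  have key : ∀ S : Set ((α × ℝ) × ℝ), MeasurableSet S →
      Measurable fun q : α × ℝ => ∫ s, S.indicator (fun r => F (r.1.1, r.2)) (q, s) := by
    intro S hS
    have hG : Measurable (S.indicator fun r : (α × ℝ) × ℝ => F (r.1.1, r.2)) :=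
      (hF.comp ((measurable_fst.comp measurable_fst).prodMk measurable_snd)).indicator hS
    exact hG.stronglyMeasurable.integral_prod_right'.measurable
  have hS₁ : MeasurableSet {r : (α × ℝ) × ℝ | 0 < r.2 ∧ r.2 ≤ r.1.2} :=
    (measurableSet_lt measurable_const measurable_snd).inter
      (measurableSet_le measurable_snd (measurable_snd.comp measurable_fst))
  have hS₂ : MeasurableSet {r : (α × ℝ) × ℝ | r.1.2 < r.2 ∧ r.2 ≤ 0} :=
    (measurableSet_lt (measurable_snd.comp measurable_fst) measurable_snd).inter
      (measurableSet_le measurable_snd measurable_const)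
  convert (key _ hS₁).sub (key _ hS₂) using 2 with q
  rw [intervalIntegral, ← integral_indicator measurableSet_Ioc,
    ← integral_indicator measurableSet_Ioc]
  rfl

section Coefficients

variable {σ : Space n → Dir n → ℝ} {k : Space n → Dir n → Dir n → ℝ} {M : ℝ}

theorem measurable_stream (hX : IsSmoothConvexDomain X)
    (hσ : Measurable fun p : Space n × Dir n => σ p.1 p.2) {φ f : Space n × Dir n → ℝ}
    (hφ : Measurable φ) (hf : Measurable f) : Measurable (stream X σ φ f) := by
  have h1 : Measurable fun q : (Space n × Dir n) × ℝ =>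
      ∫ s in (0 : ℝ)..q.2, σ (q.1.1 + s • (q.1.2 : Space n)) q.1.2 :=
    measurable_intervalIntegral
      (F := fun q : (Space n × Dir n) × ℝ => σ (q.1.1 + q.2 • (q.1.2 : Space n)) q.1.2)
      (hσ.comp measurable_flow)
  have h2 := measurable_intervalIntegral (h1.exp.mul (hf.comp measurable_flow))
  have h3 : Measurable fun q : (Space n × Dir n) × ℝ =>
      lineSol (fun s => σ (q.1.1 + s • (q.1.2 : Space n)) q.1.2)
        (fun s => f (flow (q.1, s))) (φ q.1) q.2 :=
    h1.neg.exp.mul ((hφ.comp measurable_fst).add h2)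
  exact h3.comp hX.measurable_entry

theorem measurable_scatter (hk : Measurable fun p : Space n × Dir n × Dir n => k p.1 p.2.1 p.2.2)
    {u : Space n × Dir n → ℝ} (hu : Measurable u) : Measurable (scatter k u) := by
  have : Measurable fun r : (Space n × Dir n) × Dir n => k r.1.1 r.2 r.1.2 * u (r.1.1, r.2) :=
    (hk.comp ((measurable_fst.comp measurable_fst).prodMk
      (measurable_snd.prodMk (measurable_snd.comp measurable_fst)))).mul
      (hu.comp ((measurable_fst.comp measurable_fst).prodMk measurable_snd))
  exact this.stronglyMeasurable.integral_prod_right'.measurable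

theorem measurable_sigmaS (hk : Measurable fun p : Space n × Dir n × Dir n => k p.1 p.2.1 p.2.2) :
    Measurable fun p : Space n × Dir n => sigmaS k p.1 p.2 := by
  have : Measurable fun r : (Space n × Dir n) × Dir n => k r.1.1 r.1.2 r.2 :=
    hk.comp ((measurable_fst.comp measurable_fst).prodMk
      ((measurable_snd.comp measurable_fst).prodMk measurable_snd))
  exact this.stronglyMeasurable.integral_prod_right'.measurable

theorem measurable_sigmaA (hσ : Measurable fun p : Space n × Dir n => σ p.1 p.2)
    (hk : Measurable fun p : Space n × Dir n × Dir n => k p.1 p.2.1 p.2.2) :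
    Measurable fun p : Space n × Dir n => sigmaA σ k p.1 p.2 :=
  hσ.sub (measurable_sigmaS hk)

theorem measurable_absorb (hσ : Measurable fun p : Space n × Dir n => σ p.1 p.2)
    (hk : Measurable fun p : Space n × Dir n × Dir n => k p.1 p.2.1 p.2.2)
    {u : Space n × Dir n → ℝ} (hu : Measurable u) : Measurable (absorb σ k u) :=
  ((measurable_sigmaA hσ hk).mul hu).stronglyMeasurable.integral_prod_right'.measurable

namespace IsBoundedCoefficients

variable (hc : IsBoundedCoefficients σ k M)
include hc

theorem measurable_sigma_line (x : Space n) (v : Dir n) :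
    Measurable fun s : ℝ => σ (x + s • (v : Space n)) v :=
  hc.measurable_sigma.comp
    ((by fun_prop : Measurable fun s : ℝ => x + s • (v : Space n)).prodMk measurable_const)

theorem measurable_k_apply (x : Space n) (v : Dir n) : Measurable (k x v) :=
  hc.measurable_k.comp (measurable_const.prodMk (measurable_const.prodMk measurable_id))

theorem integrable_k (x : Space n) (v : Dir n) : Integrable (k x v) (dirMeasure n) :=
  Integrable.of_bound (hc.measurable_k_apply x v).aestronglyMeasurable M
    (Eventually.of_forall fun v' => by
      rw [Real.norm_of_nonneg (hc.k_nonneg x v v')]; exact hc.k_le x v v')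

theorem sigmaS_nonneg (x : Space n) (v : Dir n) : 0 ≤ sigmaS k x v :=
  integral_nonneg fun v' => hc.k_nonneg x v v'

theorem sigmaS_le (x : Space n) (v : Dir n) : sigmaS k x v ≤ M * (dirMeasure n).real univ := by
  calc sigmaS k x v ≤ ∫ _, M ∂(dirMeasure n) :=
        integral_mono (hc.integrable_k x v) (integrable_const M) fun v' => hc.k_le x v v'
    _ = _ := by simp [mul_comm]

theorem M_nonneg (z : Space n × Dir n) : 0 ≤ M := (hc.sigma_nonneg z.1 z.2).trans (hc.sigma_le _ _)

theorem abs_sigmaA_le (x : Space n) (v : Dir n) :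
    |sigmaA σ k x v| ≤ |M| * (1 + (dirMeasure n).real univ) := by
  rw [abs_of_nonneg (hc.M_nonneg (x, v))]
  have h1 := hc.sigma_nonneg x v
  have h2 := hc.sigma_le x v
  have h3 := hc.sigmaS_nonneg x v
  have h4 := hc.sigmaS_le x v
  have h5 : 0 ≤ M * (dirMeasure n).real univ := h3.trans h4
  have h6 := hc.M_nonneg (x, v)
  rw [sigmaA, abs_le]
  constructor <;> linarith

theorem ofReal_sigmaS (x : Space n) (v : Dir n) :
    ‖sigmaS k x v‖ₑ = ∫⁻ v', ‖k x v v'‖ₑ ∂(dirMeasure n) := by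
  rw [← ofReal_norm, Real.norm_of_nonneg (hc.sigmaS_nonneg x v), sigmaS,
    ofReal_integral_eq_lintegral_ofReal (hc.integrable_k x v)
      (Eventually.of_forall fun v' => hc.k_nonneg x v v')]
  refine lintegral_congr fun v' => ?_
  rw [← ofReal_norm, Real.norm_of_nonneg (hc.k_nonneg x v v')]

/-- Scattering redistributes the particles over the directions: the total number of scattered
particles is at most `∫ σₛ |u|`. -/
theorem lintegral_scatter_le {u : Space n × Dir n → ℝ} (hu : Measurable u) :
    ∫⁻ z, ‖scatter k u z‖ₑ ∂(phaseMeasure X) ≤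
      ∫⁻ z, ‖sigmaS k z.1 z.2 * u z‖ₑ ∂(phaseMeasure X) := by
  have hk := hc.measurable_k
  have hsu : Measurable fun z : Space n × Dir n => sigmaS k z.1 z.2 * u z :=
    (measurable_sigmaS hk).mul hu
  rw [phaseMeasure, lintegral_prod _ (measurable_scatter hk hu).enorm.aemeasurable,
    lintegral_prod _ hsu.enorm.aemeasurable]
  refine lintegral_mono fun x => ?_
  have hku : Measurable fun r : Dir n × Dir n => ‖k x r.2 r.1 * u (x, r.2)‖ₑ :=
    ((hk.comp (measurable_const.prodMk (measurable_snd.prodMk measurable_fst))).mul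
      (hu.comp (measurable_const.prodMk measurable_snd))).enorm
  calc ∫⁻ v, ‖scatter k u (x, v)‖ₑ ∂(dirMeasure n)
      ≤ ∫⁻ v, ∫⁻ v', ‖k x v' v * u (x, v')‖ₑ ∂(dirMeasure n) ∂(dirMeasure n) :=
        lintegral_mono fun v => enorm_integral_le_lintegral_enorm _
    _ = ∫⁻ v', ∫⁻ v, ‖k x v' v * u (x, v')‖ₑ ∂(dirMeasure n) ∂(dirMeasure n) :=
        lintegral_lintegral_swap hku.aemeasurable
    _ = ∫⁻ v', ‖sigmaS k x v' * u (x, v')‖ₑ ∂(dirMeasure n) := by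
        refine lintegral_congr fun v' => ?_
        simp only [enorm_mul]
        rw [lintegral_mul_const _ (hc.measurable_k_apply x v').enorm, hc.ofReal_sigmaS]

theorem lintegral_absorb_le {u : Space n × Dir n → ℝ} (hu : Measurable u) :
    ∫⁻ x, ‖absorb σ k u x‖ₑ ∂((volume : Measure (Space n)).restrict X) ≤
      ∫⁻ z, ‖sigmaA σ k z.1 z.2 * u z‖ₑ ∂(phaseMeasure X) := by
  have hau : Measurable fun z : Space n × Dir n => sigmaA σ k z.1 z.2 * u z :=
    (measurable_sigmaA hc.measurable_sigma hc.measurable_k).mul hu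
  rw [phaseMeasure, lintegral_prod _ hau.enorm.aemeasurable]
  exact lintegral_mono fun x => enorm_integral_le_lintegral_enorm _

end IsBoundedCoefficients

end Coefficients

end

/-! ### The operators on phase space -/

section

variable {n : ℕ} {X : Set (Space n)}

section Streaming

variable {σ : Space n → Dir n → ℝ} {k : Space n → Dir n → Dir n → ℝ} {M : ℝ}
  {φ φ' f f' : Space n × Dir n → ℝ}

theorem stream_flow (hX : IsSmoothConvexDomain X) {p : Space n × Dir n} (hp : p ∈ inflow X)
    {t : ℝ} (ht : t ∈ Ioo 0 (escapeTime X p.1 p.2)) (φ f : Space n × Dir n → ℝ) :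
    stream X σ φ f (flow (p, t)) = lineSol (fun s => σ (p.1 + s • (p.2 : Space n)) p.2)
      (fun s => f (flow (p, s))) (φ p) t := by
  rw [stream, hX.entry_flow ((hX.mem_rayDomain_iff hp).2 ht)]
  rfl

/-- Particles are either unscattered, or have been produced by the source. -/
theorem stream_add_stream (φ f : Space n × Dir n → ℝ) (z : Space n × Dir n) :
    stream X σ φ 0 z + stream X σ 0 f z = stream X σ φ f z := by
  simp only [stream, lineSol, Pi.zero_apply, mul_zero, intervalIntegral.integral_zero]
  ring

/-- A uniform bound for the time that a particle spends in a bounded set. -/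
theorem exists_escapeTime_le (hX : IsSmoothConvexDomain X) :
    ∃ D : ℝ≥0, ∀ p ∈ inflow X, escapeTime X p.1 p.2 ≤ D := by
  obtain ⟨R, hR⟩ := hX.isBounded.closure.exists_norm_le
  refine ⟨(2 * R).toNNReal, fun p hp => le_of_forall_lt fun t ht => ?_⟩
  rw [Real.coe_toNNReal']
  rcases le_or_gt t 0 with h0 | h0
  · by_contra! hle
    have h1 := hR _ hp.1.1
    have hτ := hX.escapeTime_pos hp
    have hmem := hX.flow_mem hp (t := escapeTime X p.1 p.2 / 2) ⟨by linarith, by linarith⟩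
    have h2 := hR _ (subset_closure hmem)
    have h3 : ‖(escapeTime X p.1 p.2 / 2) • (p.2 : Space n)‖ ≤ 2 * R := by
      have := norm_sub_le (p.1 + (escapeTime X p.1 p.2 / 2) • (p.2 : Space n)) p.1
      rw [add_sub_cancel_left] at this
      linarith
    have hv : ‖(p.2 : Space n)‖ = 1 := by simp
    rw [norm_smul, hv, mul_one, Real.norm_of_nonneg (by linarith)] at h3
    linarith [le_max_left (2 * R) 0]
  · obtain ⟨s, hts, hs⟩ := exists_between ht
    have h1 := hR _ hp.1.1
    have h2 := hR _ (subset_closure (hX.flow_mem hp ⟨h0.trans hts, hs⟩))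
    have h3 := norm_sub_le (p.1 + s • (p.2 : Space n)) p.1
    have hv : ‖(p.2 : Space n)‖ = 1 := by simp
    rw [add_sub_cancel_left, norm_smul, hv, mul_one,
      Real.norm_of_nonneg (h0.trans hts).le] at h3
    linarith [le_max_left (2 * R) 0]

/-- Balance: the particles removed by `σ` are at most those that enter or are produced. -/
theorem lintegral_sigma_mul_stream_le (hX : IsSmoothConvexDomain X)
    (hc : IsBoundedCoefficients σ k M) (hφ : Measurable φ) (hf : Measurable f)
    (hfi : Integrable f (phaseMeasure X)) :
    ∫⁻ z, ‖σ z.1 z.2 * stream X σ φ f z‖ₑ ∂(phaseMeasure X) ≤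
      ∫⁻ p, ‖φ p‖ₑ ∂(inflowMeasure X) + ∫⁻ z, ‖f z‖ₑ ∂(phaseMeasure X) := by
  have hs := measurable_stream hX hc.measurable_sigma hφ hf
  have hss : Measurable fun z => σ z.1 z.2 * stream X σ φ f z := hc.measurable_sigma.mul hs
  rw [hX.lintegral_phaseMeasure hss.enorm, hX.lintegral_phaseMeasure hf.enorm,
    ← lintegral_add_left hφ.enorm]
  refine lintegral_mono_ae ?_
  filter_upwards [hX.ae_mem_inflow, hX.integrableOn_flow hfi] with p hp hpf
  refine le_trans (setLIntegral_mono' measurableSet_Ioo fun t ht => ?_)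
    (lintegral_mul_lineSol_le (hc.measurable_sigma_line p.1 p.2) (fun _ => hc.sigma_nonneg _ _)
      (fun _ => hc.sigma_le _ _) (hX.escapeTime_pos hp).le hpf (φ p))
  rw [stream_flow hX hp ht]
  rfl

theorem lintegral_stream_le (hX : IsSmoothConvexDomain X)
    (hc : IsBoundedCoefficients σ k M) (hφ : Measurable φ) (hf : Measurable f)
    (hfi : Integrable f (phaseMeasure X)) {D : ℝ≥0}
    (hD : ∀ p ∈ inflow X, escapeTime X p.1 p.2 ≤ D) :
    ∫⁻ z, ‖stream X σ φ f z‖ₑ ∂(phaseMeasure X) ≤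
      D * (∫⁻ p, ‖φ p‖ₑ ∂(inflowMeasure X) + ∫⁻ z, ‖f z‖ₑ ∂(phaseMeasure X)) := by
  have hs := measurable_stream hX hc.measurable_sigma hφ hf
  rw [hX.lintegral_phaseMeasure hs.enorm, hX.lintegral_phaseMeasure hf.enorm,
    ← lintegral_add_left hφ.enorm, ← lintegral_const_mul' _ _ ENNReal.coe_ne_top]
  refine lintegral_mono_ae ?_
  filter_upwards [hX.ae_mem_inflow, hX.integrableOn_flow hfi] with p hp hpf
  calc ∫⁻ t in Ioo 0 (escapeTime X p.1 p.2), ‖stream X σ φ f (flow (p, t))‖ₑ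
      ≤ ∫⁻ _ in Ioo 0 (escapeTime X p.1 p.2), (‖φ p‖ₑ +
          ∫⁻ s in Ioo 0 (escapeTime X p.1 p.2), ‖f (flow (p, s))‖ₑ) := by
        refine setLIntegral_mono' measurableSet_Ioo fun t ht => ?_
        rw [stream_flow hX hp ht]
        refine (enorm_lineSol_le (hc.measurable_sigma_line p.1 p.2)
          (fun _ => hc.sigma_nonneg _ _) (fun _ => hc.sigma_le _ _) hpf (φ p) ht).trans ?_
        gcongr
        exact ht.2.le
    _ ≤ _ := by
        rw [setLIntegral_const, mul_comm, Real.volume_Ioo, sub_zero]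
        gcongr
        exact (ENNReal.ofReal_le_ofReal (hD p hp)).trans_eq (ENNReal.ofReal_coe_nnreal)

theorem ae_mem_phaseMeasure (hX : IsSmoothConvexDomain X) : ∀ᵐ z ∂(phaseMeasure X), z.1 ∈ X := by
  have h : ∀ᵐ x ∂((volume : Measure (Space n)).restrict X), x ∈ X :=
    ae_restrict_mem hX.isOpen.measurableSet
  exact Measure.quasiMeasurePreserving_fst.ae h

/-- A property of almost every ray holds at almost every point of phase space for the ray through
that point. -/
theorem ae_entry (hX : IsSmoothConvexDomain X) {P : Space n × Dir n → Prop}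
    (h : ∀ᵐ p ∂(inflowMeasure X), P p) : ∀ᵐ z ∂(phaseMeasure X), P (entry X z).1 := by
  have hfin := hX.isFiniteMeasure_inflowMeasure
  have h1 : ∀ᵐ q ∂(rayMeasure X), P q.1 :=
    ae_restrict_of_ae (Measure.quasiMeasurePreserving_fst.ae h)
  exact hX.measurePreserving_entry.quasiMeasurePreserving.ae h1

theorem stream_add_mul (hX : IsSmoothConvexDomain X) (hc : IsBoundedCoefficients σ k M)
    (hf : Integrable f (phaseMeasure X)) (hf' : Integrable f' (phaseMeasure X)) (c : ℝ) :
    stream X σ (fun p => φ p + c * φ' p) (fun z => f z + c * f' z) =ᵐ[phaseMeasure X]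
      fun z => stream X σ φ f z + c * stream X σ φ' f' z := by
  filter_upwards [ae_mem_phaseMeasure hX, ae_entry hX (hX.integrableOn_flow hf),
    ae_entry hX (hX.integrableOn_flow hf')] with z hz h1 h2
  have hmem := hX.entry_mem hz
  have hp := hX.mem_inflow_of_mem_rayDomain hmem
  exact lineSol_add_mul (hc.measurable_sigma_line _ _) (fun _ => hc.sigma_nonneg _ _)
    (fun _ => hc.sigma_le _ _) h1 h2 _ _ _
    (Ioo_subset_Icc_self ((hX.mem_rayDomain_iff hp).1 hmem))

theorem ae_integrable_slice {u : Space n × Dir n → ℝ} (hu : Integrable u (phaseMeasure X)) :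
    ∀ᵐ z ∂(phaseMeasure X), Integrable (fun v => u (z.1, v)) (dirMeasure n) :=
  Measure.quasiMeasurePreserving_fst.ae hu.prod_right_ae

theorem integrable_sigmaA_mul (hc : IsBoundedCoefficients σ k M) {x : Space n} {g : Dir n → ℝ}
    (hg : Integrable g (dirMeasure n)) :
    Integrable (fun v => sigmaA σ k x v * g v) (dirMeasure n) :=
  hg.bdd_mul ((measurable_sigmaA hc.measurable_sigma hc.measurable_k).comp
    (measurable_const.prodMk measurable_id)).aestronglyMeasurable
    (Eventually.of_forall fun v => hc.abs_sigmaA_le x v)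

theorem integrable_k_mul (hc : IsBoundedCoefficients σ k M) {x : Space n} {v : Dir n}
    {g : Dir n → ℝ} (hg : Integrable g (dirMeasure n)) :
    Integrable (fun v' => k x v' v * g v') (dirMeasure n) :=
  hg.bdd_mul (hc.measurable_k.comp
    (measurable_const.prodMk (measurable_id.prodMk measurable_const))).aestronglyMeasurable
    (c := M) (Eventually.of_forall fun v' => by
      rw [Real.norm_of_nonneg (hc.k_nonneg x v' v)]; exact hc.k_le x v' v)

theorem scatter_add_mul (hc : IsBoundedCoefficients σ k M)
    (hf : Integrable f (phaseMeasure X)) (hf' : Integrable f' (phaseMeasure X)) (c : ℝ) :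
    scatter k (fun z => f z + c * f' z) =ᵐ[phaseMeasure X]
      fun z => scatter k f z + c * scatter k f' z := by
  filter_upwards [ae_integrable_slice hf, ae_integrable_slice hf'] with z h1 h2
  simp only [scatter, mul_add]
  rw [integral_add (integrable_k_mul hc h1) (by
    simpa only [mul_left_comm] using (integrable_k_mul hc h2 (v := z.2)).const_mul c)]
  simp only [mul_left_comm _ c, integral_const_mul]

theorem absorb_add_mul (hc : IsBoundedCoefficients σ k M)
    (hf : Integrable f (phaseMeasure X)) (hf' : Integrable f' (phaseMeasure X)) (c : ℝ) :
    absorb σ k (fun z => f z + c * f' z) =ᵐ[(volume : Measure (Space n)).restrict X]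
      fun x => absorb σ k f x + c * absorb σ k f' x := by
  filter_upwards [hf.prod_right_ae, hf'.prod_right_ae] with x h1 h2
  simp only [absorb, mul_add]
  rw [integral_add (integrable_sigmaA_mul hc h1) (by
    simpa only [mul_left_comm] using (integrable_sigmaA_mul hc h2 (x := x)).const_mul c)]
  simp only [mul_left_comm _ c, integral_const_mul]

theorem absorb_congr {u w : Space n × Dir n → ℝ} (h : u =ᵐ[phaseMeasure X] w) :
    absorb σ k u =ᵐ[(volume : Measure (Space n)).restrict X] absorb σ k w := by
  filter_upwards [Measure.ae_ae_of_ae_prod h] with x hx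
  exact integral_congr_ae (hx.mono fun v hv => by simp only [hv])

end Streaming

end

/-! ### Well-posedness of the transport equation -/

section

variable {n : ℕ} {X : Set (Space n)}

theorem enorm_L1_eq {α : Type*} [MeasurableSpace α] {μ : Measure α} {φ : Lp ℝ 1 μ} {f : α → ℝ}
    (h : φ =ᵐ[μ] f) : ‖φ‖ₑ = ∫⁻ x, ‖f x‖ₑ ∂μ := by
  rw [Lp.enorm_def, eLpNorm_one_eq_lintegral_enorm]
  exact lintegral_congr_ae (h.mono fun x hx => by simp only [hx])

section Existence

variable {σ : Space n → Dir n → ℝ} {k : Space n → Dir n → Dir n → ℝ} {M : ℝ}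

theorem measurable_Lp {α : Type*} [MeasurableSpace α] {μ : Measure α} (φ : Lp ℝ 1 μ) :
    Measurable φ := (Lp.stronglyMeasurable φ).measurable

/-- Streaming an integrable source along the rays solves the transport equation. -/
theorem isTransportSolution_of_stream (hX : IsSmoothConvexDomain X)
    (hc : IsBoundedCoefficients σ k M) {φ u f : Space n × Dir n → ℝ}
    (hfi : Integrable f (phaseMeasure X)) (hu : u =ᵐ[phaseMeasure X] stream X σ φ f)
    (hf : f =ᵐ[phaseMeasure X] scatter k u) : IsTransportSolution X σ k φ u := by
  filter_upwards [hX.ae_mem_inflow, hX.integrableOn_flow hfi, hX.ae_phaseMeasure hu,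
    hX.ae_phaseMeasure hf] with p hp hpf hpu hps
  have hm := hc.measurable_sigma_line p.1 p.2
  have h0 : ∀ s : ℝ, 0 ≤ σ (p.1 + s • (p.2 : Space n)) p.2 := fun _ => hc.sigma_nonneg _ _
  have hM : ∀ s : ℝ, σ (p.1 + s • (p.2 : Space n)) p.2 ≤ M := fun _ => hc.sigma_le _ _
  have hτ := (hX.escapeTime_pos hp).le
  refine ⟨lineSol (fun s => σ (p.1 + s • (p.2 : Space n)) p.2) (fun s => f (flow (p, s))) (φ p),
    absolutelyContinuousOnInterval_lineSol hm h0 hM hτ hpf _, lineSol_zero, ?_⟩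
  filter_upwards [hpu, hps, ae_hasDerivAt_lineSol hm h0 hM hτ hpf (φ p),
    ae_restrict_mem measurableSet_Ioo] with t h1 h2 h3 ht
  rw [stream_flow hX hp ht] at h1
  refine ⟨h1.symm, ?_⟩
  rw [h2] at h3
  exact h3

/-- Every integrable solution is obtained by streaming its own scattered particles. -/
theorem IsTransportSolution.eq_stream (hX : IsSmoothConvexDomain X)
    (hc : IsBoundedCoefficients σ k M) {φ u f : Space n × Dir n → ℝ} (hφ : Measurable φ)
    (hum : Measurable u) (hfm : Measurable f) (hfi : Integrable f (phaseMeasure X))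
    (hf : f =ᵐ[phaseMeasure X] scatter k u) (hu : IsTransportSolution X σ k φ u) :
    u =ᵐ[phaseMeasure X] stream X σ φ f := by
  have hs := measurable_stream hX hc.measurable_sigma hφ hfm
  have hd : Measurable fun z => u z - stream X σ φ f z := hum.sub hs
  suffices h : ∫⁻ z, ‖u z - stream X σ φ f z‖ₑ ∂(phaseMeasure X) = 0 by
    rw [lintegral_eq_zero_iff hd.enorm] at h
    filter_upwards [h] with z hz
    exact sub_eq_zero.1 (enorm_eq_zero.1 hz)
  rw [hX.lintegral_phaseMeasure hd.enorm]
  refine lintegral_eq_zero_of_ae_eq_zero ?_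
  filter_upwards [hX.ae_mem_inflow, hX.integrableOn_flow hfi, hX.ae_phaseMeasure hf, hu]
    with p hp hpf hps hpu
  obtain ⟨U, hU, hU0, hUd⟩ := hpu
  have hm := hc.measurable_sigma_line p.1 p.2
  have h0 : ∀ s : ℝ, 0 ≤ σ (p.1 + s • (p.2 : Space n)) p.2 := fun _ => hc.sigma_nonneg _ _
  have hM : ∀ s : ℝ, σ (p.1 + s • (p.2 : Space n)) p.2 ≤ M := fun _ => hc.sigma_le _ _
  have hτ := (hX.escapeTime_pos hp).le
  have hd' : ∀ᵐ t ∂(volume.restrict (Ioo 0 (escapeTime X p.1 p.2))),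
      HasDerivAt U (-(σ (p.1 + t • (p.2 : Space n)) p.2 * U t) + f (flow (p, t))) t := by
    filter_upwards [hUd, hps] with t h1 h2
    rw [h2]
    exact h1.2
  have hUeq := eq_lineSol hm h0 hM hτ hpf hU hd'
  refine lintegral_eq_zero_of_ae_eq_zero ?_
  filter_upwards [hUd, ae_restrict_mem measurableSet_Ioo] with t h1 ht
  have h2 := hUeq t (Ioo_subset_Icc_self ht)
  rw [hU0] at h2
  have h3 : u (flow (p, t)) = U t := h1.1.symm
  rw [stream_flow hX hp ht, h3, h2]
  simp

/-- Well-posedness: absorption makes scattering after streaming a contraction of `L¹`, so the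
transport equation is solved by a Neumann series. -/
theorem exists_isAlbedoOperator (hX : IsSmoothConvexDomain X)
    (hc : IsBoundedCoefficients σ k M) {σ₀ : ℝ} (hσ₀ : 0 < σ₀)
    (ha : ∀ᵐ z ∂(phaseMeasure X), σ₀ ≤ sigmaA σ k z.1 z.2) :
    ∃ (A : Lp ℝ 1 (inflowMeasure X) →L[ℝ] Lp ℝ 1 ((volume : Measure (Space n)).restrict X))
      (C : ℝ), IsAlbedoOperator X σ k A ∧ ∀ φ : Lp ℝ 1 (inflowMeasure X),
        ∃ u f : Lp ℝ 1 (phaseMeasure X), u =ᵐ[phaseMeasure X] stream X σ φ f ∧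
          f =ᵐ[phaseMeasure X] scatter k u ∧ ‖u‖ ≤ C * ‖φ‖ ∧
          A φ =ᵐ[(volume : Measure (Space n)).restrict X] absorb σ k u := by
  obtain ⟨D, hD⟩ := exists_escapeTime_le hX
  have hσm := hc.measurable_sigma
  have hkm := hc.measurable_k
  -- `J`: streaming of the inflow; `T`: streaming of a source; `K`: scattering; `S`: absorption
  obtain ⟨J, hJ⟩ := exists_continuousLinearMap_L1 (μ := inflowMeasure X) (ν := phaseMeasure X)
    (fun φ => stream X σ φ 0) D
    (fun φ hφ _ => measurable_stream hX hσm hφ measurable_zero)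
    (fun φ hφ _ => by
      simpa using lintegral_stream_le hX hc hφ measurable_zero (integrable_zero _ _ _) hD)
    (fun φ ψ _ _ _ _ c => by
      have h := stream_add_mul hX hc (φ := φ) (φ' := ψ) (f := 0) (f' := 0)
        (integrable_zero _ _ _) (integrable_zero _ _ _) c
      simp only [Pi.zero_apply, mul_zero, add_zero] at h
      exact h)
  obtain ⟨T, hT⟩ := exists_continuousLinearMap_L1 (μ := phaseMeasure X) (ν := phaseMeasure X)
    (fun f => stream X σ 0 f) D
    (fun f hf _ => measurable_stream hX hσm measurable_zero hf)
    (fun f hf hfi => by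
      simpa using lintegral_stream_le hX hc measurable_zero hf hfi hD)
    (fun f g _ hf _ hg c => by
      have h := stream_add_mul hX hc (φ := 0) (φ' := 0) hf hg c
      simp only [Pi.zero_apply, mul_zero, add_zero] at h
      exact h)
  obtain ⟨K, hK⟩ := exists_continuousLinearMap_L1 (μ := phaseMeasure X) (ν := phaseMeasure X)
    (scatter k) (M * (dirMeasure n).real univ).toNNReal
    (fun u hu _ => measurable_scatter hkm hu)
    (fun u hu _ => (hc.lintegral_scatter_le hu).trans
      (lintegral_enorm_mul_le (g := fun z : Space n × Dir n => sigmaS k z.1 z.2)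
        (Eventually.of_forall fun z => by
        rw [abs_of_nonneg (hc.sigmaS_nonneg _ _)]; exact hc.sigmaS_le _ _)))
    (fun f g _ hf _ hg c => scatter_add_mul hc hf hg c)
  obtain ⟨S, hS⟩ := exists_continuousLinearMap_L1 (μ := phaseMeasure X)
    (ν := (volume : Measure (Space n)).restrict X)
    (absorb σ k) (|M| * (1 + (dirMeasure n).real univ)).toNNReal
    (fun u hu _ => measurable_absorb hσm hkm hu)
    (fun u hu _ => (hc.lintegral_absorb_le hu).trans
      (lintegral_enorm_mul_le (g := fun z : Space n × Dir n => sigmaA σ k z.1 z.2)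
        (Eventually.of_forall fun z => hc.abs_sigmaA_le _ _)))
    (fun f g _ hf _ hg c => absorb_add_mul hc hf hg c)
  -- `σ ≤ max M σ₀` and `σ - σₛ ≥ σ₀` give `σₛ ≤ q σ`, so that `q` is a contraction constant
  set q : ℝ := 1 - σ₀ / max M σ₀ with hq
  have hM' : 0 < max M σ₀ := hσ₀.trans_le (le_max_right _ _)
  have hq0 : 0 ≤ q := by
    rw [hq, sub_nonneg, div_le_one hM']
    exact le_max_right _ _
  have hq1 : q < 1 := by
    rw [hq]
    linarith [div_pos hσ₀ hM']
  have hsS : ∀ᵐ z ∂(phaseMeasure X), sigmaS k z.1 z.2 ≤ q * σ z.1 z.2 := by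
    filter_upwards [ha] with z hz
    have h1 : σ₀ / max M σ₀ * σ z.1 z.2 ≤ σ₀ := by
      rw [div_mul_eq_mul_div, div_le_iff₀ hM']
      gcongr
      exact (hc.sigma_le _ _).trans (le_max_left _ _)
    rw [sigmaA] at hz
    rw [hq, sub_mul, one_mul]
    linarith
  have hKT : ‖K ∘L T‖ ≤ q := by
    refine ContinuousLinearMap.opNorm_le_bound _ hq0 fun f => ?_
    have hfm := measurable_Lp f
    have hsm := measurable_stream hX hσm measurable_zero hfm
    have hKTf : K (T f) =ᵐ[phaseMeasure X] scatter k (stream X σ 0 f) :=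
      hK (T f) _ hsm (hT f f hfm EventuallyEq.rfl)
    have hle : ‖K (T f)‖ₑ ≤ (q.toNNReal : ℝ≥0∞) * ‖f‖ₑ := by
      rw [enorm_L1_eq hKTf, enorm_L1_eq (φ := f) EventuallyEq.rfl]
      refine (hc.lintegral_scatter_le hsm).trans ?_
      have hb := lintegral_sigma_mul_stream_le hX hc measurable_zero hfm
        (L1.integrable_coeFn f) (φ := 0)
      simp only [Pi.zero_apply, enorm_zero, lintegral_zero, zero_add] at hb
      refine le_trans ?_ (mul_le_mul_right hb _)
      rw [← lintegral_const_mul' _ _ ENNReal.coe_ne_top]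
      refine lintegral_mono_ae (hsS.mono fun z hz => ?_)
      rw [enorm_mul, enorm_mul, ← mul_assoc]
      gcongr
      rw [← ofReal_norm, ← ofReal_norm, Real.norm_of_nonneg (hc.sigmaS_nonneg _ _),
        Real.norm_of_nonneg (hc.sigma_nonneg _ _)]
      exact (ENNReal.ofReal_le_ofReal hz).trans_eq (ENNReal.ofReal_mul hq0)
    have h2 := ENNReal.toReal_mono (ENNReal.mul_ne_top ENNReal.coe_ne_top enorm_ne_top) hle
    change ‖K (T f)‖ ≤ q * ‖f‖
    simpa only [ENNReal.toReal_mul, toReal_enorm, ENNReal.coe_toReal,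
      Real.coe_toNNReal _ hq0] using h2
  -- the scattered particles `f` satisfy `f = K (J φ) + K (T f)`
  let N := Units.oneSub (K ∘L T) (hKT.trans_lt hq1)
  have hN : ∀ g, (N⁻¹).1 g - K (T ((N⁻¹).1 g)) = g := by
    intro g
    have := congrArg (fun B => B g) N.mul_inv
    exact this
  have hN' : ∀ g, (N⁻¹).1 (g - K (T g)) = g := by
    intro g
    have := congrArg (fun B => B g) N.inv_mul
    exact this
  let F := (N⁻¹).1 ∘L K ∘L J
  let U := J + T ∘L F
  have hKU : ∀ φ, K (U φ) = F φ := by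
    intro φ
    have h1 := hN (K (J φ))
    change K (J φ + T (F φ)) = F φ
    rw [map_add]
    exact (sub_eq_iff_eq_add.1 h1).symm
  have hUs : ∀ φ, U φ =ᵐ[phaseMeasure X] stream X σ φ (F φ) := by
    intro φ
    filter_upwards [Lp.coeFn_add (J φ) (T (F φ)), hJ φ φ (measurable_Lp φ) EventuallyEq.rfl,
      hT (F φ) (F φ) (measurable_Lp _) EventuallyEq.rfl] with z h1 h2 h3
    change (J φ + T (F φ) : Lp ℝ 1 (phaseMeasure X)) z = _
    rw [h1, Pi.add_apply, h2, h3]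
    exact stream_add_stream _ _ _
  have hFs : ∀ φ, F φ =ᵐ[phaseMeasure X] scatter k (U φ) := by
    intro φ
    rw [← hKU]
    exact hK (U φ) (U φ) (measurable_Lp _) EventuallyEq.rfl
  have hAs : ∀ φ, S (U φ) =ᵐ[(volume : Measure (Space n)).restrict X] absorb σ k (U φ) :=
    fun φ => hS (U φ) (U φ) (measurable_Lp _) EventuallyEq.rfl
  refine ⟨S ∘L U, ‖U‖, fun φ => ⟨U φ, ?_, fun w hw => ?_, hAs φ⟩, fun φ =>
    ⟨U φ, F φ, hUs φ, hFs φ, U.le_opNorm φ, hAs φ⟩⟩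
  · exact isTransportSolution_of_stream hX hc (L1.integrable_coeFn _) (hUs φ) (hFs φ)
  · have hKw : K w =ᵐ[phaseMeasure X] scatter k w :=
      hK w w (measurable_Lp _) EventuallyEq.rfl
    have hw2 := hw.eq_stream hX hc (measurable_Lp φ) (measurable_Lp w) (measurable_Lp (K w))
      (L1.integrable_coeFn _) hKw
    have hw3 : w = J φ + T (K w) := by
      refine Lp.ext ?_
      filter_upwards [Lp.coeFn_add (J φ) (T (K w)), hJ φ φ (measurable_Lp φ) EventuallyEq.rfl,
        hT (K w) (K w) (measurable_Lp _) EventuallyEq.rfl, hw2] with z h1 h2 h3 h4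
      rw [h4, h1, Pi.add_apply, h2, h3]
      exact (stream_add_stream _ _ _).symm
    have hw4 : K w = F φ := by
      have h1 : K w - K (T (K w)) = K (J φ) := by
        rw [sub_eq_iff_eq_add, ← map_add, ← hw3]
      have h2 := hN' (K w)
      rw [h1] at h2
      exact h2.symm
    rw [hw3, hw4]
    rfl

end Existence

end

/-! ### Dispersion of the scattered particles -/

section

variable {n : ℕ} {X : Set (Space n)}

/-- Integration in polar coordinates. -/
theorem lintegral_polar (hn : 0 < n) {h : Space n → ℝ≥0∞} (hh : Measurable h) :
    ∫⁻ x, h x = ∫⁻ v, (∫⁻ r in Ioi (0 : ℝ), ENNReal.ofReal (r ^ (n - 1)) *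
      h (r • (v : Space n))) ∂(dirMeasure n) := by
  have : Nonempty (Fin n) := ⟨⟨0, hn⟩⟩
  have hmp := (volume : Measure (Space n)).measurePreserving_homeomorphUnitSphereProd
  rw [finrank_euclideanSpace_fin] at hmp
  have hcm : MeasurableSet ({0}ᶜ : Set (Space n)) := (measurableSet_singleton _).compl
  have hH : Measurable fun y : Dir n × Ioi (0 : ℝ) => h ((y.2 : ℝ) • (y.1 : Space n)) :=
    hh.comp (by fun_prop)
  calc ∫⁻ x, h x = ∫⁻ x in ({0}ᶜ : Set (Space n)), h x := by rw [restrict_compl_singleton]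
    _ = ∫⁻ x : ({0}ᶜ : Set (Space n)), h x
          ∂((volume : Measure (Space n)).comap Subtype.val) :=
        (lintegral_subtype_comap hcm _).symm
    _ = ∫⁻ y, h ((y.2 : ℝ) • (y.1 : Space n)) ∂((dirMeasure n).prod
          (Measure.volumeIoiPow (n - 1))) := by
        rw [dirMeasure, ← hmp.lintegral_comp hH]
        refine lintegral_congr fun x => ?_
        rw [← homeomorphUnitSphereProd_symm_apply_coe, Homeomorph.symm_apply_apply]
    _ = _ := by
        rw [lintegral_prod _ hH.aemeasurable]
        refine lintegral_congr fun v => ?_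
        have hv : Measurable fun r : Ioi (0 : ℝ) => h ((r : ℝ) • (v : Space n)) :=
          hh.comp (by fun_prop)
        have hp : Measurable fun r : Ioi (0 : ℝ) => ENNReal.ofReal ((r : ℝ) ^ (n - 1)) := by
          fun_prop
        rw [Measure.volumeIoiPow, lintegral_withDensity_eq_lintegral_mul _ hp hv]
        exact lintegral_subtype_comap measurableSet_Ioi
          (fun r : ℝ => ENNReal.ofReal (r ^ (n - 1)) * h (r • (v : Space n)))

/-- The total weight seen from a point `y`, over all lines of sight, is small when the weight is
bounded and has a small integral: up to the distance `η` the weight is at most one, and farther away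
the polar density `r ^ (n - 1)` is at least `η ^ (n - 1)`. -/
theorem lintegral_lines_le (hn : 0 < n) {w : Space n → ℝ≥0∞} (hw : Measurable w)
    (hw1 : ∀ x, w x ≤ 1) {η : ℝ} (hη : 0 < η) (y : Space n) :
    ∫⁻ v, (∫⁻ r in Ioi (0 : ℝ), w (y + r • (v : Space n))) ∂(dirMeasure n) ≤
      ENNReal.ofReal η * dirMeasure n univ + ENNReal.ofReal (η ^ (n - 1))⁻¹ * ∫⁻ x, w x := by
  have hwy : Measurable fun x => w (y + x) := hw.comp (measurable_const_add y)
  have h1 : ∀ v : Dir n, ∫⁻ r in Ioi (0 : ℝ), w (y + r • (v : Space n)) ≤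
      ENNReal.ofReal η + ENNReal.ofReal (η ^ (n - 1))⁻¹ *
        ∫⁻ r in Ioi (0 : ℝ), ENNReal.ofReal (r ^ (n - 1)) * w (y + r • (v : Space n)) := by
    intro v
    have hm : Measurable fun r : ℝ => (Iio η).indicator (fun _ => (1 : ℝ≥0∞)) r :=
      measurable_const.indicator measurableSet_Iio
    calc ∫⁻ r in Ioi (0 : ℝ), w (y + r • (v : Space n))
        ≤ ∫⁻ r in Ioi (0 : ℝ), ((Iio η).indicator (fun _ => (1 : ℝ≥0∞)) r +
            ENNReal.ofReal (η ^ (n - 1))⁻¹ *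
              (ENNReal.ofReal (r ^ (n - 1)) * w (y + r • (v : Space n)))) := by
          refine lintegral_mono fun r => ?_
          rcases lt_or_ge r η with hr | hr
          · rw [indicator_of_mem (show r ∈ Iio η from hr)]
            exact (hw1 _).trans le_self_add
          · refine le_trans ?_ le_add_self
            rw [← mul_assoc, ← ENNReal.ofReal_mul (by positivity)]
            refine le_mul_of_one_le_left bot_le ?_
            rw [ENNReal.one_le_ofReal, ← div_eq_inv_mul, one_le_div (by positivity)]
            gcongr
      _ = _ := by
          rw [lintegral_add_left hm, lintegral_const_mul' _ _ ENNReal.ofReal_ne_top,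
            lintegral_indicator measurableSet_Iio]
          congr 1
          rw [Measure.restrict_restrict measurableSet_Iio, setLIntegral_one, inter_comm,
            Ioi_inter_Iio, Real.volume_Ioo, sub_zero]
  calc _ ≤ ∫⁻ v, (ENNReal.ofReal η + ENNReal.ofReal (η ^ (n - 1))⁻¹ *
        ∫⁻ r in Ioi (0 : ℝ), ENNReal.ofReal (r ^ (n - 1)) * w (y + r • (v : Space n)))
          ∂(dirMeasure n) := lintegral_mono h1
    _ = _ := by
        rw [lintegral_add_left measurable_const, lintegral_const,
          lintegral_const_mul' _ _ ENNReal.ofReal_ne_top, ← lintegral_polar hn hwy,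
          lintegral_add_left_eq_self]

section Scattering

variable {σ : Space n → Dir n → ℝ} {k : Space n → Dir n → Dir n → ℝ} {M : ℝ}

/-- The weighted mass of the particles emitted by a source: each particle meets at most the weight
that lies ahead of it. -/
theorem lintegral_mul_stream_le (hX : IsSmoothConvexDomain X) (hc : IsBoundedCoefficients σ k M)
    {f : Space n × Dir n → ℝ} (hf : Measurable f) (hfi : Integrable f (phaseMeasure X))
    {w : Space n → ℝ≥0∞} (hw : Measurable w) :
    ∫⁻ z, w z.1 * ‖stream X σ 0 f z‖ₑ ∂(phaseMeasure X) ≤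
      ∫⁻ z, ‖f z‖ₑ * (∫⁻ r in Ioi (0 : ℝ), w (z.1 + r • (z.2 : Space n)))
        ∂(phaseMeasure X) := by
  have hs := measurable_stream hX hc.measurable_sigma measurable_zero hf
  have hws : Measurable fun z : Space n × Dir n => w z.1 * ‖stream X σ 0 f z‖ₑ :=
    (hw.comp measurable_fst).mul hs.enorm
  have hwf : Measurable fun r : (Space n × Dir n) × ℝ => w (r.1.1 + r.2 • (r.1.2 : Space n)) :=
    hw.comp (by fun_prop)
  have hH : Measurable fun z : Space n × Dir n =>
      ∫⁻ r in Ioi (0 : ℝ), w (z.1 + r • (z.2 : Space n)) := hwf.lintegral_prod_right'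
  have hfH : Measurable fun z : Space n × Dir n =>
      ‖f z‖ₑ * ∫⁻ r in Ioi (0 : ℝ), w (z.1 + r • (z.2 : Space n)) := hf.enorm.mul hH
  rw [hX.lintegral_phaseMeasure hws, hX.lintegral_phaseMeasure hfH]
  refine lintegral_mono_ae ?_
  filter_upwards [hX.ae_mem_inflow, hX.integrableOn_flow hfi] with p hp hpf
  set τ := escapeTime X p.1 p.2
  set g : ℝ → ℝ≥0∞ := fun s => ‖f (flow (p, s))‖ₑ with hg
  set W : ℝ → ℝ≥0∞ := fun t => w (p.1 + t • (p.2 : Space n)) with hW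
  have hflow : Measurable fun s : ℝ => flow (p, s) :=
    measurable_flow.comp measurable_prodMk_left
  have hgm : Measurable g := (hf.comp hflow).enorm
  have hWm : Measurable W := hw.comp (by fun_prop)
  have hT : MeasurableSet {q : ℝ × ℝ | q.2 < q.1} := measurableSet_lt measurable_snd measurable_fst
  have hK : Measurable (({q : ℝ × ℝ | q.2 < q.1}).indicator fun q => W q.1 * g q.2) :=
    ((hWm.comp measurable_fst).mul (hgm.comp measurable_snd)).indicator hT
  calc ∫⁻ t in Ioo 0 τ, w (flow (p, t)).1 * ‖stream X σ 0 f (flow (p, t))‖ₑ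
      ≤ ∫⁻ t in Ioo 0 τ, ∫⁻ s in Ioo 0 τ,
          ({q : ℝ × ℝ | q.2 < q.1}).indicator (fun q => W q.1 * g q.2) (t, s) := by
        refine setLIntegral_mono' measurableSet_Ioo fun t ht => ?_
        rw [stream_flow hX hp ht]
        have h1 := enorm_lineSol_le (hc.measurable_sigma_line p.1 p.2)
          (fun _ => hc.sigma_nonneg _ _) (fun _ => hc.sigma_le _ _) hpf
          ((0 : Space n × Dir n → ℝ) p) ht
        rw [Pi.zero_apply, enorm_zero, zero_add] at h1
        refine (mul_le_mul_right h1 _).trans ?_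
        rw [← lintegral_const_mul _ hgm, ← lintegral_indicator measurableSet_Ioo,
          ← lintegral_indicator measurableSet_Ioo]
        refine lintegral_mono fun s => indicator_le (fun s hs => ?_) s
        rw [indicator_of_mem (show s ∈ Ioo 0 τ from ⟨hs.1, hs.2.trans ht.2⟩),
          indicator_of_mem (show (t, s) ∈ {q : ℝ × ℝ | q.2 < q.1} from hs.2)]
        rfl
    _ = ∫⁻ s in Ioo 0 τ, ∫⁻ t in Ioo 0 τ,
          ({q : ℝ × ℝ | q.2 < q.1}).indicator (fun q => W q.1 * g q.2) (t, s) :=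
        lintegral_lintegral_swap hK.aemeasurable
    _ ≤ _ := by
        refine setLIntegral_mono' measurableSet_Ioo fun s hs => ?_
        have hshift : ∀ r : ℝ, (flow (p, s)).1 + r • ((flow (p, s)).2 : Space n) =
            p.1 + (r + s) • (p.2 : Space n) := by
          intro r
          simp only [flow, add_smul]
          abel
        simp only [hshift]
        rw [mul_comm, ← lintegral_mul_const _ (by fun_prop)]
        calc ∫⁻ t in Ioo 0 τ, ({q : ℝ × ℝ | q.2 < q.1}).indicator (fun q => W q.1 * g q.2) (t, s)
            ≤ ∫⁻ t, (Ioi s).indicator (fun t => W t * g s) t := by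
              refine (setLIntegral_le_lintegral _ _).trans (lintegral_mono fun t => le_of_eq ?_)
              by_cases h : s < t
              · rw [indicator_of_mem (show (t, s) ∈ {q : ℝ × ℝ | q.2 < q.1} from h),
                  indicator_of_mem (show t ∈ Ioi s from h)]
              · rw [indicator_of_notMem (show (t, s) ∉ {q : ℝ × ℝ | q.2 < q.1} from h),
                  indicator_of_notMem (show t ∉ Ioi s from h)]
          _ = ∫⁻ r, (Ioi s).indicator (fun t => W t * g s) (r + s) :=
              (lintegral_add_right_eq_self _ s).symm
          _ = _ := by
              rw [← lintegral_indicator measurableSet_Ioi]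
              refine lintegral_congr fun r => ?_
              by_cases h : 0 < r
              · rw [indicator_of_mem (show r + s ∈ Ioi s by simpa using h),
                  indicator_of_mem (show r ∈ Ioi 0 from h)]
              · rw [indicator_of_notMem (show r + s ∉ Ioi s by simpa using h),
                  indicator_of_notMem (show r ∉ Ioi 0 from h)]

/-- Scattered particles spread over all directions, so that few of them are found where a bounded
weight with a small integral is concentrated. -/
theorem lintegral_mul_stream_scatter_le (hX : IsSmoothConvexDomain X)
    (hc : IsBoundedCoefficients σ k M) {u f : Space n × Dir n → ℝ} (hu : Measurable u)
    (hf : Measurable f) (hfi : Integrable f (phaseMeasure X))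
    (hfu : f =ᵐ[phaseMeasure X] scatter k u) {w : Space n → ℝ≥0∞} (hw : Measurable w)
    (hw1 : ∀ x, w x ≤ 1) {η : ℝ} (hη : 0 < η) :
    ∫⁻ z, w z.1 * ‖stream X σ 0 f z‖ₑ ∂(phaseMeasure X) ≤
      ENNReal.ofReal M * (ENNReal.ofReal η * dirMeasure n univ +
        ENNReal.ofReal (η ^ (n - 1))⁻¹ * ∫⁻ x, w x) * ∫⁻ z, ‖u z‖ₑ ∂(phaseMeasure X) := by
  refine (lintegral_mul_stream_le hX hc hf hfi hw).trans ?_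
  set B := ENNReal.ofReal η * dirMeasure n univ + ENNReal.ofReal (η ^ (n - 1))⁻¹ * ∫⁻ x, w x
  have hwf : Measurable fun r : (Space n × Dir n) × ℝ => w (r.1.1 + r.2 • (r.1.2 : Space n)) :=
    hw.comp (by fun_prop)
  have hH : Measurable fun z : Space n × Dir n =>
      ∫⁻ r in Ioi (0 : ℝ), w (z.1 + r • (z.2 : Space n)) := hwf.lintegral_prod_right'
  have hG : Measurable fun x : Space n => ∫⁻ v', ‖u (x, v')‖ₑ ∂(dirMeasure n) :=
    hu.enorm.lintegral_prod_right'
  have hGz : Measurable fun z : Space n × Dir n => (ENNReal.ofReal M *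
      ∫⁻ v', ‖u (z.1, v')‖ₑ ∂(dirMeasure n)) *
        ∫⁻ r in Ioi (0 : ℝ), w (z.1 + r • (z.2 : Space n)) :=
    (measurable_const.mul (hG.comp measurable_fst)).mul hH
  calc _ ≤ ∫⁻ z, (ENNReal.ofReal M * ∫⁻ v', ‖u (z.1, v')‖ₑ ∂(dirMeasure n)) *
        (∫⁻ r in Ioi (0 : ℝ), w (z.1 + r • (z.2 : Space n))) ∂(phaseMeasure X) := by
        refine lintegral_mono_ae (hfu.mono fun z hz => ?_)
        rw [hz]
        gcongr
        rw [← lintegral_const_mul' _ _ ENNReal.ofReal_ne_top]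
        refine (enorm_integral_le_lintegral_enorm _).trans (lintegral_mono fun v' => ?_)
        rw [enorm_mul]
        gcongr
        rw [← ofReal_norm, Real.norm_of_nonneg (hc.k_nonneg _ _ _)]
        exact ENNReal.ofReal_le_ofReal (hc.k_le _ _ _)
    _ = ∫⁻ x in X, (ENNReal.ofReal M * ∫⁻ v', ‖u (x, v')‖ₑ ∂(dirMeasure n)) *
          ∫⁻ v, (∫⁻ r in Ioi (0 : ℝ), w (x + r • (v : Space n))) ∂(dirMeasure n) := by
        rw [phaseMeasure, lintegral_prod _ hGz.aemeasurable]
        refine lintegral_congr fun x => ?_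
        have hx : Measurable fun v : Dir n => ∫⁻ r in Ioi (0 : ℝ), w (x + r • (v : Space n)) :=
          hH.comp measurable_prodMk_left
        dsimp only
        rw [lintegral_const_mul _ hx]
    _ ≤ ∫⁻ x in X, (ENNReal.ofReal M * ∫⁻ v', ‖u (x, v')‖ₑ ∂(dirMeasure n)) * B := by
        refine lintegral_mono fun x => ?_
        gcongr
        exact lintegral_lines_le hX.pos hw hw1 hη x
    _ = _ := by
        rw [lintegral_mul_const _ (hG.const_mul _), lintegral_const_mul _ hG, phaseMeasure,
          lintegral_prod _ hu.enorm.aemeasurable]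
        ring

end Scattering

end

/-! ### The ballistic part of the albedo operator -/

section

variable {n : ℕ} {X : Set (Space n)}

section Ballistic

variable {σ : Space n → Dir n → ℝ} {k : Space n → Dir n → Dir n → ℝ} {M : ℝ}

theorem integrable_stream (hX : IsSmoothConvexDomain X) (hc : IsBoundedCoefficients σ k M)
    {φ f : Space n × Dir n → ℝ} (hφ : Measurable φ) (hφi : Integrable φ (inflowMeasure X))
    (hf : Measurable f) (hfi : Integrable f (phaseMeasure X)) :
    Integrable (stream X σ φ f) (phaseMeasure X) := by
  obtain ⟨D, hD⟩ := exists_escapeTime_le hX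
  exact ⟨(measurable_stream hX hc.measurable_sigma hφ hf).aestronglyMeasurable,
    (lintegral_stream_le hX hc hφ hf hfi hD).trans_lt (ENNReal.mul_lt_top ENNReal.coe_lt_top
      (ENNReal.add_lt_top.2 ⟨hφi.2, hfi.2⟩))⟩

theorem integrable_sigmaA_mul_phase (hc : IsBoundedCoefficients σ k M)
    {u : Space n × Dir n → ℝ} (hui : Integrable u (phaseMeasure X)) :
    Integrable (fun z => sigmaA σ k z.1 z.2 * u z) (phaseMeasure X) :=
  hui.bdd_mul (measurable_sigmaA hc.measurable_sigma hc.measurable_k).aestronglyMeasurable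
    (Eventually.of_forall fun z => hc.abs_sigmaA_le z.1 z.2)

theorem integrable_weight_mul {α : Type*} [MeasurableSpace α] {μ : Measure α} {ψ g : α → ℝ}
    (hψ : Measurable ψ) (hψ1 : ∀ x, |ψ x| ≤ 1) (hg : Integrable g μ) :
    Integrable (fun x => ψ x * g x) μ :=
  hg.bdd_mul hψ.aestronglyMeasurable (Eventually.of_forall fun x => hψ1 x)

/-- The weighted absorption of unscattered particles, as an integral over the rays. -/
theorem integral_mul_absorb_stream (hX : IsSmoothConvexDomain X)
    (hc : IsBoundedCoefficients σ k M) {φ : Space n × Dir n → ℝ} (hφ : Measurable φ)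
    (hφi : Integrable φ (inflowMeasure X)) {ψ : Space n → ℝ} (hψ : Measurable ψ)
    (hψ1 : ∀ x, |ψ x| ≤ 1) :
    ∫ x in X, ψ x * absorb σ k (stream X σ φ 0) x =
      ∫ p, φ p * (∫ t in Ioo 0 (escapeTime X p.1 p.2),
        ψ (p.1 + t • (p.2 : Space n)) * ballisticProfile σ k p.1 p.2 t) ∂(inflowMeasure X) := by
  have hsi := integrable_sigmaA_mul_phase hc
    (integrable_stream hX hc hφ hφi measurable_zero (integrable_zero _ _ _))
  have hψz : Measurable fun z : Space n × Dir n => ψ z.1 := hψ.comp measurable_fst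
  have hpi := integrable_weight_mul hψz (fun z => hψ1 z.1) hsi
  have h1 : ∫ x in X, ψ x * absorb σ k (stream X σ φ 0) x =
      ∫ z, ψ z.1 * (sigmaA σ k z.1 z.2 * stream X σ φ 0 z) ∂(phaseMeasure X) := by
    rw [phaseMeasure, integral_prod _ hpi]
    exact integral_congr_ae (Eventually.of_forall fun x => (integral_const_mul _ _).symm)
  rw [h1, hX.integral_phaseMeasure hpi]
  refine integral_congr_ae ?_
  filter_upwards [hX.ae_mem_inflow] with p hp
  rw [← integral_const_mul]
  refine setIntegral_congr_fun measurableSet_Ioo fun t ht => ?_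
  have h2 := stream_flow (σ := σ) hX hp ht φ 0
  simp only [lineSol, Pi.zero_apply, mul_zero, intervalIntegral.integral_zero, add_zero] at h2
  rw [h2]
  simp only [ballisticProfile, flow]
  ring

/-- Up to scattered particles, the albedo operator is given by the ballistic profile, and the
contribution of the scattered particles to a weighted average is small for weights with a small
integral. -/
theorem exists_isAlbedoOperator_approx (hX : IsSmoothConvexDomain X)
    (hc : IsBoundedCoefficients σ k M) {σ₀ : ℝ} (hσ₀ : 0 < σ₀)
    (ha : ∀ᵐ z ∂(phaseMeasure X), σ₀ ≤ sigmaA σ k z.1 z.2) :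
    ∃ (A : Lp ℝ 1 (inflowMeasure X) →L[ℝ] Lp ℝ 1 ((volume : Measure (Space n)).restrict X))
      (C : ℝ), IsAlbedoOperator X σ k A ∧ 0 ≤ C ∧
      ∀ ψ : Space n → ℝ, Measurable ψ → (∀ x, |ψ x| ≤ 1) → ∀ η : ℝ, 0 < η →
      ∀ φ : Lp ℝ 1 (inflowMeasure X),
        |(∫ x in X, ψ x * A φ x) - ∫ p, φ p * (∫ t in Ioo 0 (escapeTime X p.1 p.2),
          ψ (p.1 + t • (p.2 : Space n)) * ballisticProfile σ k p.1 p.2 t) ∂(inflowMeasure X)| ≤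
        C * (η + (η ^ (n - 1))⁻¹ * ∫ x in X, |ψ x|) * ‖φ‖ := by
  obtain ⟨A, C, hA, hAφ⟩ := exists_isAlbedoOperator hX hc hσ₀ ha
  have hfinX : IsFiniteMeasure ((volume : Measure (Space n)).restrict X) :=
    isFiniteMeasure_restrict.2 hX.isBounded.measure_lt_top.ne
  set s : ℝ := (dirMeasure n).real univ with hs
  have hs0 : 0 ≤ s := measureReal_nonneg
  set Ca : ℝ := |M| * (1 + s) with hCa
  have hCa0 : 0 ≤ Ca := by positivity
  refine ⟨A, Ca * (|M| * ((s + 1) * |C|)), hA, by positivity, fun ψ hψ hψ1 η hη φ => ?_⟩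
  obtain ⟨u, f, hu, hf, hun, hAu⟩ := hAφ φ
  have hφm := measurable_Lp φ
  have hfm := measurable_Lp f
  have hφi := L1.integrable_coeFn φ
  have hfi := L1.integrable_coeFn f
  have hi1 := integrable_stream hX hc hφm hφi measurable_zero (integrable_zero _ _ _)
  have hi2 := integrable_stream hX hc measurable_zero (integrable_zero _ _ _) hfm hfi
  have habs : ∀ {w : Space n × Dir n → ℝ}, Measurable w → Integrable w (phaseMeasure X) →
      Integrable (absorb σ k w) ((volume : Measure (Space n)).restrict X) := fun hwm hwi =>
    ⟨(measurable_absorb hc.measurable_sigma hc.measurable_k hwm).aestronglyMeasurable,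
      (hc.lintegral_absorb_le hwm).trans_lt (integrable_sigmaA_mul_phase hc hwi).2⟩
  have hm1 := measurable_stream hX hc.measurable_sigma hφm measurable_zero
  have hm2 := measurable_stream hX hc.measurable_sigma measurable_zero hfm
  have hsplit : A φ =ᵐ[(volume : Measure (Space n)).restrict X]
      fun x => absorb σ k (stream X σ φ 0) x + absorb σ k (stream X σ 0 f) x := by
    have h1 := absorb_add_mul hc hi1 hi2 1
    simp only [one_mul, stream_add_stream] at h1
    exact hAu.trans ((absorb_congr hu).trans h1)
  have hI1 := integrable_weight_mul hψ hψ1 (habs hm1 hi1)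
  have hI2 := integrable_weight_mul hψ hψ1 (habs hm2 hi2)
  have hsum : ∫ x in X, ψ x * A φ x = (∫ x in X, ψ x * absorb σ k (stream X σ φ 0) x) +
      ∫ x in X, ψ x * absorb σ k (stream X σ 0 f) x := by
    rw [← integral_add hI1 hI2]
    exact integral_congr_ae (hsplit.mono fun x hx => by simp only [hx, mul_add])
  rw [hsum, integral_mul_absorb_stream hX hc hφm hφi hψ hψ1, add_sub_cancel_left]
  -- the scattered particles
  have hψX : Measurable fun x => ‖ψ x‖ₑ := hψ.enorm
  have hw : Measurable (X.indicator fun x => ‖ψ x‖ₑ) := hψX.indicator hX.isOpen.measurableSet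
  have hψe : ∀ x, ‖ψ x‖ₑ ≤ 1 := fun x => by
    rw [← ofReal_norm, ENNReal.ofReal_le_one]
    exact hψ1 x
  have hw1 : ∀ x, X.indicator (fun x => ‖ψ x‖ₑ) x ≤ 1 := fun x =>
    (indicator_le_self _ _ x).trans (hψe x)
  have hψi : Integrable ψ ((volume : Measure (Space n)).restrict X) :=
    Integrable.of_bound hψ.aestronglyMeasurable 1 (Eventually.of_forall hψ1)
  have hwi : ∫⁻ x, X.indicator (fun x => ‖ψ x‖ₑ) x = ENNReal.ofReal (∫ x in X, |ψ x|) := by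
    rw [lintegral_indicator hX.isOpen.measurableSet,
      ofReal_integral_eq_lintegral_ofReal hψi.abs (Eventually.of_forall fun _ => abs_nonneg _)]
    exact lintegral_congr fun x => (ofReal_norm (ψ x)).symm
  have hJ0 : 0 ≤ ∫ x in X, |ψ x| := integral_nonneg fun _ => abs_nonneg _
  have hsc := lintegral_mul_stream_scatter_le hX hc (measurable_Lp u) hfm hfi hf hw hw1 hη
  have hmain : ‖∫ x in X, ψ x * absorb σ k (stream X σ 0 f) x‖ₑ ≤
      ENNReal.ofReal (Ca * (|M| * (η * s + (η ^ (n - 1))⁻¹ * ∫ x in X, |ψ x|) * ‖u‖)) := by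
    calc ‖∫ x in X, ψ x * absorb σ k (stream X σ 0 f) x‖ₑ
        ≤ ∫⁻ x in X, ‖ψ x * absorb σ k (stream X σ 0 f) x‖ₑ :=
          enorm_integral_le_lintegral_enorm _
      _ ≤ ∫⁻ x in X, ∫⁻ v, ‖ψ x‖ₑ * (ENNReal.ofReal Ca * ‖stream X σ 0 f (x, v)‖ₑ)
            ∂(dirMeasure n) := by
          refine lintegral_mono fun x => ?_
          rw [enorm_mul, lintegral_const_mul' _ _ enorm_ne_top]
          gcongr
          refine (enorm_integral_le_lintegral_enorm _).trans (lintegral_mono fun v => ?_)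
          rw [enorm_mul]
          gcongr
          rw [← ofReal_norm]
          exact ENNReal.ofReal_le_ofReal (hc.abs_sigmaA_le x v)
      _ = ∫⁻ z, ‖ψ z.1‖ₑ * (ENNReal.ofReal Ca * ‖stream X σ 0 f z‖ₑ) ∂(phaseMeasure X) := by
          have hz : Measurable fun z : Space n × Dir n =>
              ‖ψ z.1‖ₑ * (ENNReal.ofReal Ca * ‖stream X σ 0 f z‖ₑ) :=
            (hψX.comp measurable_fst).mul (measurable_const.mul hm2.enorm)
          exact (lintegral_prod _ hz.aemeasurable).symm
      _ = ENNReal.ofReal Ca * ∫⁻ z, X.indicator (fun x => ‖ψ x‖ₑ) z.1 * ‖stream X σ 0 f z‖ₑ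
            ∂(phaseMeasure X) := by
          rw [← lintegral_const_mul' _ _ ENNReal.ofReal_ne_top]
          refine lintegral_congr_ae ((ae_mem_phaseMeasure hX).mono fun z hz => ?_)
          simp only [indicator_of_mem hz]
          ring
      _ ≤ ENNReal.ofReal Ca * _ := mul_le_mul_right hsc _
      _ ≤ _ := by
          have hS : dirMeasure n univ = ENNReal.ofReal s := by
            rw [hs, ofReal_measureReal]
          have hun' : ∫⁻ z, ‖u z‖ₑ ∂(phaseMeasure X) = ENNReal.ofReal ‖u‖ := by
            rw [← enorm_L1_eq (φ := u) EventuallyEq.rfl, ofReal_norm]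
          rw [hwi, hS, hun', ← ENNReal.ofReal_mul hη.le, ← ENNReal.ofReal_mul (by positivity),
            ← ENNReal.ofReal_add (by positivity) (by positivity)]
          calc _ ≤ ENNReal.ofReal Ca * (ENNReal.ofReal |M| * ENNReal.ofReal
                (η * s + (η ^ (n - 1))⁻¹ * ∫ x in X, |ψ x|) * ENNReal.ofReal ‖u‖) := by
                gcongr
                exact le_abs_self M
            _ = _ := by
                rw [← ENNReal.ofReal_mul (abs_nonneg _), ← ENNReal.ofReal_mul (by positivity),
                  ← ENNReal.ofReal_mul hCa0]
  rw [← ofReal_norm, Real.norm_eq_abs, ENNReal.ofReal_le_ofReal_iff (by positivity)] at hmain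
  refine hmain.trans ?_
  have h1 : η * s + (η ^ (n - 1))⁻¹ * ∫ x in X, |ψ x| ≤
      (s + 1) * (η + (η ^ (n - 1))⁻¹ * ∫ x in X, |ψ x|) := by
    have : 0 ≤ (η ^ (n - 1))⁻¹ * ∫ x in X, |ψ x| := by positivity
    nlinarith [mul_nonneg hs0 this]
  have h2 : ‖u‖ ≤ |C| * ‖φ‖ := hun.trans (by gcongr; exact le_abs_self C)
  calc Ca * (|M| * (η * s + (η ^ (n - 1))⁻¹ * ∫ x in X, |ψ x|) * ‖u‖)
      ≤ Ca * (|M| * ((s + 1) * (η + (η ^ (n - 1))⁻¹ * ∫ x in X, |ψ x|)) * (|C| * ‖φ‖)) := by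
        gcongr
    _ = _ := by ring

end Ballistic

end

/-! ### Admissible coefficients -/

section

variable {n : ℕ} {X : Set (Space n)}

section BallisticAverage

variable {σ : Space n → Dir n → ℝ} {k : Space n → Dir n → Dir n → ℝ} {M : ℝ}

theorem IsSmoothConvexDomain.integrable_integral_flow (hX : IsSmoothConvexDomain X)
    {f : Space n × Dir n → ℝ} (hf : Integrable f (phaseMeasure X)) :
    Integrable (fun p : Space n × Dir n => ∫ t in Ioo 0 (escapeTime X p.1 p.2), f (flow (p, t)))
      (inflowMeasure X) := by
  have hfin' := hX.isFiniteMeasure_inflowMeasure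
  have hF : Integrable (fun q => f (flow q)) (rayMeasure X) :=
    hX.measurePreserving_flow.integrable_comp_of_integrable hf
  rw [rayMeasure, ← IntegrableOn, ← integrable_indicator_iff hX.measurableSet_rayDomain] at hF
  refine hF.integral_prod_left.congr ?_
  filter_upwards [hX.ae_mem_inflow] with p hp
  rw [← integral_indicator measurableSet_Ioo]
  exact integral_congr_ae (Eventually.of_forall fun t => hX.indicator_rayDomain hp _ t)

theorem integrable_ballistic_average (hX : IsSmoothConvexDomain X)
    (hc : IsBoundedCoefficients σ k M) {ψ : Space n → ℝ} (hψ : Measurable ψ)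
    (hψ1 : ∀ x, |ψ x| ≤ 1) :
    Integrable (fun p : Space n × Dir n => ∫ t in Ioo 0 (escapeTime X p.1 p.2),
      ψ (p.1 + t • (p.2 : Space n)) * ballisticProfile σ k p.1 p.2 t) (inflowMeasure X) := by
  have hfin := hX.isFiniteMeasure_inflowMeasure
  have hψz : Measurable fun z : Space n × Dir n => ψ z.1 := hψ.comp measurable_fst
  have hpi := integrable_weight_mul hψz (fun z => hψ1 z.1) (integrable_sigmaA_mul_phase hc
    (integrable_stream hX hc (φ := fun _ => (1 : ℝ)) measurable_const (integrable_const _)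
      measurable_zero (integrable_zero _ _ _)))
  refine (hX.integrable_integral_flow hpi).congr ?_
  filter_upwards [hX.ae_mem_inflow] with p hp
  refine setIntegral_congr_fun measurableSet_Ioo fun t ht => ?_
  have h2 := stream_flow (σ := σ) hX hp ht (fun _ => (1 : ℝ)) 0
  simp only [lineSol, Pi.zero_apply, mul_zero, intervalIntegral.integral_zero, add_zero,
    mul_one] at h2
  rw [h2]
  rfl

theorem integrableOn_ballisticProfile (hc : IsBoundedCoefficients σ k M) (x : Space n)
    (v : Dir n) (τ : ℝ) : IntegrableOn (ballisticProfile σ k x v) (Ioo 0 τ) := by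
  have hm := hc.measurable_sigma_line x v
  have hp : Continuous fun t : ℝ => ∫ s in (0 : ℝ)..t, σ (x + s • (v : Space n)) v :=
    continuous_primitive hm (fun _ => hc.sigma_nonneg _ _) (fun _ => hc.sigma_le _ _)
  have hA : Measurable fun t : ℝ => sigmaA σ k (x + t • (v : Space n)) v :=
    (measurable_sigmaA hc.measurable_sigma hc.measurable_k).comp
      ((by fun_prop : Measurable fun s : ℝ => x + s • (v : Space n)).prodMk measurable_const)
  refine Integrable.of_bound (hA.mul hp.measurable.neg.exp).aestronglyMeasurable
    (|M| * (1 + (dirMeasure n).real univ)) ?_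
  filter_upwards [ae_restrict_mem measurableSet_Ioo] with t ht
  have h0 : 0 ≤ ∫ s in (0 : ℝ)..t, σ (x + s • (v : Space n)) v :=
    intervalIntegral.integral_nonneg ht.1.le fun _ _ => hc.sigma_nonneg _ _
  rw [ballisticProfile, norm_mul, Real.norm_eq_abs, Real.norm_eq_abs, Real.abs_exp]
  exact (mul_le_of_le_one_right (abs_nonneg _) (Real.exp_le_one_iff.2 (neg_nonpos.2 h0))).trans
    (hc.abs_sigmaA_le _ _)

end BallisticAverage

section Extension

variable {σ σ' : Space n → Dir n → ℝ} {k k' : Space n → Dir n → Dir n → ℝ}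

/-- Admissible coefficients, continued by zero outside `X`. -/
theorem IsAdmissible.exists_isBoundedCoefficients (hX : MeasurableSet X)
    (h : IsAdmissible X σ k) : ∃ (σ' : Space n → Dir n → ℝ)
      (k' : Space n → Dir n → Dir n → ℝ) (M : ℝ), IsBoundedCoefficients σ' k' M ∧
        ∀ x ∈ X, σ' x = σ x ∧ k' x = k x := by
  obtain ⟨M, hM⟩ := h.bounded
  refine ⟨X.indicator σ, X.indicator k, max M 0, ⟨?_, ?_, fun x v => ?_, fun x v' v => ?_,
    fun x v => ?_, fun x v' v => ?_⟩, fun x hx => ⟨indicator_of_mem hx _, indicator_of_mem hx _⟩⟩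
  · have : (fun p : Space n × Dir n => X.indicator σ p.1 p.2) =
        (Prod.fst ⁻¹' X).indicator fun p => σ p.1 p.2 := by
      funext p
      by_cases hp : p.1 ∈ X <;> simp [hp, indicator]
    rw [this]
    exact h.measurable_sigma.indicator (measurable_fst hX)
  · have : (fun p : Space n × Dir n × Dir n => X.indicator k p.1 p.2.1 p.2.2) =
        (Prod.fst ⁻¹' X).indicator fun p => k p.1 p.2.1 p.2.2 := by
      funext p
      by_cases hp : p.1 ∈ X <;> simp [hp, indicator]
    rw [this]
    exact h.measurable_k.indicator (measurable_fst hX)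
  all_goals by_cases hx : x ∈ X
  · simpa [hx] using h.sigma_nonneg x hx v
  · simp [hx]
  · simpa [hx] using h.k_nonneg x hx v' v
  · simp [hx]
  · simpa [hx] using Or.inl (hM x hx v).1
  · simp [hx]
  · simpa [hx] using Or.inl ((hM x hx v).2 v')
  · simp [hx]

theorem sigmaA_congr {x : Space n} (h : σ' x = σ x ∧ k' x = k x) (v : Dir n) :
    sigmaA σ' k' x v = sigmaA σ k x v := by
  rw [sigmaA, sigmaA, sigmaS, sigmaS, h.1, h.2]

theorem ballisticProfile_congr (hX : IsSmoothConvexDomain X)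
    (h : ∀ x ∈ X, σ' x = σ x ∧ k' x = k x) {p : Space n × Dir n} (hp : p ∈ inflow X) {t : ℝ}
    (ht : t ∈ Ioo 0 (escapeTime X p.1 p.2)) :
    ballisticProfile σ' k' p.1 p.2 t = ballisticProfile σ k p.1 p.2 t := by
  rw [ballisticProfile, ballisticProfile, sigmaA_congr (h _ (hX.flow_mem hp ht)),
    intervalIntegral.integral_of_le ht.1.le, intervalIntegral.integral_of_le ht.1.le]
  congr 3
  refine setIntegral_congr_fun measurableSet_Ioc fun s hs => ?_
  rw [(h _ (hX.flow_mem hp ⟨hs.1, hs.2.trans_lt ht.2⟩)).1]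

theorem IsTransportSolution.congr (hX : IsSmoothConvexDomain X)
    (h : ∀ x ∈ X, σ' x = σ x ∧ k' x = k x) {φ u : Space n × Dir n → ℝ}
    (hu : IsTransportSolution X σ' k' φ u) : IsTransportSolution X σ k φ u := by
  filter_upwards [hu, hX.ae_mem_inflow] with p ⟨U, hU, hU0, hUd⟩ hp
  refine ⟨U, hU, hU0, ?_⟩
  filter_upwards [hUd, ae_restrict_mem measurableSet_Ioo] with t h1 ht
  have h2 := h _ (hX.flow_mem hp ht)
  rw [h2.1, h2.2] at h1
  exact h1

theorem IsAlbedoOperator.congr (hX : IsSmoothConvexDomain X)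
    (h : ∀ x ∈ X, σ' x = σ x ∧ k' x = k x)
    {A : Lp ℝ 1 (inflowMeasure X) →L[ℝ] Lp ℝ 1 ((volume : Measure (Space n)).restrict X)}
    (hA : IsAlbedoOperator X σ' k' A) : IsAlbedoOperator X σ k A := by
  intro φ
  obtain ⟨u, hu, hun, hAu⟩ := hA φ
  refine ⟨u, hu.congr hX h, fun w hw => hun w (hw.congr hX fun x hx =>
    ⟨(h x hx).1.symm, (h x hx).2.symm⟩), ?_⟩
  filter_upwards [hAu, ae_restrict_mem hX.isOpen.measurableSet] with x h1 hx
  rw [h1]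
  exact integral_congr_ae (Eventually.of_forall fun v => by
    dsimp only
    rw [sigmaA_congr (h x hx)])

theorem IsAlbedoOperator.albedoOperator_eq
    {A : Lp ℝ 1 (inflowMeasure X) →L[ℝ] Lp ℝ 1 ((volume : Measure (Space n)).restrict X)}
    (hA : IsAlbedoOperator X σ k A) : albedoOperator X σ k = A := by
  have h : ∃ A, IsAlbedoOperator X σ k A := ⟨A, hA⟩
  rw [albedoOperator, dif_pos h]
  exact h.choose_spec.unique hA

/-- The weighted averages of the ballistic profile over the rays, as seen by the albedo operator. -/
theorem IsAdmissible.exists_ballistic_approx (hX : IsSmoothConvexDomain X)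
    (h : IsAdmissible X σ k) :
    (∀ p ∈ inflow X, IntegrableOn (ballisticProfile σ k p.1 p.2)
      (Ioo 0 (escapeTime X p.1 p.2))) ∧ ∃ C : ℝ, 0 ≤ C ∧
      ∀ ψ : Space n → ℝ, Measurable ψ → (∀ x, |ψ x| ≤ 1) →
        Integrable (fun p : Space n × Dir n => ∫ t in Ioo 0 (escapeTime X p.1 p.2),
          ψ (p.1 + t • (p.2 : Space n)) * ballisticProfile σ k p.1 p.2 t) (inflowMeasure X) ∧
        ∀ η : ℝ, 0 < η → ∀ φ : Lp ℝ 1 (inflowMeasure X),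
        |(∫ x in X, ψ x * albedoOperator X σ k φ x) -
          ∫ p, φ p * (∫ t in Ioo 0 (escapeTime X p.1 p.2),
            ψ (p.1 + t • (p.2 : Space n)) * ballisticProfile σ k p.1 p.2 t)
              ∂(inflowMeasure X)| ≤
        C * (η + (η ^ (n - 1))⁻¹ * ∫ x in X, |ψ x|) * ‖φ‖ := by
  obtain ⟨σ', k', M, hc, heq⟩ := h.exists_isBoundedCoefficients hX.isOpen.measurableSet
  obtain ⟨σ₀, hσ₀, ha⟩ := h.sigmaA_pos
  have ha' : ∀ᵐ z ∂(phaseMeasure X), σ₀ ≤ sigmaA σ' k' z.1 z.2 := by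
    filter_upwards [ha, ae_mem_phaseMeasure hX] with z h1 h2
    rwa [sigmaA_congr (heq _ h2)]
  obtain ⟨A, C, hA, hC, hAC⟩ := exists_isAlbedoOperator_approx hX hc hσ₀ ha'
  have havg : ∀ (ψ : Space n → ℝ), ∀ p ∈ inflow X, ∫ t in Ioo 0 (escapeTime X p.1 p.2),
      ψ (p.1 + t • (p.2 : Space n)) * ballisticProfile σ' k' p.1 p.2 t =
      ∫ t in Ioo 0 (escapeTime X p.1 p.2),
        ψ (p.1 + t • (p.2 : Space n)) * ballisticProfile σ k p.1 p.2 t := fun ψ p hp =>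
    setIntegral_congr_fun measurableSet_Ioo fun t ht => by
      rw [ballisticProfile_congr hX heq hp ht]
  refine ⟨fun p hp => (integrableOn_ballisticProfile hc p.1 p.2 _).congr_fun
    (fun t ht => ballisticProfile_congr hX heq hp ht) measurableSet_Ioo, C, hC,
    fun ψ hψ hψ1 => ⟨?_, fun η hη φ => ?_⟩⟩
  · exact (integrable_ballistic_average hX hc hψ hψ1).congr
      (hX.ae_mem_inflow.mono fun p hp => havg ψ p hp)
  · rw [(hA.congr hX heq).albedoOperator_eq]
    refine le_of_eq_of_le ?_ (hAC ψ hψ hψ1 η hη φ)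
    congr 2
    exact integral_congr_ae (hX.ae_mem_inflow.mono fun p hp => by
      dsimp only
      rw [havg ψ p hp])

end Extension

end

/-! ### From weighted averages to rays -/

section

variable {n : ℕ} {X : Set (Space n)}

/-- A function whose averages are bounded by `c` is bounded by `c`. -/
theorem ae_abs_le_of_forall_abs_setIntegral_le {α : Type*} [MeasurableSpace α] {μ : Measure α}
    [IsFiniteMeasure μ] {g : α → ℝ} (hg : Integrable g μ) {c : ℝ}
    (h : ∀ s, MeasurableSet s → |∫ x in s, g x ∂μ| ≤ c * μ.real s) : ∀ᵐ x ∂μ, |g x| ≤ c := by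
  have h1 : g ≤ᵐ[μ] fun _ => c :=
    ae_le_of_forall_setIntegral_le hg (integrable_const c) fun s hs _ => by
      rw [setIntegral_const, smul_eq_mul, mul_comm]
      exact (le_abs_self _).trans (h s hs)
  have h2 : (fun x => -g x) ≤ᵐ[μ] fun _ => c :=
    ae_le_of_forall_setIntegral_le hg.neg (integrable_const c) fun s hs _ => by
      rw [setIntegral_const, smul_eq_mul, mul_comm, integral_neg]
      exact (neg_le_abs _).trans (h s hs)
  filter_upwards [h1, h2] with x h3 h4
  exact abs_le'.2 ⟨h3, h4⟩

/-- Two operators on `L¹` whose pairings with a weight `ψ` are, up to errors, the integrations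
against `b` and `b'`: the difference `b - b'` is controlled by the distance of the operators. -/
theorem ae_abs_sub_le_of_approx {α β : Type*} [MeasurableSpace α] [MeasurableSpace β]
    {μ : Measure α} [IsFiniteMeasure μ] {ν : Measure β} {A A' : Lp ℝ 1 μ →L[ℝ] Lp ℝ 1 ν}
    {ψ : β → ℝ} (hψ : Measurable ψ) (hψ1 : ∀ x, |ψ x| ≤ 1) {b b' : α → ℝ} (hb : Integrable b μ)
    (hb' : Integrable b' μ) {e e' : ℝ}
    (h : ∀ φ : Lp ℝ 1 μ, |(∫ x, ψ x * A φ x ∂ν) - ∫ p, φ p * b p ∂μ| ≤ e * ‖φ‖)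
    (h' : ∀ φ : Lp ℝ 1 μ, |(∫ x, ψ x * A' φ x ∂ν) - ∫ p, φ p * b' p ∂μ| ≤ e' * ‖φ‖) :
    ∀ᵐ p ∂μ, |b p - b' p| ≤ ‖A - A'‖ + (e + e') := by
  refine ae_abs_le_of_forall_abs_setIntegral_le (hb.sub hb') fun s hs => ?_
  set φ : Lp ℝ 1 μ := indicatorConstLp 1 hs (measure_ne_top μ s) 1 with hφ
  have hφn : ‖φ‖ = μ.real s := by
    rw [hφ, norm_indicatorConstLp one_ne_zero ENNReal.one_ne_top]
    simp
  have hφb : ∀ g : α → ℝ, ∫ p, φ p * g p ∂μ = ∫ p in s, g p ∂μ := by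
    intro g
    rw [← integral_indicator hs]
    refine integral_congr_ae ?_
    filter_upwards [indicatorConstLp_coeFn (p := 1) (hs := hs) (hμs := measure_ne_top μ s)
      (c := (1 : ℝ))] with x hx
    rw [hφ, hx]
    by_cases hxs : x ∈ s <;> simp [hxs]
  have h1 := h φ
  have h2 := h' φ
  rw [hφb, hφn] at h1 h2
  have hi : ∀ g : Lp ℝ 1 ν, Integrable (fun x => ψ x * g x) ν := fun g =>
    integrable_weight_mul hψ hψ1 (L1.integrable_coeFn g)
  have h3 : |(∫ x, ψ x * A φ x ∂ν) - ∫ x, ψ x * A' φ x ∂ν| ≤ ‖A - A'‖ * μ.real s := by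
    rw [← hφn, ← integral_sub (hi _) (hi _)]
    refine le_trans ?_ ((A - A').le_opNorm φ)
    rw [sub_apply, L1.norm_eq_integral_norm, ← Real.norm_eq_abs]
    refine (norm_integral_le_integral_norm _).trans ?_
    refine integral_mono_ae ((hi _).sub (hi _)).norm (L1.integrable_coeFn _).norm ?_
    filter_upwards [Lp.coeFn_sub (A φ) (A' φ)] with x hx
    rw [hx, Pi.sub_apply, ← mul_sub, norm_mul]
    exact mul_le_of_le_one_left (norm_nonneg _) (hψ1 x)
  simp only [Pi.sub_apply]
  rw [integral_sub hb.integrableOn hb'.integrableOn]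
  rw [abs_le] at h1 h2 h3 ⊢
  constructor <;> linarith [h1.1, h1.2, h2.1, h2.2, h3.1, h3.2]

/-- Duality between `L¹` and the continuous functions of modulus at most one. -/
theorem integral_abs_le_of_forall_continuous {μ : Measure ℝ} [IsFiniteMeasure μ] [μ.WeaklyRegular]
    {γ : ℝ → ℝ} (hγ : Integrable γ μ) {N : ℝ}
    (h : ∀ g : ℝ → ℝ, Continuous g → (∀ t, |g t| ≤ 1) → |∫ t, g t * γ t ∂μ| ≤ N) :
    ∫ t, |γ t| ∂μ ≤ N := by
  have key : ∀ ε : ℝ, 0 < ε → ∫ t, |γ t| ∂μ ≤ N + ε * (2 + μ.real univ) := by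
    intro ε hε
    obtain ⟨b, hb, hbi⟩ := hγ.exists_boundedContinuous_integral_sub_le hε
    have hpos : ∀ t, 0 < |b t| + ε := fun t => by positivity
    -- a continuous substitute for the sign of `b`
    set g : ℝ → ℝ := fun t => b t / (|b t| + ε) with hg
    have hgc : Continuous g :=
      b.continuous.div (b.continuous.abs.add continuous_const) fun t => (hpos t).ne'
    have hg1 : ∀ t, |g t| ≤ 1 := fun t => by
      rw [hg, abs_div, abs_of_pos (hpos t), div_le_one (hpos t)]
      linarith
    have hgγ : Integrable (fun t => g t * γ t) μ :=
      hγ.bdd_mul hgc.aestronglyMeasurable (Eventually.of_forall hg1)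
    have hpt : ∀ t, |γ t| ≤ g t * γ t + 2 * |γ t - b t| + ε := by
      intro t
      have h1 : |b t| - ε ≤ g t * b t := by
        rw [hg, div_mul_eq_mul_div, le_div_iff₀ (hpos t), ← abs_mul_abs_self (b t)]
        nlinarith [abs_nonneg (b t)]
      have h2 : |γ t| ≤ |b t| + |γ t - b t| := by
        have := abs_add_le (b t) (γ t - b t)
        rwa [add_sub_cancel] at this
      have h3 : g t * b t - g t * γ t ≤ |γ t - b t| := by
        rw [← mul_sub, abs_sub_comm]
        refine (le_abs_self _).trans ?_
        rw [abs_mul]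
        exact mul_le_of_le_one_left (abs_nonneg _) (hg1 t)
      linarith
    have hd : Integrable (fun t => 2 * |γ t - b t|) μ := (hγ.sub hbi).abs.const_mul 2
    calc ∫ t, |γ t| ∂μ ≤ ∫ t, (g t * γ t + 2 * |γ t - b t| + ε) ∂μ :=
          integral_mono hγ.abs ((hgγ.add hd).add (integrable_const ε)) hpt
      _ = (∫ t, g t * γ t ∂μ) + 2 * ∫ t, |γ t - b t| ∂μ + ε * μ.real univ := by
          rw [integral_add (f := fun t => g t * γ t + 2 * |γ t - b t|) (hgγ.add hd)
            (integrable_const ε), integral_add hgγ hd, integral_const_mul, integral_const,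
            smul_eq_mul, mul_comm ε]
      _ ≤ N + 2 * ε + ε * μ.real univ := by
          gcongr
          · exact (le_abs_self _).trans (h g hgc hg1)
          · exact hb
      _ = _ := by ring
  have hlim : Tendsto (fun ε : ℝ => N + ε * (2 + μ.real univ)) (𝓝[>] 0) (𝓝 N) := by
    have : Continuous fun ε : ℝ => N + ε * (2 + μ.real univ) := by fun_prop
    have h2 := this.tendsto 0
    simp only [zero_mul, add_zero] at h2
    exact h2.mono_left nhdsWithin_le_nhds
  exact ge_of_tendsto hlim (eventually_mem_nhdsWithin.mono key)

/-- If the continuous functions of modulus at most one have, one at a time, almost everywhere the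
bound below, then almost everywhere they all have it: there is a dense sequence of them. -/
theorem ae_forall_continuous_abs_integral_le {P Y : Type*} [MeasurableSpace P] {μ : Measure P}
    [TopologicalSpace Y] [LocallyCompactSpace Y] [SecondCountableTopology Y] [MeasurableSpace Y]
    [BorelSpace Y] {ν : Measure Y} [IsFiniteMeasure ν] {ρ : P → Measure ℝ}
    {F : P → ℝ → Y} {γ : P → ℝ → ℝ} (hF : ∀ p, Continuous (F p))
    (hγ : ∀ᵐ p ∂μ, Integrable (γ p) (ρ p)) {N : ℝ} {a b : ℕ → ℝ}
    (h : ∀ ψ : Y → ℝ, Measurable ψ → (∀ x, |ψ x| ≤ 1) → ∀ m : ℕ, ∀ᵐ p ∂μ,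
      |∫ t, ψ (F p t) * γ p t ∂(ρ p)| ≤ N + (a m + b m * ∫ x, |ψ x| ∂ν)) :
    ∀ᵐ p ∂μ, ∀ ψ : Y → ℝ, Continuous ψ → (∀ x, |ψ x| ≤ 1) → ∀ m : ℕ,
      |∫ t, ψ (F p t) * γ p t ∂(ρ p)| ≤ N + (a m + b m * ∫ x, |ψ x| ∂ν) := by
  set d := TopologicalSpace.denseSeq C(Y, ℝ) with hd
  -- truncation to `[-1, 1]`
  set cl : ℝ → ℝ := fun r => max (-1) (min 1 r) with hcl
  have hclc : Continuous cl := by fun_prop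
  have hcl1 : ∀ r, |cl r| ≤ 1 := fun r => abs_le.2 ⟨le_max_left _ _,
    max_le (by norm_num) (min_le_left _ _)⟩
  have hclid : ∀ r, |r| ≤ 1 → cl r = r := fun r hr => by
    rw [hcl]
    dsimp only
    rw [min_eq_right (abs_le.1 hr).2, max_eq_right (abs_le.1 hr).1]
  have hall : ∀ᵐ p ∂μ, ∀ i m : ℕ, |∫ t, cl (d i (F p t)) * γ p t ∂(ρ p)| ≤
      N + (a m + b m * ∫ x, |cl (d i x)| ∂ν) :=
    ae_all_iff.2 fun i => ae_all_iff.2 fun m =>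
      h (fun x => cl (d i x)) (hclc.comp (d i).continuous).measurable (fun x => hcl1 _) m
  filter_upwards [hall, hγ] with p hp hpγ ψ hψ hψ1 m
  obtain ⟨e, he, hlim⟩ := mem_closure_iff_seq_limit.1
    ((TopologicalSpace.denseRange_denseSeq C(Y, ℝ)) ⟨ψ, hψ⟩)
  choose i hi using he
  have hpt : ∀ x, Tendsto (fun j => cl (d (i j) x)) atTop (𝓝 (ψ x)) := by
    intro x
    have h1 := (hclc.tendsto _).comp
      (((continuous_eval_const x).tendsto _).comp hlim)
    have h2 : cl ((⟨ψ, hψ⟩ : C(Y, ℝ)) x) = ψ x := hclid _ (hψ1 x)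
    rw [h2] at h1
    refine h1.congr fun j => ?_
    simp only [Function.comp_apply, hd, hi]
  have hl : Tendsto (fun j => ∫ t, cl (d (i j) (F p t)) * γ p t ∂(ρ p)) atTop
      (𝓝 (∫ t, ψ (F p t) * γ p t ∂(ρ p))) := by
    refine tendsto_integral_of_dominated_convergence (fun t => |γ p t|) (fun j => ?_) hpγ.abs
      (fun j => Eventually.of_forall fun t => ?_)
      (Eventually.of_forall fun t => (hpt _).mul_const _)
    · exact ((hclc.comp ((d (i j)).continuous.comp (hF p))).aestronglyMeasurable).mul
        hpγ.aestronglyMeasurable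
    · rw [norm_mul]
      exact mul_le_of_le_one_left (abs_nonneg _) (hcl1 _)
  have hr : Tendsto (fun j => ∫ x, |cl (d (i j) x)| ∂ν) atTop (𝓝 (∫ x, |ψ x| ∂ν)) := by
    refine tendsto_integral_of_dominated_convergence (fun _ => 1) (fun j => ?_)
      (integrable_const 1) (fun j => Eventually.of_forall fun x => ?_)
      (Eventually.of_forall fun x => (hpt x).abs)
    · exact (hclc.comp (d (i j)).continuous).abs.aestronglyMeasurable
    · rw [Real.norm_eq_abs, abs_abs]
      exact hcl1 _
  exact le_of_tendsto_of_tendsto' hl.abs (((hr.const_mul _).const_add _).const_add _)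
    fun j => hp (i j) m

/-- A line is a null set in dimension at least two. -/
theorem volume_line_eq_zero (hn : 2 ≤ n) (x : Space n) (v : Dir n) :
    volume {y : Space n | y - x - ⟪(v : Space n), y - x⟫ • (v : Space n) = 0} = 0 := by
  refine measure_mono_null (fun y hy => ?_) (Measure.addHaar_affineSubspace volume
    (AffineSubspace.mk' x (ℝ ∙ (v : Space n))) fun htop => ?_)
  · rw [SetLike.mem_coe, AffineSubspace.mem_mk', vsub_eq_sub, Submodule.mem_span_singleton]
    exact ⟨_, (sub_eq_zero.1 hy).symm⟩
  · have h1 := congrArg AffineSubspace.direction htop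
    rw [AffineSubspace.direction_mk', AffineSubspace.direction_top] at h1
    have h2 := finrank_span_singleton (K := ℝ) (ne_zero_of_mem_unit_sphere v)
    rw [h1, finrank_top, finrank_euclideanSpace_fin] at h2
    omega

/-- Functions concentrated near a line recover the values along the line. -/
theorem integral_abs_ray_le (hn : 2 ≤ n) {ν : Measure (Space n)} [IsFiniteMeasure ν]
    (hν : ν ≪ volume) {ρ : Measure ℝ} [IsFiniteMeasure ρ] [ρ.WeaklyRegular] {γ : ℝ → ℝ}
    (hγ : Integrable γ ρ) {N : ℝ} {a b : ℕ → ℝ} (ha : Tendsto a atTop (𝓝 0)) (x : Space n)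
    (v : Dir n)
    (h : ∀ ψ : Space n → ℝ, Continuous ψ → (∀ x, |ψ x| ≤ 1) → ∀ m : ℕ,
      |∫ t, ψ (x + t • (v : Space n)) * γ t ∂ρ| ≤ N + (a m + b m * ∫ x, |ψ x| ∂ν)) :
    ∫ t, |γ t| ∂ρ ≤ N := by
  refine integral_abs_le_of_forall_continuous hγ fun g hg hg1 => ?_
  set D : Space n → ℝ := fun y => ‖y - x - ⟪(v : Space n), y - x⟫ • (v : Space n)‖ with hD
  have hDc : Continuous D := by fun_prop
  have hv : ⟪(v : Space n), (v : Space n)⟫ = 1 := by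
    rw [real_inner_self_eq_norm_sq]
    simp
  -- cut-off functions that are one on the line and vanish at distance at least `1 / j` from it
  set χ : ℕ → Space n → ℝ := fun j y => max 0 (1 - j * D y) with hχ
  have hχ0 : ∀ j y, 0 ≤ χ j y := fun j y => le_max_left _ _
  have hχ1 : ∀ j y, χ j y ≤ 1 := fun j y => max_le zero_le_one
    (sub_le_self _ (mul_nonneg j.cast_nonneg (norm_nonneg _)))
  set ψ : ℕ → Space n → ℝ := fun j y => g ⟪(v : Space n), y - x⟫ * χ j y with hψ
  have hψc : ∀ j, Continuous (ψ j) := fun j => by fun_prop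
  have hψ1 : ∀ j y, |ψ j y| ≤ 1 := fun j y => by
    rw [hψ, abs_mul, abs_of_nonneg (hχ0 j y)]
    exact mul_le_one₀ (hg1 _) (hχ0 j y) (hχ1 j y)
  have hray : ∀ j t, ψ j (x + t • (v : Space n)) = g t := fun j t => by
    simp only [hψ, hχ, hD, add_sub_cancel_left, inner_smul_right, hv, mul_one, sub_self,
      norm_zero, mul_zero, sub_zero, max_eq_right zero_le_one]
  have hlim : Tendsto (fun j => ∫ y, |ψ j y| ∂ν) atTop (𝓝 0) := by
    rw [← integral_zero (Space n) ℝ (μ := ν)]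
    refine tendsto_integral_of_dominated_convergence (fun _ => 1)
      (fun j => (hψc j).abs.aestronglyMeasurable) (integrable_const 1)
      (fun j => Eventually.of_forall fun y => by
        rw [Real.norm_eq_abs, abs_abs]; exact hψ1 j y) ?_
    have hoff : ∀ᵐ y ∂ν, y - x - ⟪(v : Space n), y - x⟫ • (v : Space n) ≠ 0 :=
      hν (measure_eq_zero_iff_ae_notMem.1 (volume_line_eq_zero hn x v))
    filter_upwards [hoff] with y hy
    have hDy : 0 < D y := norm_pos_iff.2 hy
    obtain ⟨J, hJ⟩ := exists_nat_gt (1 / D y)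
    refine tendsto_const_nhds.congr' ?_
    filter_upwards [eventually_ge_atTop J] with j hj
    have h1 : 1 ≤ j * D y := by
      rw [← div_le_iff₀ hDy]
      exact hJ.le.trans (Nat.cast_le.2 hj)
    simp only [hψ, hχ, max_eq_left (sub_nonpos.2 h1), mul_zero, abs_zero]
  have h1 : ∀ m, |∫ t, g t * γ t ∂ρ| ≤ N + (a m + b m * 0) := fun m =>
    ge_of_tendsto' (((hlim.const_mul (b m)).const_add (a m)).const_add N) fun j => by
      have h2 := h (ψ j) (hψc j) (hψ1 j) m
      simpa only [hray] using h2
  simp only [mul_zero, add_zero] at h1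
  have h3 := ha.const_add N
  rw [add_zero] at h3
  exact ge_of_tendsto' h3 h1

end

/-! ### Stability of the ballistic part -/

section

variable {n : ℕ} {X : Set (Space n)}

/-- Testing the difference of two albedo operators against a weight controls the weighted averages
of the difference of the ballistic profiles along almost every ray. -/
theorem ae_abs_ballistic_average_le {σ σ' : Space n → Dir n → ℝ}
    {k k' : Space n → Dir n → Dir n → ℝ} (hX : IsSmoothConvexDomain X) (h : IsAdmissible X σ k)
    (h' : IsAdmissible X σ' k') :
    ∃ C : ℝ, ∀ ψ : Space n → ℝ, Measurable ψ → (∀ x, |ψ x| ≤ 1) → ∀ η : ℝ, 0 < η →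
      ∀ᵐ p ∂(inflowMeasure X), |∫ t in Ioo 0 (escapeTime X p.1 p.2),
        ψ (p.1 + t • (p.2 : Space n)) *
          (ballisticProfile σ k p.1 p.2 t - ballisticProfile σ' k' p.1 p.2 t)| ≤
        ‖albedoOperator X σ k - albedoOperator X σ' k'‖ +
          C * (η + (η ^ (n - 1))⁻¹ * ∫ x in X, |ψ x|) := by
  have hfin := hX.isFiniteMeasure_inflowMeasure
  obtain ⟨hi, C, -, hC⟩ := h.exists_ballistic_approx hX
  obtain ⟨hi', C', -, hC'⟩ := h'.exists_ballistic_approx hX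
  refine ⟨C + C', fun ψ hψ hψ1 η hη => ?_⟩
  obtain ⟨hb, hCψ⟩ := hC ψ hψ hψ1
  obtain ⟨hb', hCψ'⟩ := hC' ψ hψ hψ1
  have hbound := ae_abs_sub_le_of_approx hψ hψ1 hb hb' (hCψ η hη) (hCψ' η hη)
  filter_upwards [hbound, hX.ae_mem_inflow] with p hp hpi
  refine le_of_eq_of_le ?_ (hp.trans_eq (by ring))
  have hpm : Measurable fun t : ℝ => ψ (p.1 + t • (p.2 : Space n)) := hψ.comp (by fun_prop)
  rw [← integral_sub (integrable_weight_mul hpm (fun t => hψ1 _) (hi p hpi))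
    (integrable_weight_mul hpm (fun t => hψ1 _) (hi' p hpi))]
  simp only [mul_sub]

end

end Transport

end

theorem theorem2p3 {n : ℕ} (hn : 2 ≤ n) (X : Set (Transport.Space n))
    (hXopen : IsOpen X) (hXbdd : Bornology.IsBounded X) (hXconv : Convex ℝ X)
    (hXC1 : Transport.HasC1Boundary X)
    (σ σ' : Transport.Space n → Transport.Dir n → ℝ)
    (k k' : Transport.Space n → Transport.Dir n → Transport.Dir n → ℝ)
    (h : Transport.IsAdmissible X σ k) (h' : Transport.IsAdmissible X σ' k') :
    ∀ᵐ p ∂(Transport.inflowMeasure X),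
      IntervalIntegrable
        (fun t => Transport.ballisticProfile σ k p.1 p.2 t
          - Transport.ballisticProfile σ' k' p.1 p.2 t)
        volume 0 (Transport.escapeTime X p.1 p.2) ∧
      ∫ t in (0 : ℝ)..(Transport.escapeTime X p.1 p.2),
          |Transport.ballisticProfile σ k p.1 p.2 t
            - Transport.ballisticProfile σ' k' p.1 p.2 t|
        ≤ ‖Transport.albedoOperator X σ k - Transport.albedoOperator X σ' k'‖ := by
  have hX : Transport.IsSmoothConvexDomain X := ⟨by omega, hXopen, hXbdd, hXconv, hXC1⟩
  have hfinX : IsFiniteMeasure ((volume : Measure (Transport.Space n)).restrict X) :=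
    isFiniteMeasure_restrict.2 hXbdd.measure_lt_top.ne
  obtain ⟨C, hC⟩ := Transport.ae_abs_ballistic_average_le hX h h'
  obtain ⟨hi, -⟩ := h.exists_ballistic_approx hX
  obtain ⟨hi', -⟩ := h'.exists_ballistic_approx hX
  -- the radii at which the scattered particles are cut off
  have hη : ∀ m : ℕ, (0 : ℝ) < 1 / (m + 1) := fun m => Nat.one_div_pos_of_nat
  have hall := Transport.ae_forall_continuous_abs_integral_le
    (μ := Transport.inflowMeasure X) (ν := (volume : Measure (Transport.Space n)).restrict X)
    (ρ := fun p => volume.restrict (Ioo 0 (Transport.escapeTime X p.1 p.2)))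
    (F := fun p t => p.1 + t • (p.2 : Transport.Space n))
    (γ := fun p t => Transport.ballisticProfile σ k p.1 p.2 t
      - Transport.ballisticProfile σ' k' p.1 p.2 t)
    (N := ‖Transport.albedoOperator X σ k - Transport.albedoOperator X σ' k'‖)
    (a := fun m => C * (1 / (m + 1))) (b := fun m => C * ((1 / (m + 1) : ℝ) ^ (n - 1))⁻¹)
    (fun p => by fun_prop)
    (hX.ae_mem_inflow.mono fun p hp => (hi p hp).sub (hi' p hp))
    (fun ψ hψ hψ1 m => (hC ψ hψ hψ1 _ (hη m)).mono fun p hp => hp.trans_eq (by ring))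
  filter_upwards [hall, hX.ae_mem_inflow] with p hp hpi
  have hint := (hi p hpi).sub (hi' p hpi)
  have hτ := (hX.escapeTime_pos hpi).le
  refine ⟨(intervalIntegrable_iff_integrableOn_Ioo_of_le hτ).2 hint, ?_⟩
  rw [intervalIntegral.integral_of_le hτ, integral_Ioc_eq_integral_Ioo]
  have ha : Filter.Tendsto (fun m : ℕ => C * (1 / ((m : ℝ) + 1))) Filter.atTop (nhds 0) := by
    simpa using tendsto_one_div_add_atTop_nhds_zero_nat.const_mul C
  exact Transport.integral_abs_ray_le hn Measure.absolutelyContinuous_restrict hint ha p.1 p.2 hp
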